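/- Put $F(x,y,z)=(\zeta+2)xyz-\zeta(xy+yz+xz+x+y+z)+\zeta(2\zeta+1)$ and $G(x,y)=(\zeta+2)xy(x+y)-\zeta(x^2+y^2)-2(\zeta^2+3\zeta+1)xy+\zeta(2\zeta+1)(x+y)$, and for $n\ge 0$ let $$S_n(x_1,\dots,x_n,y_1,\dots,y_n,z)=\frac{\prod_{i,j=1}^n G(x_i,y_j)}{\prod_{1\le i<j\le n}(x_j-x_i)(y_j-y_i)}\,\det_{1\le i,j\le n}\left(\frac{F(x_i,y_j,z)}{G(x_i,y_j)}\right),$$ which is a (symmetric) polynomial in $x_1,\dots,x_n,y_1,\dots,y_n,z$ with coefficients polynomial in $\zeta$. Let $p_n(\zeta)$, $n\ge 0$, be the polynomial (of degree $n(n+1)/2$) determined by $$\left(1+\tfrac{\zeta}{2}\right)^{n^2}S_n\Big(\underbrace{2\zeta+1,\dots,2\zeta+1}_{n+1},\underbrace{\tfrac{\zeta}{\zeta+2},\dots,\tfrac{\zeta}{\zeta+2}}_{n}\Big)=(-1)^{\binom{n+1}{2}}\zeta^{n^2}(1+\zeta)^{n^2}(1+2\zeta)^{[n^2/4]}\left(1+\tfrac{\zeta}{2}\right)^{[(n-1)^2/4]}p_n(\zeta),$$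 and let $\tilde p_n(\zeta)=\zeta^{\deg p_n}p_n(1/\zeta)$. For example, $p_0=1$, $p_1=3\zeta+1$ and $p_2=5\zeta^3+15\zeta^2+7\zeta+1$. Assume that, for every $n\ge 0$, the polynomial $p_n$ has exactly $[(n+1)/2]$ real zeroes, counted with multiplicity (Conjecture 3.10). Then: 1. For every $n\ge 0$, all real zeroes of $p_n$ are simple; they lie in the interval $-1/2<\zeta<0$ if $n$ is odd and in $\zeta<-2$ if $n$ is even. 2. For every $n\ge 0$, let $a_1<\dots<a_n$ be the real zeroes of $p_{2n}$, $b_1<b_2<\dots$ those of $\tilde p_{2n+1}$, and $c_1<c_2<\dots$ those of $p_{2n+2}$. There are exactly $n$ zeroes $a_i$, $n+1$ zeroes $b_i$ and $n+1$ zeroes $c_i$, and $$b_1<a_1<b_2<a_2<\dots<a_n<b_{n+1},\qquad b_1<c_1<b_2<c_2<\dots<b_{n+1}<c_{n+1}.$$ 3. For every $n\ge 0$, $p_n$ does not vanish in the interval $-2<\zeta<-1/2$ (Conjecture 3.11). -/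

import Mathlib

namespace ThreeColour

open Polynomial

/-- The polynomial `F(x, y, z)`, with parameter `ζ`. -/
def F {A : Type*} [CommRing A] (ζ x y z : A) : A :=
  (ζ + 2) * x * y * z - ζ * (x * y + y * z + x * z + x + y + z) + ζ * (2 * ζ + 1)

/-- The polynomial `G(x, y)`, with parameter `ζ`. -/
def G {A : Type*} [CommRing A] (ζ x y : A) : A :=
  (ζ + 2) * x * y * (x + y) - ζ * (x ^ 2 + y ^ 2) - 2 * (ζ ^ 2 + 3 * ζ + 1) * x * y
    + ζ * (2 * ζ + 1) * (x + y)

/-- The index set of the `2n+1` variables `x₁, …, xₙ, y₁, …, yₙ, z`. -/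
abbrev Vars (n : ℕ) : Type := Fin n ⊕ Fin n ⊕ Unit

/-- Polynomials in `x₁, …, xₙ, y₁, …, yₙ, z` over `ℝ[ζ]`. -/
abbrev PolyRing (n : ℕ) : Type := MvPolynomial (Vars n) ℝ[X]

/-- The parameter `ζ` as an element of the polynomial ring. -/
noncomputable def zeta (n : ℕ) : PolyRing n := MvPolynomial.C Polynomial.X

/-- The variable `xᵢ`. -/
noncomputable def xv {n : ℕ} (i : Fin n) : PolyRing n := MvPolynomial.X (Sum.inl i)

/-- The variable `yᵢ`. -/
noncomputable def yv {n : ℕ} (i : Fin n) : PolyRing n := MvPolynomial.X (Sum.inr (Sum.inl i))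

/-- The variable `z`. -/
noncomputable def zv (n : ℕ) : PolyRing n := MvPolynomial.X (Sum.inr (Sum.inr ()))

/-- `∏_{i<j} (x_j - x_i)(y_j - y_i)`. -/
noncomputable def vdm (n : ℕ) : PolyRing n :=
  ∏ i : Fin n, ∏ j ∈ Finset.Ioi i, ((xv j - xv i) * (yv j - yv i))

/-- The rational function
`∏_{i,j} G(xᵢ, yⱼ) / ∏_{i<j} (x_j - x_i)(y_j - y_i) * det (F(xᵢ, yⱼ, z) / G(xᵢ, yⱼ))`. -/
noncomputable def SRat (n : ℕ) : FractionRing (PolyRing n) :=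
  let q := algebraMap (PolyRing n) (FractionRing (PolyRing n))
  q (∏ i : Fin n, ∏ j : Fin n, G (zeta n) (xv i) (yv j)) / q (vdm n) *
    Matrix.det (Matrix.of fun i j : Fin n =>
      q (F (zeta n) (xv i) (yv j) (zv n)) / q (G (zeta n) (xv i) (yv j)))

/-- Substitution of `X a` for `X b`. -/
noncomputable def substX {σ : Type*} [DecidableEq σ] (R : Type*) [CommRing R] (a b : σ) :
    MvPolynomial σ R →ₐ[R] MvPolynomial σ R :=
  MvPolynomial.aeval fun c => MvPolynomial.X (Function.update id b a c)

theorem dvd_iff_subst {σ R : Type*} [DecidableEq σ] [CommRing R] (a b : σ) (P : MvPolynomial σ R) :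
    (MvPolynomial.X b - MvPolynomial.X a : MvPolynomial σ R) ∣ P ↔ substX R a b P = 0 := by
  constructor
  · rintro ⟨Q, rfl⟩
    by_cases h : a = b <;> simp [substX, h]
  · intro h
    set I : Ideal (MvPolynomial σ R) := Ideal.span {MvPolynomial.X b - MvPolynomial.X a}
    have key : (Ideal.Quotient.mkₐ R I).comp (substX R a b) = Ideal.Quotient.mkₐ R I := by
      apply MvPolynomial.algHom_ext
      intro c
      by_cases hc : c = b
      · subst hc
        simp only [substX, AlgHom.comp_apply, MvPolynomial.aeval_X, Function.update_self,
          Ideal.Quotient.mkₐ_eq_mk]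
        rw [Ideal.Quotient.eq, ← Ideal.neg_mem_iff, neg_sub]
        exact Ideal.mem_span_singleton_self _
      · simp [substX, hc]
    have h2 := DFunLike.congr_fun key P
    rw [AlgHom.comp_apply, h, map_zero, Ideal.Quotient.mkₐ_eq_mk, eq_comm,
      Ideal.Quotient.eq_zero_iff_mem, Ideal.mem_span_singleton] at h2
    exact h2

theorem X_sub_X_ne_zero {σ R : Type*} [CommRing R] [Nontrivial R] {a b : σ} (h : a ≠ b) :
    (MvPolynomial.X b - MvPolynomial.X a : MvPolynomial σ R) ≠ 0 := by
  rw [sub_ne_zero]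
  exact fun e => h (MvPolynomial.X_injective e).symm

theorem prime_X_sub_X {σ R : Type*} [DecidableEq σ] [CommRing R] [IsDomain R]
    {a b : σ} (h : a ≠ b) :
    Prime (MvPolynomial.X b - MvPolynomial.X a : MvPolynomial σ R) := by
  rw [← Ideal.span_singleton_prime (X_sub_X_ne_zero h)]
  have : Ideal.span {(MvPolynomial.X b - MvPolynomial.X a : MvPolynomial σ R)}
      = RingHom.ker (substX R a b) := by
    ext P
    rw [Ideal.mem_span_singleton, dvd_iff_subst, RingHom.mem_ker]
  rw [this]
  exact RingHom.ker_isPrime _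

theorem not_dvd {σ R : Type*} [DecidableEq σ] [CommRing R] [IsDomain R]
    {a b c d : σ} (hcd : c ≠ d) (h1 : ¬ (c = a ∧ d = b)) (h2 : ¬ (c = b ∧ d = a)) :
    ¬ (MvPolynomial.X b - MvPolynomial.X a : MvPolynomial σ R) ∣
      MvPolynomial.X d - MvPolynomial.X c := by
  rw [dvd_iff_subst]
  simp only [substX, map_sub, MvPolynomial.aeval_X]
  rw [sub_eq_zero, MvPolynomial.X_injective.eq_iff]
  simp only [Function.update_apply, id]
  split_ifs <;> grind

theorem prod_dvd {σ R : Type*} [DecidableEq σ] [CommRing R] [IsDomain R]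
    {ι : Type*} (s : Finset ι) (a b : ι → σ)
    (hab : ∀ k ∈ s, a k ≠ b k)
    (h1 : ∀ k ∈ s, ∀ l ∈ s, k ≠ l → ¬ (a k = a l ∧ b k = b l) ∧ ¬ (a k = b l ∧ b k = a l))
    (P : MvPolynomial σ R)
    (hP : ∀ k ∈ s, (MvPolynomial.X (b k) - MvPolynomial.X (a k) : MvPolynomial σ R) ∣ P) :
    (∏ k ∈ s, (MvPolynomial.X (b k) - MvPolynomial.X (a k) : MvPolynomial σ R)) ∣ P := by
  classical
  induction s using Finset.induction_on with
  | empty => simp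
  | insert k s hk ih =>
    obtain ⟨Q, hQ⟩ := ih (fun m hm => hab m (Finset.mem_insert_of_mem hm))
      (fun m hm l hl => h1 m (Finset.mem_insert_of_mem hm) l (Finset.mem_insert_of_mem hl))
      (fun m hm => hP m (Finset.mem_insert_of_mem hm))
    have hk0 := Finset.mem_insert_self k s
    have hp := prime_X_sub_X (R := R) (hab k hk0)
    have hd := hP k hk0
    rw [hQ] at hd
    rcases hp.dvd_or_dvd hd with h | h
    · obtain ⟨l, hl, hdl⟩ := hp.exists_mem_finset_dvd h
      have hl' := Finset.mem_insert_of_mem (b := k) hl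
      have hne : l ≠ k := fun e => hk (e ▸ hl)
      have := h1 l hl' k hk0 hne
      exact absurd hdl (not_dvd (hab l hl') this.1 this.2)
    · obtain ⟨Q', rfl⟩ := h
      rw [Finset.prod_insert hk, hQ]
      exact ⟨Q', by ring⟩

/-- The determinant with denominators cleared. -/
noncomputable def num (n : ℕ) : PolyRing n :=
  Matrix.det (Matrix.of fun i j : Fin n =>
    F (zeta n) (xv i) (yv j) (zv n) * ∏ k ∈ Finset.univ.erase j, G (zeta n) (xv i) (yv k))

theorem vdm_dvd_num (n : ℕ) : vdm n ∣ num n := by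
  classical
  have e : vdm n = ∏ k ∈ ((Finset.univ.sigma fun i : Fin n => Finset.Ioi i).disjSum
      (Finset.univ.sigma fun i : Fin n => Finset.Ioi i)),
      (MvPolynomial.X (Sum.elim (fun p => Sum.inl p.2) (fun p => Sum.inr (Sum.inl p.2)) k)
        - MvPolynomial.X (Sum.elim (fun p => Sum.inl p.1) (fun p => Sum.inr (Sum.inl p.1)) k) :
        PolyRing n) := by
    rw [Finset.prod_disjSum, Finset.prod_sigma, Finset.prod_sigma, ← Finset.prod_mul_distrib]
    simp only [vdm, Finset.prod_mul_distrib]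
    rfl
  rw [e]
  apply prod_dvd
  · rintro (⟨i, j⟩ | ⟨i, j⟩) h
    · simp at h ⊢; exact h.ne
    · simp at h ⊢; exact h.ne
  · rintro (⟨i, j⟩ | ⟨i, j⟩) h (⟨k, l⟩ | ⟨k, l⟩) h' hne <;> simp at h h' hne ⊢ <;> grind
  · rintro (⟨i, j⟩ | ⟨i, j⟩) h
    · simp only [Finset.inl_mem_disjSum, Finset.mem_sigma, Finset.mem_univ, Finset.mem_Ioi,
        true_and] at h
      rw [dvd_iff_subst, num, AlgHom.map_det]
      apply Matrix.det_zero_of_row_eq h.ne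
      funext k
      simp [F, G, xv, yv, zv, zeta, substX, Function.update_apply, h.ne]
    · simp only [Finset.inr_mem_disjSum, Finset.mem_sigma, Finset.mem_univ, Finset.mem_Ioi,
        true_and] at h
      rw [dvd_iff_subst, num, AlgHom.map_det]
      apply Matrix.det_zero_of_column_eq h.ne
      intro k
      have hg : substX ℝ[X] (Sum.inr (Sum.inl i)) (Sum.inr (Sum.inl j)) (yv j : PolyRing n)
          = substX ℝ[X] (Sum.inr (Sum.inl i)) (Sum.inr (Sum.inl j)) (yv i) := by
        simp [yv, substX, Function.update_apply, h.ne]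
      have hj : j ∈ Finset.univ.erase i := by simp [h.ne']
      have hi : i ∈ Finset.univ.erase j := by simp [h.ne]
      simp only [AlgHom.mapMatrix_apply, Matrix.map_apply, Matrix.of_apply, Sum.elim_inr]
      rw [← Finset.mul_prod_erase _ _ hj, ← Finset.mul_prod_erase _ _ hi,
        Finset.erase_right_comm]
      simp only [map_mul, F, G, map_sub, map_add, map_pow, hg]

theorem vdm_ne_zero (n : ℕ) : vdm n ≠ 0 := by
  classical
  refine Finset.prod_ne_zero_iff.2 fun i _ => Finset.prod_ne_zero_iff.2 fun j hj => ?_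
  have h : i ≠ j := (Finset.mem_Ioi.1 hj).ne
  exact mul_ne_zero (X_sub_X_ne_zero (by simpa using h)) (X_sub_X_ne_zero (by simpa using h))

theorem G_ne_zero {n : ℕ} (i j : Fin n) : G (zeta n) (xv i) (yv j) ≠ 0 := by
  intro h
  have h2 := congrArg (MvPolynomial.eval₂ (Polynomial.evalRingHom (0 : ℝ))
    (fun _ => (1 : ℝ))) h
  simp [G, zeta, xv, yv] at h2
  norm_num at h2

theorem SRat_eq (n : ℕ) :
    SRat n = algebraMap (PolyRing n) (FractionRing (PolyRing n)) (num n) /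
      algebraMap (PolyRing n) (FractionRing (PolyRing n)) (vdm n) := by
  classical
  have hq : ∀ i j : Fin n, algebraMap (PolyRing n) (FractionRing (PolyRing n))
      (G (zeta n) (xv i) (yv j)) ≠ 0 := fun i j =>
    (map_ne_zero_iff _ (IsFractionRing.injective _ _)).2 (G_ne_zero i j)
  rw [SRat, div_mul_eq_mul_div, map_prod, ← Matrix.det_mul_column, num, RingHom.map_det]
  congr 2
  ext i j
  simp only [Matrix.of_apply, RingHom.mapMatrix_apply, Matrix.map_apply, map_mul, map_prod]
  rw [← Finset.mul_prod_erase _ _ (Finset.mem_univ j)]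
  have := hq i j
  field_simp

theorem exists_S (n : ℕ) :
    ∃ s : PolyRing n, algebraMap (PolyRing n) (FractionRing (PolyRing n)) s = SRat n := by
  obtain ⟨s, hs⟩ := vdm_dvd_num n
  refine ⟨s, ?_⟩
  have h0 : algebraMap (PolyRing n) (FractionRing (PolyRing n)) (vdm n) ≠ 0 :=
    (map_ne_zero_iff _ (IsFractionRing.injective _ _)).2 (vdm_ne_zero n)
  rw [SRat_eq, hs, map_mul, mul_div_cancel_left₀ _ h0]

/-- The polynomial `Sₙ(x₁, …, xₙ, y₁, …, yₙ, z)`. -/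
noncomputable def S (n : ℕ) : PolyRing n := (exists_S n).choose

/-- `Sₙ(x, …, x, y, …, y, x)` with `x = 2ζ+1` (`n+1` times) and `y = ζ/(ζ+2)` (`n` times),
as a rational function of `ζ`. -/
noncomputable def SSpec (n : ℕ) : RatFunc ℝ :=
  MvPolynomial.aeval
    (Sum.elim (fun _ => 2 * RatFunc.X + 1)
      (Sum.elim (fun _ => RatFunc.X / (RatFunc.X + 2)) (fun _ => 2 * RatFunc.X + 1)))
    (S n)

/-- `δₙ = [n²/4]`. -/
def δ (n : ℕ) : ℕ := n ^ 2 / 4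

/-- The quotient
`(1+ζ/2)^{n²} Sₙ(2ζ+1, …, ζ/(ζ+2), …) /
  ((-1)^{n(n+1)/2} ζ^{n²} (1+ζ)^{n²} (1+2ζ)^{δₙ} (1+ζ/2)^{δₙ₋₁})`.
(For `n = 0` truncated subtraction gives `δ (0 - 1) = 0`, which agrees with `[(-1)²/4] = 0`.) -/
noncomputable def pRat (n : ℕ) : RatFunc ℝ :=
  (1 + RatFunc.X / 2) ^ n ^ 2 * SSpec n /
    ((-1) ^ (n + 1).choose 2 * RatFunc.X ^ n ^ 2 * (1 + RatFunc.X) ^ n ^ 2 *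
      (1 + 2 * RatFunc.X) ^ δ n * (1 + RatFunc.X / 2) ^ δ (n - 1))

/-- The polynomial `pₙ(ζ)`: the quotient above is a polynomial in `ζ`, and for `r : ℝ[X]` the
numerator of `r`, seen as a rational function, is `r` itself (`RatFunc.num_algebraMap`). -/
noncomputable def p (n : ℕ) : ℝ[X] := (pRat n).num

/-- For every `n`, the polynomial `pₙ` has exactly `[(n+1)/2]` real zeroes, counted with
multiplicity. -/
def RealZeroCountConjecture : Prop :=
  ∀ n : ℕ, Multiset.card (p n).roots = (n + 1) / 2

/-- For every `n`, the polynomial `pₙ` does not vanish in the interval `-2 < ζ < -1/2`. -/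
def NonvanishingConjecture : Prop :=
  ∀ n : ℕ, ∀ ζ : ℝ, -2 < ζ → ζ < -1 / 2 → (p n).eval ζ ≠ 0

end ThreeColour

/-! Move `x` and `y` along rational curves, with parameters `T` and `T'`, through the base points
`2ζ+1` and `ζ/(ζ+2)`. Put `a = (2ζ+1)(ζ+2)/ζ` and `ρ(T) = T(1-T)²/(1-aT)²`. Up to factors in `T` or
`T'` alone, `F/G` is then `(A(T) - a²ρ(T')B(T')) / (1 - a³ρ(T)ρ(T'))` (`F_div_G_field`). Its
coefficients in powers of `ρ(T)` and `ρ(T')` form a Toeplitz matrix up to row scaling. Letting the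
variables coalesce, `pₙ(ζ) = 0` exactly when a Toeplitz, hence a Hankel, determinant of the
two-sided sequence `moment ζ` vanishes (`specValue_eq_zero_iff`). Under `ζ ↦ 1/ζ` the parameter `a`
is fixed and the moments are reflected, so a zero at `1/ζ` is detected by the Hankel determinant
with start shifted by one.

On `ζ < -2` the determinants `mainDet k` detect zeros of `pₖ` at `ζ` for even `k` and at `1/ζ` for
odd `k`; `sideDet k` detects them the other way round. Condensation gives `mainDet (k+2) * mainDet k
= -sideDet (k+1)²` where `mainDet (k+1)` vanishes and `mainDet k` does not, as in a Sturm sequence.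
The boundary signs are known. Near `-2` the determinants are positive, because a rescaled limit is
block diagonal with positive definite Hankel blocks of Raney numbers (`eventually_hankelDet_pos`).
At `-∞` a rescaled limit is the exchange matrix (`eventually_sign_hankelDet`).

By induction and the intermediate value theorem, `mainDet k` has `[(k+1)/2]` distinct zeros below
`-2`, interlacing with those of its neighbour. The assumed count says that these already give every
real zero of `pₖ`. Hence `sideDet k` has no zero below `-2`, so the sign in the condensation
identity is strict and the induction continues. Simplicity, location, interlacing and nonvanishing
follow. -/

namespace ThreeColour

/-! ### Zeros of `p` as zeros of a specialized value of `S`. -/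

section Specialization

open Polynomial

/-- The rational function `r` has no pole at `ζ` and takes the value `v` there. -/
def HasValueAt (ζ : ℝ) (r : RatFunc ℝ) (v : ℝ) : Prop :=
  ∃ f g : ℝ[X], g.eval ζ ≠ 0 ∧ r * algebraMap ℝ[X] (RatFunc ℝ) g = algebraMap ℝ[X] (RatFunc ℝ) f ∧
    v * g.eval ζ = f.eval ζ

namespace HasValueAt

variable {ζ : ℝ} {r s : RatFunc ℝ} {v w : ℝ}

theorem polynomial (f : ℝ[X]) : HasValueAt ζ (algebraMap ℝ[X] (RatFunc ℝ) f) (f.eval ζ) :=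
  ⟨f, 1, by simp, by simp, by simp⟩

theorem add (hr : HasValueAt ζ r v) (hs : HasValueAt ζ s w) : HasValueAt ζ (r + s) (v + w) := by
  obtain ⟨f, g, hg, h1, h2⟩ := hr
  obtain ⟨f', g', hg', h1', h2'⟩ := hs
  refine ⟨f * g' + f' * g, g * g', by simp [hg, hg'], ?_, ?_⟩
  · simp only [map_mul, map_add, ← h1, ← h1']; ring
  · simp only [eval_mul, eval_add, ← h2, ← h2']; ring

theorem mul (hr : HasValueAt ζ r v) (hs : HasValueAt ζ s w) : HasValueAt ζ (r * s) (v * w) := by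
  obtain ⟨f, g, hg, h1, h2⟩ := hr
  obtain ⟨f', g', hg', h1', h2'⟩ := hs
  refine ⟨f * f', g * g', by simp [hg, hg'], ?_, ?_⟩
  · simp only [map_mul, ← h1, ← h1']; ring
  · simp only [eval_mul, ← h2, ← h2']; ring

theorem inv (hr : HasValueAt ζ r v) (hv : v ≠ 0) : HasValueAt ζ r⁻¹ v⁻¹ := by
  obtain ⟨f, g, hg, h1, h2⟩ := hr
  have hf : f.eval ζ ≠ 0 := h2 ▸ mul_ne_zero hv hg
  have hr : r ≠ 0 := by
    rintro rfl
    rw [zero_mul, eq_comm, FaithfulSMul.algebraMap_eq_zero_iff] at h1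
    simp [h1] at hf
  refine ⟨g, f, hf, ?_, ?_⟩
  · rw [← h1, inv_mul_cancel_left₀ hr]
  · rw [← h2, inv_mul_cancel_left₀ hv]

theorem div (hr : HasValueAt ζ r v) (hs : HasValueAt ζ s w) (hw : w ≠ 0) :
    HasValueAt ζ (r / s) (v / w) := by
  rw [div_eq_mul_inv, div_eq_mul_inv]
  exact hr.mul (hs.inv hw)

theorem pow (hr : HasValueAt ζ r v) (n : ℕ) : HasValueAt ζ (r ^ n) (v ^ n) := by
  induction n with
  | zero => simpa using polynomial (ζ := ζ) (1 : ℝ[X])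
  | succ n ih => rw [pow_succ, pow_succ]; exact ih.mul hr

theorem const (c : ℝ) : HasValueAt ζ (RatFunc.C c) c := by
  simpa [RatFunc.algebraMap_C] using polynomial (ζ := ζ) (C c : ℝ[X])

theorem X : HasValueAt ζ RatFunc.X ζ := by
  simpa [RatFunc.algebraMap_X] using polynomial (ζ := ζ) (Polynomial.X : ℝ[X])

theorem ofNat (n : ℕ) [n.AtLeastTwo] :
    HasValueAt ζ (OfNat.ofNat n : RatFunc ℝ) (OfNat.ofNat n : ℝ) := by
  have := const (ζ := ζ) (OfNat.ofNat n : ℝ)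
  rwa [map_ofNat] at this

theorem one : HasValueAt ζ (1 : RatFunc ℝ) 1 := by
  simpa using const (ζ := ζ) 1

/-- Numerator and denominator are coprime, so the denominator cannot vanish at a zero of the
numerator. This gives access to the zeros of `p` without knowing that `pRat` is a polynomial. -/
theorem num_isRoot_iff (hr : HasValueAt ζ r v) : r.num.IsRoot ζ ↔ v = 0 := by
  obtain ⟨f, g, hg, h1, h2⟩ := hr
  have key : r.num * g = f * r.denom := by
    apply RatFunc.algebraMap_injective ℝ
    have hd : algebraMap ℝ[X] (RatFunc ℝ) r.denom ≠ 0 :=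
      RatFunc.algebraMap_ne_zero r.denom_ne_zero
    rw [map_mul, map_mul, ← h1, (div_eq_iff hd).1 r.num_div_denom]
    ring
  have key2 := congrArg (Polynomial.eval ζ) key
  rw [eval_mul, eval_mul, ← h2] at key2
  constructor
  · intro h
    have hd : r.denom.eval ζ ≠ 0 := by
      intro hd
      obtain ⟨u, w, huw⟩ := r.isCoprime_num_denom
      have := congrArg (Polynomial.eval ζ) huw
      simp [h.eq_zero, hd] at this
    rw [h.eq_zero, zero_mul, eq_comm] at key2
    simpa [hg, hd] using key2
  · intro h
    rw [h] at key2
    simpa [hg] using key2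

theorem mvPolynomial_aeval {σ : Type*} {x : σ → RatFunc ℝ} {y : σ → ℝ}
    (h : ∀ i, HasValueAt ζ (x i) (y i)) (P : MvPolynomial σ ℝ[X]) :
    HasValueAt ζ (MvPolynomial.aeval x P) (MvPolynomial.eval₂ (evalRingHom ζ) y P) := by
  induction P using MvPolynomial.induction_on with
  | C a => simpa using polynomial (ζ := ζ) a
  | add p q hp hq => rw [map_add, MvPolynomial.eval₂_add]; exact hp.add hq
  | mul_X p i hp =>
    rw [map_mul, MvPolynomial.aeval_X, MvPolynomial.eval₂_mul, MvPolynomial.eval₂_X]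
    exact hp.mul (h i)

end HasValueAt

/-- The value of `Sₙ` at `x₁ = … = xₙ = z = 2ζ+1`, `y₁ = … = yₙ = ζ/(ζ+2)` for real `ζ`. -/
noncomputable def specValue (n : ℕ) (ζ : ℝ) : ℝ :=
  MvPolynomial.eval₂ (evalRingHom ζ)
    (Sum.elim (fun _ => 2 * ζ + 1) (Sum.elim (fun _ => ζ / (ζ + 2)) (fun _ => 2 * ζ + 1))) (S n)

/-- The excluded points are the zeros of the prefactors in `pRat` together with the pole of
`ζ/(ζ+2)`. -/
theorem p_isRoot_iff (n : ℕ) {ζ : ℝ} (h0 : ζ ≠ 0) (h1 : ζ + 1 ≠ 0) (h2 : ζ + 2 ≠ 0)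
    (h3 : 2 * ζ + 1 ≠ 0) : (p n).IsRoot ζ ↔ specValue n ζ = 0 := by
  have hX : HasValueAt ζ RatFunc.X ζ := .X
  have hS : HasValueAt ζ (SSpec n) (specValue n ζ) := by
    apply HasValueAt.mvPolynomial_aeval
    have h : HasValueAt ζ (2 * RatFunc.X + 1) (2 * ζ + 1) := ((HasValueAt.ofNat 2).mul hX).add .one
    rintro (_ | _ | _)
    · exact h
    · exact hX.div (hX.add (.ofNat 2)) h2
    · exact h
  have h4 : 1 + ζ / 2 ≠ 0 := by
    intro h; apply h2; linarith
  have hd : HasValueAt ζ (1 + RatFunc.X / 2) (1 + ζ / 2) :=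
    HasValueAt.one.add (hX.div (.ofNat 2) two_ne_zero)
  have h5 : 1 + 2 * ζ ≠ 0 := by rwa [add_comm]
  have h6 : 1 + ζ ≠ 0 := by rwa [add_comm]
  have hm : HasValueAt ζ (-1) (-1) := by simpa using HasValueAt.const (ζ := ζ) (-1)
  have hp : HasValueAt ζ (pRat n) _ :=
    ((hd.pow (n ^ 2)).mul hS).div
    (((((hm.pow ((n + 1).choose 2)).mul (hX.pow (n ^ 2))).mul
      ((HasValueAt.one.add hX).pow (n ^ 2))).mul
      ((HasValueAt.one.add ((HasValueAt.ofNat 2).mul hX)).pow (δ n))).mul (hd.pow (δ (n - 1))))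
    (by simp [h0, h4, h5, h6])
  rw [p, hp.num_isRoot_iff, div_eq_zero_iff]
  simp [h0, h4, h5, h6]

end Specialization

/-! ### Expansions of power series in powers of a local parameter. -/

section Expansion

open PowerSeries

variable {A B : Type*} [CommRing A] [CommRing B]

/-- `f = ∑ₖ eₖ ρᵏ` as formal power series, for `ρ` without constant term. -/
def IsExpansion (ρ f : A⟦X⟧) (e : ℕ → A) : Prop :=
  ∀ N : ℕ, (X : A⟦X⟧) ^ N ∣ f - ∑ k ∈ Finset.range N, C (e k) * ρ ^ k

/-- The coefficients of `f` with respect to the powers of `ρ`. -/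
noncomputable def expansion (ρ f : A⟦X⟧) (n : ℕ) : A :=
  coeff n f - ∑ k : Fin n, expansion ρ f k * coeff n (ρ ^ (k : ℕ))
termination_by n
decreasing_by exact k.2

theorem expansion_eq (ρ f : A⟦X⟧) (n : ℕ) : expansion ρ f n =
    coeff n f - ∑ k ∈ Finset.range n, expansion ρ f k * coeff n (ρ ^ k) := by
  rw [expansion, Finset.sum_range]

theorem X_pow_succ_dvd_iff {f : A⟦X⟧} {N : ℕ} (h : (X : A⟦X⟧) ^ N ∣ f) :
    (X : A⟦X⟧) ^ (N + 1) ∣ f ↔ coeff N f = 0 := by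
  rw [X_pow_dvd_iff] at h ⊢
  constructor
  · intro h'; exact h' N N.lt_succ_self
  · intro h' m hm
    rcases Nat.lt_succ_iff_lt_or_eq.1 hm with hm | rfl
    · exact h m hm
    · exact h'

theorem coeff_mul_X_pow_self {φ : A⟦X⟧} (hφ : constantCoeff φ = 1) (n : ℕ) :
    coeff n ((X * φ) ^ n) = 1 := by
  rw [mul_pow, coeff_X_pow_mul', if_pos le_rfl, Nat.sub_self, coeff_zero_eq_constantCoeff,
    map_pow, hφ, one_pow]

/-- The powers of `X * φ` form a unitriangular system with respect to the powers of `X`, so the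
coefficients are found recursively. Uniqueness below has the same reason. -/
theorem isExpansion_expansion {φ : A⟦X⟧} (hφ : constantCoeff φ = 1) (f : A⟦X⟧) :
    IsExpansion (X * φ) f (expansion (X * φ) f) := by
  intro N
  induction N with
  | zero => simp
  | succ N ih =>
    rw [Finset.sum_range_succ, ← sub_sub, X_pow_succ_dvd_iff]
    · rw [map_sub, map_sub, map_sum, coeff_C_mul, coeff_mul_X_pow_self hφ, mul_one,
        expansion_eq _ _ N, sub_eq_zero]
      simp only [coeff_C_mul]
    · refine dvd_sub ih (Dvd.dvd.mul_left ?_ _)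
      rw [mul_pow]
      exact dvd_mul_right _ _

theorem IsExpansion.unique {φ f : A⟦X⟧} (hφ : constantCoeff φ = 1) {e e' : ℕ → A}
    (h : IsExpansion (X * φ) f e) (h' : IsExpansion (X * φ) f e') : e = e' := by
  funext n
  induction n using Nat.strong_induction_on with
  | _ n ih =>
    have h1 := dvd_sub (h (n + 1)) (h' (n + 1))
    rw [Finset.sum_range_succ, Finset.sum_range_succ, Finset.sum_congr rfl
      (fun k hk => by rw [ih k (Finset.mem_range.1 hk)])] at h1
    have h2 := X_pow_dvd_iff.1 h1 n n.lt_succ_self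
    simp only [map_sub, map_add, coeff_C_mul, coeff_mul_X_pow_self hφ] at h2
    linear_combination -h2

theorem IsExpansion.map (g : A →+* B) {ρ f : A⟦X⟧} {e : ℕ → A} (h : IsExpansion ρ f e) :
    IsExpansion (PowerSeries.map g ρ) (PowerSeries.map g f) (fun n => g (e n)) := by
  intro N
  have := map_dvd (PowerSeries.map g) (h N)
  simpa using this

theorem IsExpansion.sub {ρ f f' : A⟦X⟧} {e e' : ℕ → A} (h : IsExpansion ρ f e)
    (h' : IsExpansion ρ f' e') : IsExpansion ρ (f - f') (e - e') := by
  intro N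
  convert dvd_sub (h N) (h' N) using 1
  simp only [Pi.sub_apply, map_sub, sub_mul, Finset.sum_sub_distrib]
  ring

theorem IsExpansion.comb {ρ f f' : A⟦X⟧} {e e' : ℕ → A} (h : IsExpansion ρ f e)
    (h' : IsExpansion ρ f' e') (c c' : A) :
    IsExpansion ρ (C c * f + C c' * f') (fun n => c * e n + c' * e' n) := by
  intro N
  convert dvd_add ((h N).mul_left (C c)) ((h' N).mul_left (C c')) using 1
  simp only [map_add, map_mul, add_mul, Finset.sum_add_distrib, mul_sub, Finset.mul_sum, mul_assoc]
  ring

/-- Division by the local parameter shifts the coefficients by one; the zeroth coefficient vanishes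
because the multiplied series has no constant term. -/
theorem IsExpansion.of_mul {φ f : A⟦X⟧} (hφ : constantCoeff φ = 1) {e : ℕ → A}
    (h : IsExpansion (X * φ) (X * φ * f) e) : IsExpansion (X * φ) f (fun n => e (n + 1)) := by
  intro N
  have h0 : e 0 = 0 := by
    have := X_pow_dvd_iff.1 (h 1) 0 one_pos
    simpa [mul_assoc] using this
  have h1 := h (N + 1)
  have hu : IsUnit φ := by rw [PowerSeries.isUnit_iff_constantCoeff, hφ]; exact isUnit_one
  have e1 : X * φ * f - ∑ k ∈ Finset.range (N + 1), C (e k) * (X * φ) ^ k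
      = X * (φ * (f - ∑ k ∈ Finset.range N, C (e (k + 1)) * (X * φ) ^ k)) := by
    rw [Finset.sum_range_succ', h0, map_zero, zero_mul, add_zero, mul_sub, mul_sub,
      Finset.mul_sum, Finset.mul_sum, ← mul_assoc]
    congr 1
    refine Finset.sum_congr rfl fun k _ => ?_
    ring
  rw [e1, pow_succ'] at h1
  rw [← hu.dvd_mul_left]
  rw [X_pow_dvd_iff]
  intro m hm
  obtain ⟨q, hq⟩ := h1
  have := congrArg (coeff (m + 1)) hq
  rw [coeff_succ_X_mul, mul_assoc, coeff_succ_X_mul, coeff_X_pow_mul', if_neg (by omega)] at this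
  exact this

end Expansion

/-! ### The local parameter `rho a` and the two basic expansions. -/

section Rho

open PowerSeries

variable {A B : Type*} [CommRing A] [CommRing B]

/-- The geometric series `1 / (1 - a X)`. -/
noncomputable def geom (a : A) : A⟦X⟧ := PowerSeries.mk fun n => a ^ n

theorem geom_mul (a : A) : geom a * (1 - C a * X) = 1 := by
  ext n
  rcases n with _ | n
  · simp [geom]
  · rw [mul_sub, mul_one, map_sub, ← mul_assoc, mul_comm (geom a), mul_assoc, coeff_C_mul,
      coeff_succ_mul_X]
    simp [geom, pow_succ', coeff_one]

theorem constantCoeff_geom (a : A) : constantCoeff (geom a) = 1 := by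
  simp [geom, ← coeff_zero_eq_constantCoeff_apply]

theorem map_geom (g : A →+* B) (a : A) : PowerSeries.map g (geom a) = geom (g a) := by
  ext n; simp [geom]

/-- The unit part `(1 - X)² / (1 - a X)²` of the local parameter. -/
noncomputable def rhoUnit (a : A) : A⟦X⟧ := (1 - X) ^ 2 * geom a ^ 2

/-- The local parameter `X (1 - X)² / (1 - a X)²`. -/
noncomputable def rho (a : A) : A⟦X⟧ := X * rhoUnit a

theorem constantCoeff_rhoUnit (a : A) : constantCoeff (rhoUnit a) = 1 := by
  simp [rhoUnit, constantCoeff_geom]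

theorem map_rho (g : A →+* B) (a : A) : PowerSeries.map g (rho a) = rho (g a) := by
  simp [rho, rhoUnit, map_geom]

/-- The coefficients of `1 / (1 - X)²` in powers of `rho a`. -/
noncomputable def eCoeff (a : A) : ℕ → A := expansion (rho a) (geom 1 ^ 2)

/-- The coefficients of `X / (1 - X)²` in powers of `rho a`. -/
noncomputable def eCoeff' (a : A) : ℕ → A := expansion (rho a) (X * geom 1 ^ 2)

theorem isExpansion_eCoeff (a : A) : IsExpansion (rho a) (geom 1 ^ 2) (eCoeff a) :=
  isExpansion_expansion (constantCoeff_rhoUnit a) _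

theorem isExpansion_eCoeff' (a : A) : IsExpansion (rho a) (X * geom 1 ^ 2) (eCoeff' a) :=
  isExpansion_expansion (constantCoeff_rhoUnit a) _

/-- Uniqueness of expansions makes the coefficients natural in the ring. Evaluating `ℝ[X]` at a real
number then exhibits `eCoeff a n` as a polynomial in `a`. -/
theorem map_eCoeff (g : A →+* B) (a : A) (n : ℕ) : g (eCoeff a n) = eCoeff (g a) n := by
  have h := (isExpansion_eCoeff a).map g
  rw [map_rho, map_pow, map_geom, map_one] at h
  exact congrFun (h.unique (constantCoeff_rhoUnit (g a)) (isExpansion_eCoeff (g a))) n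

theorem map_eCoeff' (g : A →+* B) (a : A) (n : ℕ) : g (eCoeff' a n) = eCoeff' (g a) n := by
  have h := (isExpansion_eCoeff' a).map g
  rw [map_rho, map_mul, PowerSeries.map_X, map_pow, map_geom, map_one] at h
  exact congrFun (h.unique (constantCoeff_rhoUnit (g a)) (isExpansion_eCoeff' (g a))) n

theorem eCoeff_zero (a : A) : eCoeff a 0 = 1 := by
  rw [eCoeff, expansion_eq]
  simp [constantCoeff_geom]

theorem eCoeff'_zero (a : A) : eCoeff' a 0 = 0 := by
  rw [eCoeff', expansion_eq]
  simp

end Rho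

/-! ### Degree of the expansion coefficients as polynomials in `a`. -/

section Degree

open Polynomial

/-- The coefficient of `X ^ n` has degree at most `n - s`. -/
def DegLE (s : ℕ) (f : PowerSeries ℝ[X]) : Prop :=
  ∀ n j : ℕ, n < j + s → (PowerSeries.coeff n f).coeff j = 0

theorem DegLE.mul {s t : ℕ} {f g : PowerSeries ℝ[X]} (hf : DegLE s f) (hg : DegLE t g) :
    DegLE (s + t) (f * g) := by
  intro n j h
  rw [PowerSeries.coeff_mul, finsetSum_coeff]
  refine Finset.sum_eq_zero fun x hx => ?_
  rw [Polynomial.coeff_mul]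
  refine Finset.sum_eq_zero fun y hy => ?_
  rw [Finset.HasAntidiagonal.mem_antidiagonal] at hx hy
  rcases lt_or_ge x.1 (y.1 + s) with h1 | h1
  · rw [hf _ _ h1, zero_mul]
  · rw [hg x.2 y.2 (by omega), mul_zero]

theorem DegLE.one : DegLE 0 1 := by
  intro n j h
  rw [PowerSeries.coeff_one]
  split_ifs
  · rw [Polynomial.coeff_one, if_neg (by omega)]
  · simp

theorem DegLE.pow {s : ℕ} {f : PowerSeries ℝ[X]} (hf : DegLE s f) (k : ℕ) :
    DegLE (k * s) (f ^ k) := by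
  induction k with
  | zero => simpa using DegLE.one
  | succ k ih => rw [pow_succ, Nat.succ_mul]; exact ih.mul hf

theorem DegLE.geom_X : DegLE 0 (geom (X : ℝ[X])) := by
  intro n j h
  simp only [geom, PowerSeries.coeff_mk, coeff_X_pow]
  rw [if_neg (by omega)]

theorem DegLE.X : DegLE 1 PowerSeries.X := by
  intro n j h
  rw [PowerSeries.coeff_X]
  split_ifs
  · rw [Polynomial.coeff_one, if_neg (by omega)]
  · simp

theorem DegLE.one_sub_X : DegLE 0 (1 - PowerSeries.X) := by
  intro n j h
  rw [map_sub, coeff_sub, DegLE.one n j h, DegLE.X n j (by omega), sub_zero]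

theorem DegLE.rho : DegLE 1 (rho (Polynomial.X : ℝ[X])) := by
  have := DegLE.X.mul ((DegLE.one_sub_X.pow 2).mul (DegLE.geom_X.pow 2))
  simpa [ThreeColour.rho, rhoUnit] using this

/-- In the recursion, the coefficient at `ρ^k` has degree at most `k - 1` and that of `X^n` in `ρ^k`
at most `n - k`. The sum `n - 1` controls the moments as `ζ → -∞`. -/
theorem natDegree_expansion_le {f : PowerSeries ℝ[X]}
    (hf : ∀ n, (PowerSeries.coeff n f).natDegree = 0) (n : ℕ) :
    (expansion (rho (X : ℝ[X])) f n).natDegree ≤ n - 1 := by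
  induction n using Nat.strong_induction_on with
  | _ n ih =>
    rw [expansion_eq]
    refine (natDegree_sub_le _ _).trans (max_le (by simp [hf]) ?_)
    refine natDegree_sum_le_of_forall_le _ _ fun k hk => ?_
    have hk' := Finset.mem_range.1 hk
    -- For `k = 0` truncated subtraction gives the bound `0` instead of `-1`, but `ρ^0 = 1` has no
    -- coefficient in positive degree.
    rcases k with _ | k
    · simp [PowerSeries.coeff_one, show n ≠ 0 by omega]
    · refine natDegree_mul_le.trans ?_
      have h1 := ih (k + 1) hk'
      have h2 : (PowerSeries.coeff n (rho (X : ℝ[X]) ^ (k + 1))).natDegree ≤ n - (k + 1) := by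
        rw [natDegree_le_iff_coeff_eq_zero]
        intro j hj
        exact DegLE.rho.pow (k + 1) n j (by omega)
      omega

theorem natDegree_coeff_geom_one_sq (n : ℕ) :
    (PowerSeries.coeff n (geom (1 : ℝ[X]) ^ 2)).natDegree = 0 := by
  have : geom (1 : ℝ[X]) = PowerSeries.map (C : ℝ →+* ℝ[X]) (geom 1) := by simp [map_geom]
  rw [this, ← map_pow, PowerSeries.coeff_map, natDegree_C]

theorem natDegree_eCoeff_le (n : ℕ) : (eCoeff (X : ℝ[X]) n).natDegree ≤ n - 1 :=
  natDegree_expansion_le natDegree_coeff_geom_one_sq n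

theorem natDegree_eCoeff'_le (n : ℕ) : (eCoeff' (X : ℝ[X]) n).natDegree ≤ n - 1 := by
  refine natDegree_expansion_le (fun n => ?_) n
  rcases n with _ | n
  · simp
  · rw [PowerSeries.coeff_succ_X_mul, natDegree_coeff_geom_one_sq]

theorem eval_eCoeff (a : ℝ) (n : ℕ) : (eCoeff (X : ℝ[X]) n).eval a = eCoeff a n := by
  have := map_eCoeff (evalRingHom a) X n
  simpa using this

theorem eval_eCoeff' (a : ℝ) (n : ℕ) : (eCoeff' (X : ℝ[X]) n).eval a = eCoeff' a n := by
  have := map_eCoeff' (evalRingHom a) X n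
  simpa using this

end Degree

/-! ### Raney numbers and vanishing finite differences. -/

section RaneySums

open Polynomial

/-- This is the `m`-th finite difference of `P` at `0`. It replaces Lagrange inversion in the next
sums. -/
theorem alternating_sum_eq_zero (P : Polynomial ℝ) {m : ℕ} (h : P.natDegree < m) :
    ∑ k ∈ Finset.range (m + 1), (-1 : ℝ) ^ (m - k) * m.choose k * P.eval (k : ℝ) = 0 := by
  have h1 := congrFun (Polynomial.fwdDiff_iter_eq_zero_of_degree_lt h) 0
  rw [fwdDiff_iter_eq_sum_shift] at h1
  simpa [mul_assoc, zsmul_eq_mul] using h1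

/-- The number `C(3n+1, n) / (n+1)`. -/
noncomputable def raney₂ (n : ℕ) : ℝ := (3 * n + 1).choose n / (n + 1)

/-- The number `C(3n, n) / (2n+1)`. -/
noncomputable def raney₁ (n : ℕ) : ℝ := (3 * n).choose n / (2 * n + 1)

theorem cast_choose_eq {a b c : ℕ} (h : b + c = a) :
    (a.choose b : ℝ) = a.factorial / (b.factorial * c.factorial) := by
  rw [Nat.cast_choose ℝ (by omega : b ≤ a), show a - b = c by omega]

theorem cast_descFactorial_eq {a b c : ℕ} (h : b + c = a) :
    (a.descFactorial b : ℝ) = a.factorial / c.factorial := by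
  have := Nat.factorial_mul_descFactorial (show b ≤ a by omega)
  rw [show a - b = c by omega] at this
  rw [← this]
  push_cast
  field_simp

/-- With `k = l + 1`, the right side is a binomial coefficient in `k` times `2k` times the falling
factorial of `3k - 2` of length `M`, a polynomial of degree `M + 1` in `k`. This turns `raney₂_sum`
into a finite difference of order `M + 2`. -/
theorem raney₂_mul {l M : ℕ} (h : l ≤ M + 1) :
    raney₂ l * (2 * (l + 1)).choose (M + 2 - (l + 1)) * (M + 2).factorial =
      (M + 2).choose (l + 1) * (2 * (l + 1) * (3 * l + 1).descFactorial M) := by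
  rcases le_or_gt M (3 * l + 1) with hM | hM
  · obtain ⟨d, hd⟩ := Nat.exists_eq_add_of_le h
    obtain ⟨e, he⟩ := Nat.exists_eq_add_of_le hM
    rw [raney₂, cast_choose_eq (show l + (2 * l + 1) = 3 * l + 1 by omega),
      show M + 2 - (l + 1) = d by omega, cast_choose_eq (show d + e = 2 * (l + 1) by omega),
      cast_choose_eq (show l + 1 + d = M + 2 by omega), cast_descFactorial_eq he.symm,
      show 2 * (l + 1) = (2 * l + 1) + 1 by ring, Nat.factorial_succ (2 * l + 1),
      Nat.factorial_succ l]
    push_cast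
    field_simp
    ring
  -- Outside the range of the factorial formulas both sides vanish.
  · rw [Nat.choose_eq_zero_of_lt (by omega), Nat.descFactorial_eq_zero_iff_lt.2 hM]
    simp

/-- Here the polynomial in `k = l + 1` is `2k²` times the falling factorial of `3k - 3` of length
`M`, of degree `M + 2`, against a difference of order `M + 3`. -/
theorem raney₁_mul {l M : ℕ} (h : l ≤ M + 2) :
    raney₁ l * (2 * (l + 1)).choose (M + 3 - (l + 1)) * (M + 3).factorial =
      (M + 3).choose (l + 1) * (2 * (l + 1) ^ 2 * (3 * l).descFactorial M) := by
  rcases le_or_gt M (3 * l) with hM | hM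
  · obtain ⟨d, hd⟩ := Nat.exists_eq_add_of_le h
    obtain ⟨e, he⟩ := Nat.exists_eq_add_of_le hM
    rw [raney₁, cast_choose_eq (show l + 2 * l = 3 * l by omega),
      show M + 3 - (l + 1) = d by omega, cast_choose_eq (show d + e = 2 * (l + 1) by omega),
      cast_choose_eq (show l + 1 + d = M + 3 by omega), cast_descFactorial_eq he.symm,
      show 2 * (l + 1) = (2 * l + 1) + 1 by ring, Nat.factorial_succ (2 * l + 1),
      Nat.factorial_succ (2 * l), Nat.factorial_succ l]
    push_cast
    field_simp
    ring
  · rw [Nat.choose_eq_zero_of_lt (by omega), Nat.descFactorial_eq_zero_iff_lt.2 hM]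
    simp

theorem raney₂_sum (M : ℕ) : ∑ l ∈ Finset.range (M + 2),
    raney₂ l * ((-1) ^ (M + 2 - (l + 1)) * (2 * (l + 1)).choose (M + 2 - (l + 1))) = 0 := by
  have hd : (2 * X * (descPochhammer ℝ M).comp (3 * X - 2)).natDegree < M + 2 := by
    have h1 : (3 * X - 2 : ℝ[X]).natDegree ≤ 1 := by compute_degree
    have h2 := natDegree_comp_le (p := descPochhammer ℝ M) (q := 3 * X - 2)
    rw [descPochhammer_natDegree] at h2
    have h3 : (2 * X : ℝ[X]).natDegree ≤ 1 := by compute_degree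
    have h4 := natDegree_mul_le (p := 2 * X) (q := (descPochhammer ℝ M).comp (3 * X - 2))
    nlinarith
  have h := alternating_sum_eq_zero _ hd
  -- The term `k = 0` of the difference drops out because of the factor `2k`.
  rw [Finset.sum_range_succ'] at h
  simp only [eval_mul, eval_comp, eval_X, eval_sub, eval_ofNat, Nat.cast_zero, mul_zero, zero_mul,
    add_zero] at h
  rw [← mul_eq_zero_iff_right (Nat.cast_ne_zero.2 (M + 2).factorial_ne_zero : ((M + 2).factorial : ℝ) ≠ 0),
    Finset.sum_mul, ← h]
  refine Finset.sum_congr rfl fun l hl => ?_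
  have h2 := raney₂_mul (show l ≤ M + 1 by simpa [Nat.lt_succ_iff] using hl)
  have h3 : (descPochhammer ℝ M).eval (3 * ((l + 1 : ℕ) : ℝ) - 2)
      = ((3 * l + 1).descFactorial M : ℝ) := by
    rw [← descPochhammer_eval_eq_descFactorial]
    congr 1
    push_cast; ring
  rw [h3]
  push_cast at h2 ⊢
  linear_combination (-1) ^ (M + 1 - l) * h2

theorem raney₁_sum (M : ℕ) : ∑ l ∈ Finset.range (M + 3),
    raney₁ l * ((-1) ^ (M + 3 - (l + 1)) * (2 * (l + 1)).choose (M + 3 - (l + 1))) = 0 := by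
  have hd : (2 * X ^ 2 * (descPochhammer ℝ M).comp (3 * X - 3)).natDegree < M + 3 := by
    have h1 : (3 * X - 3 : ℝ[X]).natDegree ≤ 1 := by compute_degree
    have h2 := natDegree_comp_le (p := descPochhammer ℝ M) (q := 3 * X - 3)
    rw [descPochhammer_natDegree] at h2
    have h3 : (2 * X ^ 2 : ℝ[X]).natDegree ≤ 2 := by compute_degree
    have h4 := natDegree_mul_le (p := 2 * X ^ 2) (q := (descPochhammer ℝ M).comp (3 * X - 3))
    nlinarith
  have h := alternating_sum_eq_zero _ hd
  rw [Finset.sum_range_succ'] at h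
  simp only [eval_mul, eval_comp, eval_X, eval_sub, eval_pow, eval_ofNat, Nat.cast_zero, mul_zero, zero_mul,
    add_zero, ne_eq, OfNat.ofNat_ne_zero, not_false_eq_true, zero_pow] at h
  rw [← mul_eq_zero_iff_right (Nat.cast_ne_zero.2 (M + 3).factorial_ne_zero : ((M + 3).factorial : ℝ) ≠ 0),
    Finset.sum_mul, ← h]
  refine Finset.sum_congr rfl fun l hl => ?_
  have h2 := raney₁_mul (show l ≤ M + 2 by simpa [Nat.lt_succ_iff] using hl)
  have h3 : (descPochhammer ℝ M).eval (3 * ((l + 1 : ℕ) : ℝ) - 3)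
      = ((3 * l).descFactorial M : ℝ) := by
    rw [← descPochhammer_eval_eq_descFactorial]
    congr 1
    push_cast; ring
  rw [h3]
  push_cast at h2 ⊢
  linear_combination (-1) ^ (M + 2 - l) * h2

end RaneySums

/-! ### Identification of the expansion coefficients at `a = 0`. -/

section Raney

open PowerSeries

theorem coeff_one_sub_X_pow (n j : ℕ) :
    coeff j ((1 - X : ℝ⟦X⟧) ^ n) = (-1) ^ j * n.choose j := by
  have h : (1 - X : ℝ⟦X⟧) ^ n
      = rescale (-1 : ℝ) (((1 + Polynomial.X : Polynomial ℝ) ^ n : Polynomial ℝ) : ℝ⟦X⟧) := by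
    simp [rescale_X, sub_eq_add_neg]
  rw [h, coeff_rescale, Polynomial.coeff_coe, Polynomial.coeff_one_add_X_pow]

theorem geom_zero {A : Type*} [CommRing A] : geom (0 : A) = 1 := by
  have := geom_mul (0 : A)
  simpa using this

theorem rho_zero : rho (0 : ℝ) = X * (1 - X) ^ 2 := by
  simp [rho, rhoUnit, geom_zero]

theorem coeff_rho_zero_pow {k m : ℕ} (h : k ≤ m) :
    coeff m (rho (0 : ℝ) ^ k) = (-1) ^ (m - k) * (2 * k).choose (m - k) := by
  rw [rho_zero, mul_pow, coeff_X_pow_mul', if_pos h, ← pow_mul, coeff_one_sub_X_pow]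

theorem isExpansion_of_coeff {A : Type*} [CommRing A] {φ f : A⟦X⟧} {e : ℕ → A}
    (h : ∀ n, coeff n f = ∑ k ∈ Finset.range (n + 1), e k * coeff n ((X * φ) ^ k)) :
    IsExpansion (X * φ) f e := by
  intro N
  rw [X_pow_dvd_iff]
  intro m hm
  rw [map_sub, map_sum, h m, sub_eq_zero]
  simp only [coeff_C_mul]
  refine Finset.sum_subset (Finset.range_subset_range.2 hm) fun k _ hk => ?_
  rw [Finset.mem_range, not_lt] at hk
  rw [mul_pow, coeff_X_pow_mul', if_neg (by omega), mul_zero]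

/-- For a series without constant term the coefficient at `ρ^0` is zero, so the sequence `e` enters
one place later. -/
theorem isExpansion_shift {f : ℝ⟦X⟧} {e : ℕ → ℝ} (h0 : constantCoeff f = 0)
    (h : ∀ m, coeff (m + 1) f = ∑ l ∈ Finset.range (m + 1),
      e l * ((-1) ^ (m + 1 - (l + 1)) * (2 * (l + 1)).choose (m + 1 - (l + 1)))) :
    IsExpansion (rho (0 : ℝ)) f (fun n => Nat.casesOn n 0 e) := by
  refine isExpansion_of_coeff fun n => ?_
  change _ = ∑ k ∈ Finset.range (n + 1), _ * coeff n (rho (0 : ℝ) ^ k)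
  rw [Finset.sum_range_succ']
  rcases n with _ | n
  · simp [h0]
  · rw [h]
    change _ = _ + 0 * _
    rw [zero_mul, add_zero]
    refine Finset.sum_congr rfl fun l hl => ?_
    rw [coeff_rho_zero_pow (by simpa [Nat.lt_succ_iff] using hl)]

theorem isExpansion_X_raney₂ :
    IsExpansion (rho (0 : ℝ)) X (fun n => Nat.casesOn n 0 raney₂) := by
  refine isExpansion_shift (by simp) fun m => ?_
  rcases m with _ | M
  · simp [raney₂]
  · rw [raney₂_sum, coeff_X, if_neg (by omega)]

theorem isExpansion_X_raney₁ :
    IsExpansion (rho (0 : ℝ)) (X * (1 - X)) (fun n => Nat.casesOn n 0 raney₁) := by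
  refine isExpansion_shift (by simp) fun m => ?_
  rw [coeff_succ_X_mul, map_sub]
  rcases m with _ | _ | M
  · simp [raney₁]
  · simp [raney₁, Finset.sum_range_succ, coeff_one]
    norm_num
  · rw [raney₁_sum]
    simp [coeff_one, coeff_X]

theorem geom_one_mul : (1 - X) * geom (1 : ℝ) = 1 := by
  have := geom_mul (1 : ℝ)
  rw [map_one, one_mul] at this
  rw [mul_comm, this]

/-- At `a = 0` one has `X = ρ/(1-X)²`, so the coefficients are those of `X`, the inverse of `X ↦
X(1-X)²`, shifted by one. -/
theorem eCoeff_at_zero : eCoeff (0 : ℝ) = raney₂ := by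
  have h := isExpansion_X_raney₂
  have e : (X : ℝ⟦X⟧) = rho 0 * geom 1 ^ 2 := by
    rw [rho_zero]
    linear_combination -X * ((1 - X) * geom 1 + 1) * geom_one_mul
  rw [e] at h
  exact (isExpansion_eCoeff 0).unique (constantCoeff_rhoUnit 0)
    (h.of_mul (constantCoeff_rhoUnit 0))

/-- The same argument, with `X(1-X) = ρ(1-X)/(1-X)²`. -/
theorem eCoeff_sub_at_zero : eCoeff (0 : ℝ) - eCoeff' 0 = raney₁ := by
  have h := isExpansion_X_raney₁
  have e : X * (1 - X : ℝ⟦X⟧) = rho 0 * (geom 1 ^ 2 - X * geom 1 ^ 2) := by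
    rw [rho_zero]
    linear_combination -X * (1 - X) * ((1 - X) * geom 1 + 1) * geom_one_mul
  rw [e] at h
  exact ((isExpansion_eCoeff 0).sub (isExpansion_eCoeff' 0)).unique (constantCoeff_rhoUnit 0)
    (h.of_mul (constantCoeff_rhoUnit 0))

end Raney

/-! ### Positive definite Hankel matrices from beta distributions. -/

section HankelPosDef

open MeasureTheory Set ProbabilityTheory

/-- The Hankel matrix of a sequence. -/
def hankel (s : ℕ → ℝ) (n : ℕ) : Matrix (Fin n) (Fin n) ℝ :=
  Matrix.of fun i j => s (i + j)

/-- The unnormalized density of the beta distribution. -/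
noncomputable def betaWeight (α β x : ℝ) : ℝ := x ^ (α - 1) * (1 - x) ^ (β - 1)

theorem betaWeight_eq_re {α β x : ℝ} (h0 : 0 ≤ x) (h1 : x ≤ 1) :
    betaWeight α β x = ((x : ℂ) ^ ((α : ℂ) - 1) * (1 - (x : ℂ)) ^ ((β : ℂ) - 1)).re := by
  norm_cast
  rw [← Complex.ofReal_cpow h0, ← Complex.ofReal_cpow (by linarith), ← Complex.ofReal_mul,
    Complex.ofReal_re, betaWeight]

theorem integrableOn_betaWeight {α β : ℝ} (hα : 0 < α) (hβ : 0 < β) :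
    IntegrableOn (betaWeight α β) (Ioc 0 1) := by
  have h := Complex.betaIntegral_convergent (u := α) (v := β) (by simpa) (by simpa)
  rw [intervalIntegrable_iff_integrableOn_Ioc_of_le (by simp)] at h
  exact (IntegrableOn.congr_fun (Integrable.re h)
    (fun x hx => (betaWeight_eq_re hx.1.le hx.2).symm) measurableSet_Ioc)

theorem integral_betaWeight {α β : ℝ} (hα : 0 < α) (hβ : 0 < β) :
    ∫ x in Ioc 0 1, betaWeight α β x = beta α β := by
  have h := Complex.betaIntegral_convergent (u := α) (v := β) (by simpa) (by simpa)
  rw [intervalIntegrable_iff_integrableOn_Ioc_of_le (by simp)] at h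
  rw [beta_eq_betaIntegralReal α β hα hβ, Complex.betaIntegral,
    intervalIntegral.integral_of_le (by norm_num), ← RCLike.re_to_complex, ← integral_re h]
  exact setIntegral_congr_fun measurableSet_Ioc fun x hx => betaWeight_eq_re hx.1.le hx.2

theorem pow_mul_betaWeight {α β x : ℝ} (hx : 0 < x) (k : ℕ) :
    x ^ k * betaWeight α β x = betaWeight (α + k) β x := by
  rw [betaWeight, betaWeight, ← mul_assoc, ← Real.rpow_natCast, ← Real.rpow_add hx]
  congr 2; ring

theorem beta_succ {α β : ℝ} (hα : 0 < α) (hβ : 0 < β) :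
    beta (α + 1) β * (α + β) = beta α β * α := by
  rw [beta, beta, Real.Gamma_add_one hα.ne', show α + 1 + β = (α + β) + 1 by ring,
    Real.Gamma_add_one (by positivity)]
  have := (Real.Gamma_pos_of_pos (add_pos hα hβ)).ne'
  field_simp

/-- The entries are moments of a positive weight on `(0,1)`, so the quadratic form at `x` is the
integral of `P²` against it, where `P` has coefficients `x`; a nonzero `P` has only finitely many
zeros. -/
theorem hankel_beta_posDef {α β : ℝ} (hα : 0 < α) (hβ : 0 < β) (n : ℕ) :
    (hankel (fun k => beta (α + k) β) n).PosDef := by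
  refine Matrix.PosDef.of_dotProduct_mulVec_pos (by ext i j; simp [hankel, add_comm]) fun x hx => ?_
  set P : Polynomial ℝ := ∑ i : Fin n, Polynomial.C (x i) * Polynomial.X ^ (i : ℕ) with hP
  have hP0 : P ≠ 0 := by
    obtain ⟨i, hi⟩ := Function.ne_iff.1 hx
    intro h
    apply hi
    have := congrArg (fun p => p.coeff (i : ℕ)) h
    simpa [hP, Polynomial.finsetSum_coeff, Polynomial.coeff_X_pow, Fin.val_inj] using this
  have hk : ∀ k : ℕ, 0 < α + k := fun k => by positivity
  have hint : ∀ k : ℕ, IntegrableOn (betaWeight (α + k) β) (Ioc 0 1) := fun k =>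
    integrableOn_betaWeight (hk k) hβ
  have key : ∀ t ∈ Ioc (0 : ℝ) 1, ∑ i : Fin n, ∑ j : Fin n,
      x i * x j * betaWeight (α + (i + j : ℕ)) β t = P.eval t ^ 2 * betaWeight α β t := by
    intro t ht
    rw [hP, Polynomial.eval_finsetSum, sq, Finset.sum_mul_sum, Finset.sum_mul]
    refine Finset.sum_congr rfl fun i _ => ?_
    rw [Finset.sum_mul]
    refine Finset.sum_congr rfl fun j _ => ?_
    rw [← pow_mul_betaWeight ht.1]
    simp only [Polynomial.eval_mul, Polynomial.eval_C, Polynomial.eval_pow, Polynomial.eval_X]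
    ring
  have hint2 : IntegrableOn (fun t => ∑ i : Fin n, ∑ j : Fin n,
      x i * x j * betaWeight (α + (i + j : ℕ)) β t) (Ioc 0 1) :=
    integrable_finsetSum _ fun i _ => integrable_finsetSum _ fun j _ => (hint _).const_mul _
  have e : star x ⬝ᵥ ((hankel (fun k => beta (α + k) β) n).mulVec x)
      = ∫ t in Ioc 0 1, P.eval t ^ 2 * betaWeight α β t := by
    rw [← setIntegral_congr_fun measurableSet_Ioc key, integral_finsetSum _ fun i _ =>
      integrable_finsetSum _ fun j _ => (hint _).const_mul _]
    refine Finset.sum_congr rfl fun i _ => ?_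
    rw [integral_finsetSum _ fun j _ => (hint _).const_mul _, Matrix.mulVec, dotProduct,
      Finset.mul_sum]
    refine Finset.sum_congr rfl fun j _ => ?_
    rw [integral_const_mul, integral_betaWeight (hk _) hβ]
    simp [hankel]
    ring
  have hw : ∀ t ∈ Ioo (0 : ℝ) 1, 0 < betaWeight α β t := fun t ht =>
    mul_pos (Real.rpow_pos_of_pos ht.1 _) (Real.rpow_pos_of_pos (by linarith [ht.2]) _)
  rw [e, integral_Ioc_eq_integral_Ioo, setIntegral_pos_iff_support_of_nonneg_ae]
  · have h1 : Ioo (0 : ℝ) 1 \ (P.roots.toFinset : Set ℝ) ⊆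
        Function.support (fun t => P.eval t ^ 2 * betaWeight α β t) ∩ Ioo 0 1 := by
      rintro t ⟨ht, hr⟩
      refine ⟨?_, ht⟩
      have : P.eval t ≠ 0 := by simpa [hP0] using hr
      exact mul_ne_zero (pow_ne_zero _ this) (hw t ht).ne'
    refine lt_of_lt_of_le ?_ (measure_mono h1)
    rw [measure_sdiff_null (Finset.measure_zero _ _)]
    simp
  · exact ae_restrict_of_forall_mem measurableSet_Ioo fun t ht =>
      mul_nonneg (sq_nonneg _) (hw t ht).le
  · refine IntegrableOn.mono_set ?_ Ioo_subset_Ioc_self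
    exact hint2.congr_fun key measurableSet_Ioc

/-- A sequence with the ratios of the moments of a product of two independent beta variables, up
to scaling, has positive definite Hankel matrices. -/
theorem hankel_posDef_of_ratio {s : ℕ → ℝ} {a b c d κ : ℝ} (ha : 0 < a) (hab : a < b)
    (hc : 0 < c) (hcd : c < d) (hκ : 0 < κ) (h0 : 0 < s 0)
    (hs : ∀ n : ℕ, s (n + 1) * ((n + b) * (n + d)) = κ * s n * ((n + a) * (n + c))) (n : ℕ) :
    (hankel s n).PosDef := by
  set μ : ℕ → ℝ := fun k => beta (a + k) (b - a)
  set ν : ℕ → ℝ := fun k => beta (c + k) (d - c)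
  have hμ : ∀ k, 0 < μ k := fun k => beta_pos (by positivity) (by linarith)
  have hν : ∀ k, 0 < ν k := fun k => beta_pos (by positivity) (by linarith)
  have hb : 0 < b := ha.trans hab
  have hd : 0 < d := hc.trans hcd
  -- The ratio `(k+a)/(k+b)` is that of consecutive moments `μ`, and `(k+c)/(k+d)` that of `ν`.
  have hs' : ∀ k : ℕ, s k = s 0 / (μ 0 * ν 0) * κ ^ k * (μ k * ν k) := by
    intro k
    induction k with
    | zero => have := hμ 0; have := hν 0; field_simp
    | succ k ih =>
      have h1 := beta_succ (show 0 < a + k by positivity) (show 0 < b - a by linarith)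
      have h2 := beta_succ (show 0 < c + k by positivity) (show 0 < d - c by linarith)
      have h3 : (0 : ℝ) < (k + b) * (k + d) := by positivity
      have e1 : μ (k + 1) = beta (a + k + 1) (b - a) := by simp [μ, add_assoc]
      have e2 : ν (k + 1) = beta (c + k + 1) (d - c) := by simp [ν, add_assoc]
      rw [← mul_left_inj' h3.ne', hs, ih, e1, e2, pow_succ]
      have h4 : beta (a + k + 1) (b - a) * (k + b) = μ k * (a + k) := by
        rw [← h1]; ring
      have h5 : beta (c + k + 1) (d - c) * (k + d) = ν k * (c + k) := by
        rw [← h2]; ring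
      linear_combination -s 0 / (μ 0 * ν 0) * κ ^ k * κ *
        (beta (a + k + 1) (b - a) * (k + b) * h5 + ν k * (c + k) * h4)
  -- By the Schur product theorem the entrywise product is positive definite; the factor `κ^(i+j)`
  -- is a congruence by a diagonal matrix.
  have h1 := (hankel_beta_posDef ha (sub_pos.2 hab) n).hadamard
    (hankel_beta_posDef hc (sub_pos.2 hcd) n)
  have h2 : hankel s n = (s 0 / (μ 0 * ν 0)) •
      ((Matrix.diagonal fun i : Fin n => κ ^ (i : ℕ)).conjTranspose *
        ((hankel μ n).hadamard (hankel ν n)) * Matrix.diagonal fun i : Fin n => κ ^ (i : ℕ)) := by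
    ext i j
    simp only [hankel, Matrix.smul_apply, smul_eq_mul, Matrix.diagonal_conjTranspose,
      Matrix.mul_diagonal, Matrix.diagonal_mul, Matrix.hadamard_apply, Matrix.of_apply, hs' (i + j),
      star_trivial]
    ring
  rw [h2]
  refine Matrix.PosDef.smul (h1.conjTranspose_mul_mul_same ?_)
    (div_pos h0 (mul_pos (hμ 0) (hν 0)))
  intro x y hxy
  funext i
  have := congrFun hxy i
  simpa [Matrix.mulVec_diagonal, hκ.ne'] using this

theorem raney₂_succ (n : ℕ) : raney₂ (n + 1) * ((n + 3 / 2) * (n + 2)) =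
    27 / 4 * raney₂ n * ((n + 2 / 3) * (n + 4 / 3)) := by
  rw [raney₂, raney₂, cast_choose_eq (show (n + 1) + (2 * n + 3) = 3 * (n + 1) + 1 by ring),
    cast_choose_eq (show n + (2 * n + 1) = 3 * n + 1 by ring),
    show 3 * (n + 1) + 1 = 3 * n + 1 + 1 + 1 + 1 by ring, show 2 * n + 3 = 2 * n + 1 + 1 + 1 by ring]
  simp only [Nat.factorial_succ]
  push_cast
  field_simp
  ring

theorem raney₁_succ (n : ℕ) : raney₁ (n + 1) * ((n + 3 / 2) * (n + 1)) =
    27 / 4 * raney₁ n * ((n + 1 / 3) * (n + 2 / 3)) := by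
  rw [raney₁, raney₁, cast_choose_eq (show (n + 1) + (2 * n + 2) = 3 * (n + 1) by ring),
    cast_choose_eq (show n + 2 * n = 3 * n by ring),
    show 3 * (n + 1) = 3 * n + 1 + 1 + 1 by ring, show 2 * n + 2 = 2 * n + 1 + 1 by ring]
  simp only [Nat.factorial_succ]
  push_cast
  field_simp
  ring

theorem hankel_raney₂_posDef (n : ℕ) : (hankel raney₂ n).PosDef :=
  hankel_posDef_of_ratio (a := 2 / 3) (b := 3 / 2) (c := 4 / 3) (d := 2) (κ := 27 / 4)
    (by norm_num) (by norm_num) (by norm_num) (by norm_num) (by norm_num) (by norm_num [raney₂])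
    raney₂_succ n

/-- Shifting the sequence by one raises all four parameters of the ratio by one. -/
theorem hankel_raney₂_succ_posDef (n : ℕ) : (hankel (fun k => raney₂ (k + 1)) n).PosDef :=
  hankel_posDef_of_ratio (a := 5 / 3) (b := 5 / 2) (c := 7 / 3) (d := 3) (κ := 27 / 4)
    (by norm_num) (by norm_num) (by norm_num) (by norm_num) (by norm_num)
    (by norm_num [raney₂, Nat.choose]) (fun n => by
      have := raney₂_succ (n + 1)
      push_cast at this
      linear_combination this) n

theorem hankel_raney₁_succ_posDef (n : ℕ) : (hankel (fun k => raney₁ (k + 1)) n).PosDef :=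
  hankel_posDef_of_ratio (a := 4 / 3) (b := 5 / 2) (c := 5 / 3) (d := 2) (κ := 27 / 4)
    (by norm_num) (by norm_num) (by norm_num) (by norm_num) (by norm_num)
    (by norm_num [raney₁, Nat.choose]) (fun n => by
      have := raney₁_succ (n + 1)
      push_cast at this
      linear_combination this) n

end HankelPosDef

/-! ### Determinants of bilinear forms at coalescing nodes. -/

section Confluent

open Polynomial

variable {R S : Type*} [CommRing R] [CommRing S]

/-- The coefficient of `X ^ k` in the remainder of `X ^ m` modulo `∏ᵢ (X - rᵢ)`. -/
noncomputable def remCoeff {n : ℕ} (r : Fin n → R) (m k : ℕ) : R :=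
  ((X : R[X]) ^ m %ₘ ∏ i, (X - C (r i))).coeff k

theorem monic_prod_X_sub {n : ℕ} (r : Fin n → R) : (∏ i, (X - C (r i))).Monic :=
  monic_prod_of_monic _ _ fun i _ => monic_X_sub_C (r i)

/-- Each node is a zero of the divisor, so `X^m` and its remainder agree there. -/
theorem pow_eq_sum_remCoeff [Nontrivial R] {n : ℕ} (r : Fin n → R) (m : ℕ) (i : Fin n) :
    r i ^ m = ∑ k : Fin n, r i ^ (k : ℕ) * remCoeff r m k := by
  set q : R[X] := ∏ i, (X - C (r i)) with hq
  have hm : q.Monic := monic_prod_X_sub r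
  have h0 : q.eval (r i) = 0 := by
    rw [hq, eval_prod]
    exact Finset.prod_eq_zero (Finset.mem_univ i) (by simp)
  have hdeg : ((X : R[X]) ^ m %ₘ q).degree < n := by
    have := degree_modByMonic_lt ((X : R[X]) ^ m) hm
    rw [hq, degree_prod_of_monic _ _ fun i _ => monic_X_sub_C (r i)] at this
    simpa only [degree_X_sub_C, Finset.sum_const, Finset.card_univ, Fintype.card_fin,
      nsmul_eq_mul, mul_one] using this
  have h1 := congrArg (eval (r i)) (modByMonic_add_div ((X : R[X]) ^ m) q)
  rw [eval_add, eval_mul, h0, zero_mul, add_zero, eval_pow, eval_X] at h1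
  rw [← h1]
  have h2 : (X : R[X]) ^ m %ₘ q = ∑ k ∈ Finset.range n,
      C (((X : R[X]) ^ m %ₘ q).coeff k) * X ^ k := by
    ext d
    simp only [finsetSum_coeff, coeff_C_mul, coeff_X_pow, mul_ite, mul_one, mul_zero,
      Finset.sum_ite_eq, Finset.mem_range]
    split_ifs with hd
    · rfl
    · exact coeff_eq_zero_of_degree_lt (hdeg.trans_le (by exact_mod_cast not_lt.1 hd))
  rw [h2, eval_finsetSum, Finset.sum_range]
  refine Finset.sum_congr rfl fun k _ => ?_
  rw [eval_mul, eval_C, eval_pow, eval_X, mul_comm]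
  rfl

/-- Reducing high powers of the nodes to the first `n` pulls out both Vandermonde determinants
without any division, so the remaining determinant makes sense when nodes coincide. -/
theorem det_bilinear_eq [Nontrivial R] {n N : ℕ} (r t : Fin n → R) (M : Matrix (Fin N) (Fin N) R) :
    Matrix.det (Matrix.of fun i j : Fin n =>
      ∑ p : Fin N, ∑ q : Fin N, M p q * r i ^ (p : ℕ) * t j ^ (q : ℕ)) =
    (Matrix.vandermonde r).det * (Matrix.vandermonde t).det *
      Matrix.det (Matrix.of fun k l : Fin n =>
        ∑ p : Fin N, ∑ q : Fin N, remCoeff r p k * M p q * remCoeff t q l) := by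
  rw [mul_right_comm, ← Matrix.det_mul, ← Matrix.det_transpose (Matrix.vandermonde t),
    ← Matrix.det_mul]
  congr 1
  ext i j
  simp only [Matrix.of_apply, Matrix.mul_apply, Matrix.vandermonde_apply, Matrix.transpose_apply]
  simp_rw [Finset.mul_sum, Finset.sum_mul]
  simp_rw [Finset.sum_comm (s := (Finset.univ : Finset (Fin n))) (t := (Finset.univ : Finset (Fin N)))]
  refine Finset.sum_congr rfl fun p _ => Finset.sum_congr rfl fun q _ => ?_
  rw [pow_eq_sum_remCoeff r p i, pow_eq_sum_remCoeff t q j, mul_assoc, Finset.sum_mul_sum,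
    Finset.mul_sum, Finset.sum_comm]
  refine Finset.sum_congr rfl fun k _ => ?_
  rw [Finset.mul_sum]
  refine Finset.sum_congr rfl fun l _ => ?_
  ring

/-- When all nodes go to zero the divisor becomes `X^n`. In the confluent limit only the leading `n
× n` block of the coefficient matrix therefore survives. -/
theorem map_remCoeff [Nontrivial S] (φ : R →+* S) {n : ℕ} {r : Fin n → R} (hr : ∀ i, φ (r i) = 0)
    (m : ℕ) (k : Fin n) : φ (remCoeff r m k) = if m = k then 1 else 0 := by
  rw [remCoeff, ← coeff_map, map_modByMonic _ (monic_prod_X_sub r), Polynomial.map_prod]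
  simp only [Polynomial.map_pow, map_X, Polynomial.map_sub, map_C, hr, map_zero, sub_zero,
    Finset.prod_const, Finset.card_univ, Fintype.card_fin]
  rcases lt_or_ge m n with h | h
  · rw [(modByMonic_eq_self_iff (monic_X_pow n)).2 (by rw [degree_X_pow, degree_X_pow]; exact_mod_cast h),
      coeff_X_pow]
    simp [eq_comm]
  · rw [(modByMonic_eq_zero_iff_dvd (monic_X_pow n)).2 (pow_dvd_pow _ h), coeff_zero,
      if_neg (by omega)]

theorem map_det_remCoeff [Nontrivial S] (φ : R →+* S) {n N : ℕ} (hN : n ≤ N) {r t : Fin n → R}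
    (hr : ∀ i, φ (r i) = 0) (ht : ∀ i, φ (t i) = 0) (M : ℕ → ℕ → R) :
    φ (Matrix.det (Matrix.of fun k l : Fin n =>
        ∑ p : Fin N, ∑ q : Fin N, remCoeff r p k * M p q * remCoeff t q l)) =
      Matrix.det (Matrix.of fun k l : Fin n => φ (M k l)) := by
  rw [RingHom.map_det]
  congr 1
  ext k l
  simp only [RingHom.mapMatrix_apply, Matrix.map_apply, Matrix.of_apply, map_sum, map_mul,
    map_remCoeff φ hr, map_remCoeff φ ht]
  rw [Finset.sum_eq_single ⟨k, k.2.trans_le hN⟩, Finset.sum_eq_single ⟨l, l.2.trans_le hN⟩]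
  · simp
  · intro b _ hb
    rw [if_neg (fun h => hb (Fin.ext h)), mul_zero]
  · simp
  · intro b _ hb
    refine Finset.sum_eq_zero fun c _ => ?_
    rw [if_neg (fun h => hb (Fin.ext h)), zero_mul, zero_mul]
  · simp

/-- Multiplication by `1 - c r t` telescopes along diagonals and leaves the first column and first
row. Nilpotency of `r` and `t` removes the truncation terms. -/
theorem sum_mul_one_sub {Q : Type*} [CommRing Q] {r t c : Q} {N : ℕ} (hr : r ^ N = 0)
    (ht : t ^ N = 0) (M : ℕ → ℕ → Q) (hM : ∀ p q, M (p + 1) (q + 1) = c * M p q) :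
    (∑ p ∈ Finset.range N, ∑ q ∈ Finset.range N, M p q * r ^ p * t ^ q) * (1 - c * (r * t)) =
      ∑ p ∈ Finset.range N, M p 0 * r ^ p +
        t * ∑ q ∈ Finset.range N, M 0 (q + 1) * t ^ q := by
  set s := ∑ p ∈ Finset.range N, ∑ q ∈ Finset.range N, M p q * r ^ p * t ^ q with hs
  have e : s = ∑ p ∈ Finset.range (N + 1), ∑ q ∈ Finset.range (N + 1), M p q * r ^ p * t ^ q := by
    simp [Finset.sum_range_succ, hr, ht, hs]
  have e2 : ∑ p ∈ Finset.range N, M p 0 * r ^ p = ∑ p ∈ Finset.range (N + 1), M p 0 * r ^ p := by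
    simp [Finset.sum_range_succ, hr]
  have e3 : s = ∑ p ∈ Finset.range (N + 1), M p 0 * r ^ p +
      t * ∑ q ∈ Finset.range N, M 0 (q + 1) * t ^ q + c * (r * t) * s := by
    nth_rewrite 1 [e]
    simp_rw [Finset.sum_range_succ' _ N, Finset.sum_add_distrib]
    simp only [hM, hs, Finset.mul_sum, pow_zero, mul_one]
    have h1 : ∀ p q, c * M p q * r ^ (p + 1) * t ^ (q + 1) = c * (r * t) * (M p q * r ^ p * t ^ q) :=
      fun p q => by ring
    have h2 : ∀ q, M 0 (q + 1) * t ^ (q + 1) = t * (M 0 (q + 1) * t ^ q) := fun q => by ring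
    simp only [h1, h2]
    ring
  rw [e2]
  linear_combination e3

end Confluent

/-! ### The moments and the factorization of the kernel `F / G`. -/

/-- The cross-ratio like parameter `(2ζ+1)(ζ+2)/ζ`. -/
noncomputable def aPar (ζ : ℝ) : ℝ := (2 * ζ + 1) * (ζ + 2) / ζ

/-- The coefficient `(ζ+2)(3ζ+1)/ζ`. -/
noncomputable def βPar (ζ : ℝ) : ℝ := (ζ + 2) * (3 * ζ + 1) / ζ

/-- The coefficients of the expansion at `2ζ+1`. -/
noncomputable def momA (ζ : ℝ) (n : ℕ) : ℝ :=
  βPar ζ * eCoeff (aPar ζ) n + -(ζ + 3) * aPar ζ * eCoeff' (aPar ζ) n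

/-- The coefficients of the expansion at `ζ/(ζ+2)`. -/
noncomputable def momB (ζ : ℝ) (n : ℕ) : ℝ :=
  -(ζ + 3) * eCoeff (aPar ζ) n + βPar ζ * eCoeff' (aPar ζ) n

/-- The two-sided moment sequence. -/
noncomputable def moment (ζ : ℝ) : ℤ → ℝ
  | Int.ofNat n => (aPar ζ ^ (3 * n + 2))⁻¹ * momA ζ n
  | Int.negSucc n => -momB ζ n

theorem G_div {K : Type*} [Field K] {ζ A B U V : K} (hU : U ≠ 0) (hV : V ≠ 0) :
    G ζ (A / U) (B / V) = ((ζ + 2) * A * B * (A * V + B * U) -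
      ζ * (A ^ 2 * V ^ 2 + B ^ 2 * U ^ 2) - 2 * (ζ ^ 2 + 3 * ζ + 1) * A * B * U * V +
      ζ * (2 * ζ + 1) * (A * V + B * U) * U * V) / (U ^ 2 * V ^ 2) := by
  rw [G]
  field_simp

theorem F_div {K : Type*} [Field K] {ζ A B U V z : K} (hU : U ≠ 0) (hV : V ≠ 0) :
    F ζ (A / U) (B / V) z = ((ζ + 2) * A * B * z - ζ * (A * B + B * z * U + A * z * V + A * V +
      B * U + z * U * V) + ζ * (2 * ζ + 1) * U * V) / (U * V) := by
  rw [F]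
  field_simp

/-- On the two curves `1 - a³ρ(T)ρ(T')` has numerator `1 - aTT'` times the quadratic factor of `G`
(`e1`, `e3`), while `F * (1 - aTT')` separates into two products, each of a function of `T` and one
of `T'` (`e2`). -/
theorem F_div_G_field {K : Type*} [Field K] {ζ T T' : K} (h0 : ζ ≠ 0) (h2 : ζ + 2 ≠ 0)
    (hu : 1 - (2 * ζ + 1) * (ζ + 2) / ζ * T ≠ 0) (hv : 1 - T ≠ 0)
    (hu' : 1 - (2 * ζ + 1) * (ζ + 2) / ζ * T' ≠ 0) (hv' : 1 - T' ≠ 0) :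
    F ζ ((2 * ζ + 1) * (1 - T) / (1 - (2 * ζ + 1) * (ζ + 2) / ζ * T))
      (ζ / (ζ + 2) * (1 - (2 * ζ + 1) * (ζ + 2) / ζ * T') / (1 - T')) (2 * ζ + 1) *
      ((ζ + 1) / (1 - T')) *
      (1 - ((2 * ζ + 1) * (ζ + 2) / ζ) ^ 3 *
        ((T * (1 - T) ^ 2 / (1 - (2 * ζ + 1) * (ζ + 2) / ζ * T) ^ 2) *
        (T' * (1 - T') ^ 2 / (1 - (2 * ζ + 1) * (ζ + 2) / ζ * T') ^ 2))) =
    -G ζ ((2 * ζ + 1) * (1 - T) / (1 - (2 * ζ + 1) * (ζ + 2) / ζ * T))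
      (ζ / (ζ + 2) * (1 - (2 * ζ + 1) * (ζ + 2) / ζ * T') / (1 - T')) *
      ((1 - T) ^ 2 / (1 - (2 * ζ + 1) * (ζ + 2) / ζ * T)) *
      (((ζ + 2) * (3 * ζ + 1) / ζ + -(ζ + 3) * ((2 * ζ + 1) * (ζ + 2) / ζ) * T) / (1 - T) ^ 2 -
        ((2 * ζ + 1) * (ζ + 2) / ζ) ^ 2 *
          (T' * (1 - T') ^ 2 / (1 - (2 * ζ + 1) * (ζ + 2) / ζ * T') ^ 2) *
          ((-(ζ + 3) + (ζ + 2) * (3 * ζ + 1) / ζ * T') / (1 - T') ^ 2)) := by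
  set a := (2 * ζ + 1) * (ζ + 2) / ζ with ha
  set β := (ζ + 2) * (3 * ζ + 1) / ζ with hβ
  have e1 : G ζ ((2 * ζ + 1) * (1 - T) / (1 - a * T)) (ζ / (ζ + 2) * (1 - a * T') / (1 - T')) =
      2 * (ζ + 1) ^ 2 * (ζ / (ζ + 2)) ^ 2 *
        ((1 - a * T - a * T' + a * (T * T')) ^ 2 - (a - 1) ^ 2 * a * (T * T')) /
        ((1 - a * T) ^ 2 * (1 - T') ^ 2) := by
    rw [G_div hu hv']
    congr 1
    rw [ha]
    clear_value a β
    clear hu hv hu' hv' ha hβ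
    field_simp
    ring
  have e2 : F ζ ((2 * ζ + 1) * (1 - T) / (1 - a * T)) (ζ / (ζ + 2) * (1 - a * T') / (1 - T'))
      (2 * ζ + 1) * (1 - a * (T * T')) = -2 * (ζ + 1) * (ζ / (ζ + 2)) ^ 2 *
        ((1 - a * T') ^ 2 * (β + -(ζ + 3) * a * T) -
          a ^ 2 * (1 - T) ^ 2 * T' * (-(ζ + 3) + β * T')) / ((1 - a * T) * (1 - T')) := by
    rw [F_div hu hv', div_mul_eq_mul_div]
    congr 1
    rw [ha, hβ]
    field_simp
    ring
  have e3 : 1 - a ^ 3 * ((T * (1 - T) ^ 2 / (1 - a * T) ^ 2) * (T' * (1 - T') ^ 2 / (1 - a * T') ^ 2))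
      = (1 - a * (T * T')) * ((1 - a * T - a * T' + a * (T * T')) ^ 2 - (a - 1) ^ 2 * a * (T * T'))
        / ((1 - a * T) ^ 2 * (1 - a * T') ^ 2) := by
    field_simp
    ring
  generalize (1 - a * T - a * T' + a * (T * T')) ^ 2 - (a - 1) ^ 2 * a * (T * T') = D at e1 e3
  rw [e1, e3]
  generalize F ζ _ _ _ = f at e2 ⊢
  rw [show f * ((ζ + 1) / (1 - T')) *
      ((1 - a * (T * T')) * D / ((1 - a * T) ^ 2 * (1 - a * T') ^ 2)) = f * (1 - a * (T * T')) *
      (((ζ + 1) / (1 - T')) * D / ((1 - a * T) ^ 2 * (1 - a * T') ^ 2)) by ring, e2]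
  generalize hU : 1 - a * T = U at *
  generalize hU' : 1 - a * T' = U' at *
  generalize hV : 1 - T = V at *
  generalize hV' : 1 - T' = V' at *
  clear e1 e2 e3
  clear_value a β
  field_simp

theorem map_F {R K : Type*} [CommRing R] [CommRing K] (φ : R →+* K) (ζ x y z : R) :
    φ (F ζ x y z) = F (φ ζ) (φ x) (φ y) (φ z) := by
  simp [F, map_ofNat]

theorem map_G {R K : Type*} [CommRing R] [CommRing K] (φ : R →+* K) (ζ x y : R) :
    φ (G ζ x y) = G (φ ζ) (φ x) (φ y) := by
  simp [G, map_ofNat]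

/-- The field identity is pulled back from the fraction field, with inverses as named elements, so
that it applies to power series. -/
theorem F_mul_eq_G_mul {R : Type*} [CommRing R] [IsDomain R] {ζ y a β T T' g h g' h' : R}
    (h0 : ζ ≠ 0) (h2 : ζ + 2 ≠ 0) (hy : y * (ζ + 2) = ζ) (ha : a * ζ = (2 * ζ + 1) * (ζ + 2))
    (hβ : β * ζ = (ζ + 2) * (3 * ζ + 1)) (hg : g * (1 - a * T) = 1) (hh : h * (1 - T) = 1)
    (hg' : g' * (1 - a * T') = 1) (hh' : h' * (1 - T') = 1) :
    F ζ ((2 * ζ + 1) * (1 - T) * g) (y * (1 - a * T') * h') (2 * ζ + 1) * ((ζ + 1) * h') *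
      (1 - a ^ 3 * ((T * (1 - T) ^ 2 * g ^ 2) * (T' * (1 - T') ^ 2 * g' ^ 2))) =
    -G ζ ((2 * ζ + 1) * (1 - T) * g) (y * (1 - a * T') * h') * ((1 - T) ^ 2 * g) *
      ((β + -(ζ + 3) * a * T) * h ^ 2 -
        a ^ 2 * (T' * (1 - T') ^ 2 * g' ^ 2) * ((-(ζ + 3) + β * T') * h' ^ 2)) := by
  let φ := algebraMap R (FractionRing R)
  have hφ : Function.Injective φ := IsFractionRing.injective R (FractionRing R)
  have ne : ∀ {x : R}, x ≠ 0 → φ x ≠ 0 := fun hx => (map_ne_zero_iff φ hφ).2 hx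
  have inv : ∀ {x y : R}, x * y = 1 → φ y ≠ 0 ∧ φ x = (φ y)⁻¹ := by
    intro x y hxy
    have := congrArg φ hxy
    rw [map_mul, map_one] at this
    exact ⟨right_ne_zero_of_mul_eq_one this, eq_inv_of_mul_eq_one_left this⟩
  have k0 := ne h0
  have k2 : φ ζ + 2 ≠ 0 := by simpa [map_ofNat] using ne h2
  have ea : φ a = (2 * φ ζ + 1) * (φ ζ + 2) / φ ζ := by
    rw [eq_div_iff k0]; simpa [map_ofNat] using congrArg φ ha
  have eβ : φ β = (φ ζ + 2) * (3 * φ ζ + 1) / φ ζ := by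
    rw [eq_div_iff k0]; simpa [map_ofNat] using congrArg φ hβ
  have ey : φ y = φ ζ / (φ ζ + 2) := by
    rw [eq_div_iff k2]; simpa [map_ofNat] using congrArg φ hy
  have ig := inv hg
  have ih := inv hh
  have ig' := inv hg'
  have ih' := inv hh'
  simp only [map_sub, map_one, map_mul, ea] at ig ih ig' ih'
  have key := F_div_G_field k0 k2 ig.1 ih.1 ig'.1 ih'.1
  apply hφ
  simp only [map_mul, map_sub, map_add, map_neg, map_pow, map_one, map_F, map_G, map_ofNat, ea,
    eβ, ey, ig.2, ih.2, ig'.2, ih'.2]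
  simp only [div_eq_mul_inv, inv_pow] at key ⊢
  exact key

theorem S_mul_vdm (n : ℕ) : S n * vdm n = num n := by
  have h : algebraMap (PolyRing n) (FractionRing (PolyRing n)) (S n) = SRat n :=
    (exists_S n).choose_spec
  have h0 : algebraMap (PolyRing n) (FractionRing (PolyRing n)) (vdm n) ≠ 0 :=
    (map_ne_zero_iff _ (IsFractionRing.injective _ _)).2 (vdm_ne_zero n)
  rw [SRat_eq, eq_div_iff h0, ← map_mul] at h
  exact IsFractionRing.injective (PolyRing n) (FractionRing (PolyRing n)) h

/-! ### From the specialization of `S` to a Toeplitz determinant. -/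

section Identification

open PowerSeries

/-- The `n` points of a curve are taken at parameters `0, X, 2X, …`; they merge at `X = 0`, and each
difference vanishes to order exactly one. -/
theorem exists_rescale_sub_eq {f : ℝ⟦X⟧} (hf : coeff 1 f ≠ 0) {c c' : ℝ} (h : c ≠ c') :
    ∃ u : ℝ⟦X⟧, constantCoeff u ≠ 0 ∧ rescale c f - rescale c' f = X * u := by
  obtain ⟨u, hu⟩ : (X : ℝ⟦X⟧) ∣ rescale c f - rescale c' f := by
    rw [X_dvd_iff, map_sub, ← coeff_zero_eq_constantCoeff_apply,
      ← coeff_zero_eq_constantCoeff_apply, coeff_rescale, coeff_rescale]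
    simp
  refine ⟨u, ?_, hu⟩
  have := congrArg (coeff 1) hu
  rw [map_sub, coeff_rescale, coeff_rescale, show (1 : ℕ) = 0 + 1 from rfl, coeff_succ_X_mul,
    coeff_zero_eq_constantCoeff_apply, zero_add] at this
  rw [← this, pow_one, pow_one, ← sub_mul]
  exact mul_ne_zero (sub_ne_zero.2 h) hf

theorem exists_prod_rescale_sub_eq {f : ℝ⟦X⟧} (hf : coeff 1 f ≠ 0) (n : ℕ) :
    ∃ u : ℝ⟦X⟧, constantCoeff u ≠ 0 ∧
      ∏ i : Fin n, ∏ j ∈ Finset.Ioi i, (rescale ((j : ℕ) : ℝ) f - rescale ((i : ℕ) : ℝ) f) =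
        X ^ (∑ i : Fin n, (Finset.Ioi i).card) * u := by
  have h : ∀ i j : Fin n, ∃ u : ℝ⟦X⟧, i < j → constantCoeff u ≠ 0 ∧
      rescale ((j : ℕ) : ℝ) f - rescale ((i : ℕ) : ℝ) f = X * u := by
    intro i j
    by_cases hij : i < j
    · obtain ⟨u, hu⟩ := exists_rescale_sub_eq hf
        (show ((j : ℕ) : ℝ) ≠ ((i : ℕ) : ℝ) by exact_mod_cast fun h => hij.ne' (Fin.ext h))
      exact ⟨u, fun _ => hu⟩
    · exact ⟨0, fun h => absurd h hij⟩
  choose u hu using h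
  refine ⟨∏ i : Fin n, ∏ j ∈ Finset.Ioi i, u i j, ?_, ?_⟩
  · simp only [map_prod]
    exact Finset.prod_ne_zero_iff.2 fun i _ => Finset.prod_ne_zero_iff.2 fun j hj =>
      (hu i j (Finset.mem_Ioi.1 hj)).1
  · rw [← Finset.prod_pow_eq_pow_sum, ← Finset.prod_mul_distrib]
    refine Finset.prod_congr rfl fun i _ => ?_
    rw [← Finset.prod_const, ← Finset.prod_mul_distrib]
    exact Finset.prod_congr rfl fun j hj => (hu i j (Finset.mem_Ioi.1 hj)).2

theorem rescale_C (c b : ℝ) : PowerSeries.rescale c (C b) = C b := by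
  ext n; rw [coeff_rescale, coeff_C]; split_ifs with h <;> simp [h]

theorem IsExpansion.rescale {ρ f : ℝ⟦X⟧} {e : ℕ → ℝ} (h : IsExpansion ρ f e) (c : ℝ) (N : ℕ) :
    (X : ℝ⟦X⟧) ^ N ∣ rescale c f - ∑ k ∈ Finset.range N, C (e k) * rescale c ρ ^ k := by
  have h1 := map_dvd (PowerSeries.rescale c) (h N)
  rw [map_pow, rescale_X, mul_pow] at h1
  have h2 := (dvd_mul_left _ _).trans h1
  simpa only [map_sub, map_sum, map_mul, map_pow, rescale_C] using h2

/-- The curve of points near `2ζ+1` with local parameter `X`. -/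
noncomputable def xSer (ζ : ℝ) : ℝ⟦X⟧ := (2 * C ζ + 1) * (1 - X) * geom (aPar ζ)

/-- The curve of points near `ζ/(ζ+2)` with local parameter `X`. -/
noncomputable def ySer (ζ : ℝ) : ℝ⟦X⟧ := C (ζ / (ζ + 2)) * (1 - C (aPar ζ) * X) * geom 1

/-- The generating function of `momA`. -/
noncomputable def serA (ζ : ℝ) : ℝ⟦X⟧ :=
  (C (βPar ζ) + C (-(ζ + 3) * aPar ζ) * X) * geom 1 ^ 2

/-- The generating function of `momB`. -/
noncomputable def serB (ζ : ℝ) : ℝ⟦X⟧ := (C (-(ζ + 3)) + C (βPar ζ) * X) * geom 1 ^ 2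

theorem isExpansion_serA (ζ : ℝ) : IsExpansion (rho (aPar ζ)) (serA ζ) (momA ζ) := by
  convert! (isExpansion_eCoeff (aPar ζ)).comb (isExpansion_eCoeff' (aPar ζ)) (βPar ζ)
    (-(ζ + 3) * aPar ζ) using 1
  rw [serA]; ring

theorem isExpansion_serB (ζ : ℝ) : IsExpansion (rho (aPar ζ)) (serB ζ) (momB ζ) := by
  convert! (isExpansion_eCoeff (aPar ζ)).comb (isExpansion_eCoeff' (aPar ζ)) (-(ζ + 3))
    (βPar ζ) using 1
  rw [serB]; ring

/-- The coefficients of the kernel `F / G` in the local parameters. -/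
noncomputable def kernelCoeff (ζ : ℝ) (p q : ℕ) : ℝ :=
  aPar ζ ^ 2 * (aPar ζ ^ 3) ^ p * moment ζ ((p : ℤ) - q)

theorem kernelCoeff_succ (ζ : ℝ) (p q : ℕ) :
    kernelCoeff ζ (p + 1) (q + 1) = aPar ζ ^ 3 * kernelCoeff ζ p q := by
  rw [kernelCoeff, kernelCoeff]
  push_cast
  rw [add_sub_add_right_eq_sub]
  ring

theorem kernelCoeff_zero_right {ζ : ℝ} (ha : aPar ζ ≠ 0) (p : ℕ) :
    kernelCoeff ζ p 0 = momA ζ p := by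
  rw [kernelCoeff, Nat.cast_zero, sub_zero]
  change _ * ((aPar ζ ^ (3 * p + 2))⁻¹ * _) = _
  rw [← pow_mul, ← pow_add, add_comm 2, mul_inv_cancel_left₀ (pow_ne_zero _ ha)]

theorem kernelCoeff_zero_left (ζ : ℝ) (q : ℕ) :
    kernelCoeff ζ 0 (q + 1) = -aPar ζ ^ 2 * momB ζ q := by
  have : ((0 : ℕ) : ℤ) - ((q + 1 : ℕ) : ℤ) = Int.negSucc q := by
    rw [Int.negSucc_eq]; push_cast; ring
  rw [kernelCoeff, this]
  change _ * (-momB ζ q) = _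
  ring

variable {ζ : ℝ}

/-- The kernel `F / G` along the two curves, up to units. -/
noncomputable def kernelSer (ζ : ℝ) (i j : ℕ) : ℝ⟦X⟧ :=
  (rescale (i : ℝ) (serA ζ) - C (aPar ζ ^ 2) * rescale (j : ℝ) (rho (aPar ζ)) *
    rescale (j : ℝ) (serB ζ)) *
  (1 - C (aPar ζ ^ 3) * (rescale (i : ℝ) (rho (aPar ζ)) * rescale (j : ℝ) (rho (aPar ζ))))⁻¹

theorem constantCoeff_rescale (c : ℝ) (f : ℝ⟦X⟧) :
    constantCoeff (rescale c f) = constantCoeff f := by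
  rw [← coeff_zero_eq_constantCoeff_apply, coeff_rescale, pow_zero, one_mul,
    coeff_zero_eq_constantCoeff_apply]

theorem constantCoeff_rescale_rho (c a : ℝ) : constantCoeff (rescale c (rho a)) = 0 := by
  rw [constantCoeff_rescale, rho, map_mul, constantCoeff_X, zero_mul]

theorem constantCoeff_kernel_denom (a b c c' : ℝ) :
    constantCoeff (1 - C b * (rescale c (rho a) * rescale c' (rho a))) ≠ 0 := by
  simp only [map_sub, map_mul, constantCoeff_rescale_rho, map_one]
  norm_num

theorem kernelSer_mul (ζ : ℝ) (i j : ℕ) : kernelSer ζ i j *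
    (1 - C (aPar ζ ^ 3) * (rescale (i : ℝ) (rho (aPar ζ)) * rescale (j : ℝ) (rho (aPar ζ)))) =
    rescale (i : ℝ) (serA ζ) - C (aPar ζ ^ 2) * rescale (j : ℝ) (rho (aPar ζ)) *
    rescale (j : ℝ) (serB ζ) := by
  rw [kernelSer, mul_assoc, PowerSeries.inv_mul_cancel _ (constantCoeff_kernel_denom _ _ _ _),
    mul_one]

theorem X_pow_dvd_rescale_rho_pow (a c : ℝ) (N : ℕ) :
    (X : ℝ⟦X⟧) ^ N ∣ rescale c (rho a) ^ N :=
  pow_dvd_pow_of_dvd (X_dvd_iff.2 (constantCoeff_rescale_rho c a)) N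

/-- Modulo `X^N` both sides agree after multiplication by the unit `1 - a³ρρ'`: the boundary column
of `kernelCoeff` is `momA` and the boundary row is `-a²` times `momB`. -/
theorem X_pow_dvd_kernelSer_sub (ha : aPar ζ ≠ 0) (N i j : ℕ) :
    (X : ℝ⟦X⟧) ^ N ∣ kernelSer ζ i j - ∑ p ∈ Finset.range N, ∑ q ∈ Finset.range N,
      C (kernelCoeff ζ p q) * rescale (i : ℝ) (rho (aPar ζ)) ^ p *
        rescale (j : ℝ) (rho (aPar ζ)) ^ q := by
  set I : Ideal ℝ⟦X⟧ := Ideal.span {X ^ N} with hI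
  set π := Ideal.Quotient.mk I
  have hπ : ∀ f g : ℝ⟦X⟧, (X : ℝ⟦X⟧) ^ N ∣ f - g ↔ π f = π g := by
    intro f g
    rw [Ideal.Quotient.eq, hI, Ideal.mem_span_singleton]
  have hπ0 : ∀ f : ℝ⟦X⟧, (X : ℝ⟦X⟧) ^ N ∣ f → π f = 0 := by
    intro f hf
    rw [← map_zero π, ← hπ, sub_zero]; exact hf
  set r := rescale (i : ℝ) (rho (aPar ζ)) with hr
  set t := rescale (j : ℝ) (rho (aPar ζ)) with ht
  have hA := (hπ _ _).1 ((isExpansion_serA ζ).rescale i N)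
  have hB := (hπ _ _).1 ((isExpansion_serB ζ).rescale j N)
  have hS := sum_mul_one_sub (r := π r) (t := π t) (c := π (C (aPar ζ ^ 3))) (N := N)
    (by rw [← map_pow]; exact hπ0 _ (X_pow_dvd_rescale_rho_pow _ _ _))
    (by rw [← map_pow]; exact hπ0 _ (X_pow_dvd_rescale_rho_pow _ _ _))
    (fun p q => π (C (kernelCoeff ζ p q)))
    (fun p q => by rw [kernelCoeff_succ, map_mul, map_mul])
  have hk := congrArg π (kernelSer_mul ζ i j)
  rw [hπ]
  have hu : IsUnit (π (1 - C (aPar ζ ^ 3) * (r * t))) := by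
    apply IsUnit.map
    rw [PowerSeries.isUnit_iff_constantCoeff, isUnit_iff_ne_zero]
    exact constantCoeff_kernel_denom _ _ _ _
  rw [← hu.mul_left_inj, ← map_mul, hk]
  simp only [map_sub, map_mul, map_sum, map_pow, map_one] at hA hB hS ⊢
  rw [hS, hA, hB]
  simp only [kernelCoeff_zero_right ha, kernelCoeff_zero_left, map_mul, map_neg, map_pow,
    Finset.mul_sum, sub_eq_add_neg, ← Finset.sum_neg_distrib]
  congr 1
  refine Finset.sum_congr rfl fun q _ => ?_
  ring

theorem aPar_mul (h0 : ζ ≠ 0) : aPar ζ * ζ = (2 * ζ + 1) * (ζ + 2) := by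
  rw [aPar, div_mul_cancel₀ _ h0]

theorem F_eq_G_mul_kernelSer (h0 : ζ ≠ 0) (h1 : ζ + 1 ≠ 0) (h2 : ζ + 2 ≠ 0) (i j : ℕ) :
    F (C ζ) (rescale (i : ℝ) (xSer ζ)) (rescale (j : ℝ) (ySer ζ)) (2 * C ζ + 1) =
      (-rescale (i : ℝ) ((1 - X) ^ 2 * geom (aPar ζ))) *
      (C (ζ + 1)⁻¹ * rescale (j : ℝ) (1 - X)) *
      G (C ζ) (rescale (i : ℝ) (xSer ζ)) (rescale (j : ℝ) (ySer ζ)) * kernelSer ζ i j := by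
  have hC0 : (C ζ : ℝ⟦X⟧) ≠ 0 := by simpa using h0
  have hC2 : (C ζ : ℝ⟦X⟧) + 2 ≠ 0 := by
    have : (C (ζ + 2) : ℝ⟦X⟧) ≠ 0 := by rwa [Ne, map_eq_zero_iff C C_injective]
    rwa [map_add, map_ofNat] at this
  have hC1 : (C (ζ + 1)⁻¹ : ℝ⟦X⟧) * (C ζ + 1) = 1 := by
    rw [← map_one (C : ℝ →+* ℝ⟦X⟧), ← map_add, ← map_mul, inv_mul_cancel₀ h1]
  have cast : ∀ {x y : ℝ}, x = y → (C x : ℝ⟦X⟧) = C y := fun h => h ▸ rfl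
  have hy : (C (ζ / (ζ + 2)) : ℝ⟦X⟧) * (C ζ + 2) = C ζ := by
    have := cast (div_mul_cancel₀ ζ h2)
    simpa [map_ofNat] using this
  have ha : (C (aPar ζ) : ℝ⟦X⟧) * C ζ = (2 * C ζ + 1) * (C ζ + 2) := by
    have := cast (aPar_mul h0)
    simpa [map_ofNat] using this
  have hβ : (C (βPar ζ) : ℝ⟦X⟧) * C ζ = (C ζ + 2) * (3 * C ζ + 1) := by
    have := cast (div_mul_cancel₀ ((ζ + 2) * (3 * ζ + 1)) h0)
    rw [← βPar] at this
    simpa [map_ofNat] using this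
  have hg : ∀ c : ℝ, rescale c (geom (aPar ζ)) * (1 - C (aPar ζ) * rescale c X) = 1 := fun c => by
    simpa [rescale_C] using congrArg (rescale c) (geom_mul (aPar ζ))
  have hh : ∀ c : ℝ, rescale c (geom 1) * (1 - rescale c X) = 1 := fun c => by
    simpa [rescale_C] using congrArg (rescale c) (geom_mul (1 : ℝ))
  have key := F_mul_eq_G_mul hC0 hC2 hy ha hβ (hg i) (hh i) (hg j) (hh j)
  have hx : rescale (i : ℝ) (xSer ζ) =
      (2 * C ζ + 1) * (1 - rescale (i : ℝ) X) * rescale (i : ℝ) (geom (aPar ζ)) := by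
    simp only [xSer, map_mul, map_sub, map_add, map_one, map_ofNat, rescale_C]
  have hy : rescale (j : ℝ) (ySer ζ) = C (ζ / (ζ + 2)) * (1 - C (aPar ζ) * rescale (j : ℝ) X) *
      rescale (j : ℝ) (geom 1) := by
    simp only [ySer, map_mul, map_sub, map_one, rescale_C]
  have hr : ∀ c : ℝ, rescale c (rho (aPar ζ)) =
      rescale c X * (1 - rescale c X) ^ 2 * rescale c (geom (aPar ζ)) ^ 2 := fun c => by
    simp only [rho, rhoUnit, map_mul, map_sub, map_one, map_pow, mul_assoc]
  have hk := kernelSer_mul ζ i j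
  have hd : (1 - C (aPar ζ ^ 3) * (rescale (i : ℝ) (rho (aPar ζ)) *
      rescale (j : ℝ) (rho (aPar ζ)))) ≠ 0 := by
    intro h
    apply constantCoeff_kernel_denom (aPar ζ) (aPar ζ ^ 3) i j
    rw [h, map_zero]
  rw [← hx, ← hy, ← hr, ← hr, ← map_pow] at key
  have hA : rescale (i : ℝ) (serA ζ) = (C (βPar ζ) + -(C ζ + 3) * C (aPar ζ) * rescale (i : ℝ) X) *
      rescale (i : ℝ) (geom 1) ^ 2 := by
    simp only [serA, map_mul, map_add, map_ofNat, map_neg, map_pow, rescale_C]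
  have hB : rescale (j : ℝ) (serB ζ) = (-(C ζ + 3) + C (βPar ζ) * rescale (j : ℝ) X) *
      rescale (j : ℝ) (geom 1) ^ 2 := by
    simp only [serB, map_mul, map_add, map_ofNat, map_neg, map_pow, rescale_C]
  rw [← hA, ← hB, ← map_pow, ← hk] at key
  apply mul_right_cancel₀ hd
  simp only [map_mul, map_pow, map_sub, map_one] at key ⊢
  generalize F (C ζ) _ _ _ = f at key ⊢
  generalize G (C ζ) _ _ = g at key ⊢
  generalize kernelSer ζ i j = k at key ⊢
  generalize (1 - C (aPar ζ) ^ 3 * _ : ℝ⟦X⟧) = d at key ⊢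
  linear_combination (C (ζ + 1)⁻¹ * (1 - rescale (j : ℝ) X)) * key
    - f * d * C (ζ + 1)⁻¹ * (C ζ + 1) * hh j - f * d * hC1

theorem constantCoeff_xSer : constantCoeff (xSer ζ) = 2 * ζ + 1 := by
  simp [xSer, constantCoeff_geom, map_ofNat]

theorem constantCoeff_ySer : constantCoeff (ySer ζ) = ζ / (ζ + 2) := by
  simp [ySer, constantCoeff_geom]

theorem coeff_one_geom (a : ℝ) : coeff 1 (geom a) = a := by
  simp [geom]

theorem coeff_one_X_mul_geom (a : ℝ) : coeff 1 (X * geom a) = 1 := by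
  have := coeff_succ_X_mul 0 (geom a)
  rwa [coeff_zero_eq_constantCoeff_apply, constantCoeff_geom] at this

theorem aPar_sub_one (h0 : ζ ≠ 0) : aPar ζ - 1 = 2 * (ζ + 1) ^ 2 / ζ := by
  rw [aPar]; field_simp; ring

theorem coeff_one_xSer : coeff 1 (xSer ζ) = (2 * ζ + 1) * (aPar ζ - 1) := by
  have : xSer ζ = C (2 * ζ + 1) * (geom (aPar ζ) - X * geom (aPar ζ)) := by
    simp only [xSer, map_add, map_mul, map_one, map_ofNat]; ring
  rw [this, coeff_C_mul, map_sub, coeff_one_geom, coeff_one_X_mul_geom]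

theorem coeff_one_ySer : coeff 1 (ySer ζ) = ζ / (ζ + 2) * (1 - aPar ζ) := by
  have : ySer ζ = C (ζ / (ζ + 2)) * (geom 1 - C (aPar ζ) * (X * geom 1)) := by
    rw [ySer]; ring
  rw [this, coeff_C_mul, map_sub, coeff_one_geom, coeff_C_mul, coeff_one_X_mul_geom, mul_one]

theorem coeff_one_rho (a : ℝ) : coeff 1 (rho a) = 1 := by
  rw [rho, show (1 : ℕ) = 0 + 1 from rfl, coeff_succ_X_mul, coeff_zero_eq_constantCoeff_apply,
    constantCoeff_rhoUnit]

theorem G_specialized (h2 : ζ + 2 ≠ 0) :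
    G ζ (2 * ζ + 1) (ζ / (ζ + 2)) = 2 * (ζ + 1) ^ 2 * (ζ / (ζ + 2)) ^ 2 := by
  rw [G]; field_simp; ring

/-- Specialization of the variables of `Sₙ` to points of the two curves. -/
noncomputable def curveHom (n : ℕ) (ζ : ℝ) : PolyRing n →+* ℝ⟦X⟧ :=
  MvPolynomial.eval₂Hom ((C : ℝ →+* ℝ⟦X⟧).comp (Polynomial.evalRingHom ζ))
    (Sum.elim (fun i : Fin n => rescale ((i : ℕ) : ℝ) (xSer ζ))
      (Sum.elim (fun j : Fin n => rescale ((j : ℕ) : ℝ) (ySer ζ)) (fun _ => 2 * C ζ + 1)))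

theorem constantCoeff_curveHom_S (n : ℕ) :
    constantCoeff (curveHom n ζ (S n)) = specValue n ζ := by
  have : (constantCoeff (R := ℝ)).comp (curveHom n ζ) = MvPolynomial.eval₂Hom (Polynomial.evalRingHom ζ)
      (Sum.elim (fun _ => 2 * ζ + 1)
        (Sum.elim (fun _ => ζ / (ζ + 2)) (fun _ => 2 * ζ + 1))) := by
    apply MvPolynomial.ringHom_ext
    · intro r; simp [curveHom]
    · rintro (i | j | _)
      · simp [curveHom, constantCoeff_rescale, constantCoeff_xSer]
      · simp [curveHom, constantCoeff_rescale, constantCoeff_ySer]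
      · simp [curveHom, map_ofNat]
  exact DFunLike.congr_fun this (S n)

theorem curveHom_xv {n : ℕ} (i : Fin n) :
    curveHom n ζ (xv i) = rescale ((i : ℕ) : ℝ) (xSer ζ) := by
  simp [curveHom, xv]

theorem curveHom_yv {n : ℕ} (i : Fin n) :
    curveHom n ζ (yv i) = rescale ((i : ℕ) : ℝ) (ySer ζ) := by
  simp [curveHom, yv]

theorem curveHom_zv (n : ℕ) : curveHom n ζ (zv n) = 2 * C ζ + 1 := by
  simp [curveHom, zv]

theorem curveHom_zeta (n : ℕ) : curveHom n ζ (zeta n) = C ζ := by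
  simp [curveHom, zeta]

/-- `specValue n ζ` vanishes exactly when the Toeplitz determinant of the moments does. -/
theorem specValue_eq_zero_iff (n : ℕ) (h0 : ζ ≠ 0) (h1 : ζ + 1 ≠ 0) (h2 : ζ + 2 ≠ 0)
    (h3 : 2 * ζ + 1 ≠ 0) : specValue n ζ = 0 ↔
      Matrix.det (Matrix.of fun i j : Fin n => moment ζ ((i : ℤ) - j)) = 0 := by
  have ha : aPar ζ ≠ 0 := div_ne_zero (mul_ne_zero h3 h2) h0
  have ha1 : aPar ζ - 1 ≠ 0 := by
    rw [aPar_sub_one h0]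
    exact div_ne_zero (mul_ne_zero two_ne_zero (pow_ne_zero _ h1)) h0
  set d := ∑ i : Fin n, (Finset.Ioi i).card with hd
  -- The two Vandermonde determinants cost `X^(2d)`, so this precision leaves an error divisible by
  -- `X^(n+1)`, invisible to the constant coefficient. Also `n ≤ N`, as `map_det_remCoeff` requires.
  set N := 2 * d + 1 + n with hN
  obtain ⟨u₁, hu₁, e₁⟩ := exists_prod_rescale_sub_eq
    (f := xSer ζ) (by rw [coeff_one_xSer]; exact mul_ne_zero h3 ha1) n
  obtain ⟨u₂, hu₂, e₂⟩ := exists_prod_rescale_sub_eq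
    (f := ySer ζ) (by
      rw [coeff_one_ySer]
      exact mul_ne_zero (div_ne_zero h0 h2) (by rw [← neg_sub]; exact neg_ne_zero.2 ha1)) n
  obtain ⟨u₃, hu₃, e₃⟩ := exists_prod_rescale_sub_eq
    (f := rho (aPar ζ)) (by rw [coeff_one_rho]; exact one_ne_zero) n
  rw [← hd] at e₁ e₂ e₃
  have hvdm : curveHom n ζ (vdm n) = X ^ d * u₁ * (X ^ d * u₂) := by
    rw [← e₁, ← e₂, ← Finset.prod_mul_distrib, vdm, map_prod]
    refine Finset.prod_congr rfl fun i _ => ?_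
    rw [map_prod, ← Finset.prod_mul_distrib]
    refine Finset.prod_congr rfl fun j _ => ?_
    rw [map_mul, map_sub, map_sub, curveHom_xv, curveHom_xv, curveHom_yv, curveHom_yv]
  -- The cleared entry is `kernelSer` times a row factor, which absorbs the full product of the `G`,
  -- and a column factor. All are units since `G` does not vanish at the base points.
  obtain ⟨u₄, hu₄, hnum⟩ : ∃ u : ℝ⟦X⟧, constantCoeff u ≠ 0 ∧ curveHom n ζ (num n) =
      u * Matrix.det (Matrix.of fun i j : Fin n => kernelSer ζ i j) := by
    set w : Fin n → ℝ⟦X⟧ := fun i => (-rescale ((i : ℕ) : ℝ) ((1 - X) ^ 2 * geom (aPar ζ))) *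
      ∏ k : Fin n, G (C ζ) (rescale ((i : ℕ) : ℝ) (xSer ζ)) (rescale ((k : ℕ) : ℝ) (ySer ζ))
    set z : Fin n → ℝ⟦X⟧ := fun j => C (ζ + 1)⁻¹ * rescale ((j : ℕ) : ℝ) (1 - X)
    refine ⟨(∏ i, w i) * ∏ j, z j, ?_, ?_⟩
    · rw [map_mul, map_prod, map_prod]
      refine mul_ne_zero (Finset.prod_ne_zero_iff.2 fun i _ => ?_)
        (Finset.prod_ne_zero_iff.2 fun j _ => ?_)
      · simp only [w, map_mul, map_neg, map_prod, constantCoeff_rescale, map_G, constantCoeff_xSer,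
          constantCoeff_ySer, constantCoeff_C, G_specialized h2, constantCoeff_geom, map_pow,
          map_sub, map_one, constantCoeff_X]
        refine mul_ne_zero (by norm_num) (Finset.prod_ne_zero_iff.2 fun _ _ => ?_)
        exact mul_ne_zero (mul_ne_zero two_ne_zero (pow_ne_zero _ h1))
          (pow_ne_zero _ (div_ne_zero h0 h2))
      · simp only [z, map_mul, constantCoeff_rescale, constantCoeff_C, map_sub, map_one,
          constantCoeff_X, sub_zero, mul_one]
        exact inv_ne_zero h1
    · rw [mul_assoc, ← Matrix.det_mul_row, ← Matrix.det_mul_column, num, RingHom.map_det]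
      congr 1
      refine Matrix.ext fun i j => ?_
      simp only [RingHom.mapMatrix_apply, Matrix.map_apply, Matrix.of_apply, map_mul, map_prod,
        map_F, map_G, curveHom_xv, curveHom_yv, curveHom_zv, curveHom_zeta,
        F_eq_G_mul_kernelSer h0 h1 h2, w, z]
      rw [← Finset.mul_prod_erase _ _ (Finset.mem_univ j)]
      ring
  set r : Fin n → ℝ⟦X⟧ := fun i => rescale ((i : ℕ) : ℝ) (rho (aPar ζ)) with hr
  set Q := Matrix.det (Matrix.of fun k l : Fin n => ∑ p : Fin N, ∑ q : Fin N,
    remCoeff r p k * C (kernelCoeff ζ p q) * remCoeff r q l) with hQ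
  obtain ⟨b, hb⟩ : (X : ℝ⟦X⟧) ^ N ∣ Matrix.det (Matrix.of fun i j : Fin n => kernelSer ζ i j) -
      X ^ d * u₃ * (X ^ d * u₃) * Q := by
    have hv : (Matrix.vandermonde r).det = X ^ d * u₃ := by rw [Matrix.det_vandermonde, ← e₃]
    have hbil := det_bilinear_eq r r
      (Matrix.of fun p q : Fin N => (C (kernelCoeff ζ p q) : ℝ⟦X⟧))
    simp only [Matrix.of_apply] at hbil
    rw [hv, ← hQ] at hbil
    rw [← hbil, ← Ideal.mem_span_singleton, ← Ideal.Quotient.eq, RingHom.map_det, RingHom.map_det]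
    congr 1
    refine Matrix.ext fun i j => ?_
    simp only [RingHom.mapMatrix_apply, Matrix.map_apply, Matrix.of_apply]
    rw [Ideal.Quotient.eq, Ideal.mem_span_singleton]
    have := X_pow_dvd_kernelSer_sub ha N i j
    simpa only [Finset.sum_range] using this
  have hconst : constantCoeff Q =
      Matrix.det (Matrix.of fun k l : Fin n => kernelCoeff ζ k l) := by
    rw [hQ, map_det_remCoeff constantCoeff (by omega) (fun i => constantCoeff_rescale_rho _ _)
      (fun i => constantCoeff_rescale_rho _ _) (fun p q => C (kernelCoeff ζ p q))]
    simp
  have hmain : curveHom n ζ (S n) * (u₁ * u₂) = u₄ * (u₃ ^ 2 * Q + X ^ (n + 1) * b) := by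
    have h := congrArg (curveHom n ζ) (S_mul_vdm n)
    rw [map_mul, hvdm, hnum, sub_eq_iff_eq_add.1 hb, hN] at h
    have hX : (X : ℝ⟦X⟧) ^ (2 * d) ≠ 0 := pow_ne_zero _ X_ne_zero
    apply mul_left_cancel₀ hX
    linear_combination h
  have hc := congrArg constantCoeff hmain
  simp only [map_mul, map_add, map_pow, constantCoeff_X, constantCoeff_curveHom_S, hconst] at hc
  rw [zero_pow n.succ_ne_zero, zero_mul, add_zero] at hc
  have hdet : Matrix.det (Matrix.of fun k l : Fin n => kernelCoeff ζ k l) =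
      (∏ k : Fin n, aPar ζ ^ 2 * (aPar ζ ^ 3) ^ (k : ℕ)) *
        Matrix.det (Matrix.of fun i j : Fin n => moment ζ ((i : ℤ) - j)) := by
    rw [← Matrix.det_mul_column]
    rfl
  have hprod : (∏ k : Fin n, aPar ζ ^ 2 * (aPar ζ ^ 3) ^ (k : ℕ)) ≠ 0 :=
    Finset.prod_ne_zero_iff.2 fun k _ => mul_ne_zero (pow_ne_zero _ ha)
      (pow_ne_zero _ (pow_ne_zero _ ha))
  rw [hdet] at hc
  constructor
  · intro h
    rw [h, zero_mul, eq_comm] at hc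
    simpa [hu₃, hu₄, hprod] using hc
  · intro h
    rw [h, mul_zero, mul_zero, mul_zero] at hc
    simpa [hu₁, hu₂] using hc

end Identification

/-! ### Hankel determinants and condensation. -/

section HankelDet

/-- The determinant of the `n × n` Hankel matrix of `c` starting at `m`. -/
noncomputable def hankelDet (c : ℤ → ℝ) (n : ℕ) (m : ℤ) : ℝ :=
  Matrix.det (Matrix.of fun i j : Fin n => c (m + i + j))

theorem det_submatrix_equiv_sq {m n : Type*} [Fintype m] [DecidableEq m] [Fintype n]
    [DecidableEq n] (A : Matrix m m ℝ) (e f : n ≃ m) :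
    (A.submatrix e f).det ^ 2 = A.det ^ 2 := by
  rw [← sq_abs, Matrix.abs_det_submatrix_equiv_equiv, sq_abs]

theorem det_submatrix_equiv_eq_zero_iff {m n : Type*} [Fintype m] [DecidableEq m] [Fintype n]
    [DecidableEq n] (A : Matrix m m ℝ) (e f : n ≃ m) :
    (A.submatrix e f).det = 0 ↔ A.det = 0 := by
  rw [← sq_eq_zero_iff, det_submatrix_equiv_sq, sq_eq_zero_iff]

theorem cast_rev {n : ℕ} (i : Fin n) : ((Fin.rev i : ℕ) : ℤ) = n - 1 - i := by
  rw [Fin.val_rev]; have := i.2; omega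

/-- Reversing the columns turns a Toeplitz matrix into a Hankel matrix and affects only the sign of
the determinant. -/
theorem det_toeplitz_eq_zero_iff (c : ℤ → ℝ) (n : ℕ) :
    Matrix.det (Matrix.of fun i j : Fin n => c ((i : ℤ) - j)) = 0 ↔
      hankelDet c n (1 - n) = 0 := by
  rw [hankelDet, ← det_submatrix_equiv_eq_zero_iff _ (Equiv.refl _) (Fin.revPerm (n := n))]
  have : ((Matrix.of fun i j : Fin n => c ((i : ℤ) - j)).submatrix (Equiv.refl _) Fin.revPerm) =
      Matrix.of fun i j : Fin n => c (1 - n + i + j) := by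
    ext i j
    simp only [Matrix.submatrix_apply, Matrix.of_apply, Equiv.refl_apply, Fin.revPerm_apply,
      cast_rev]
    congr 1; ring
  rw [this]

theorem det_toeplitz_reflect_eq_zero_iff (c : ℤ → ℝ) (n : ℕ) :
    Matrix.det (Matrix.of fun i j : Fin n => c (-1 - ((i : ℤ) - j))) = 0 ↔
      hankelDet c n (-n) = 0 := by
  rw [hankelDet, ← det_submatrix_equiv_eq_zero_iff _ (Fin.revPerm (n := n)) (Equiv.refl _)]
  have : ((Matrix.of fun i j : Fin n => c (-1 - ((i : ℤ) - j))).submatrix Fin.revPerm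
      (Equiv.refl _)) = Matrix.of fun i j : Fin n => c (-n + i + j) := by
    ext i j
    simp only [Matrix.submatrix_apply, Matrix.of_apply, Equiv.refl_apply, Fin.revPerm_apply,
      cast_rev]
    congr 1; ring
  rw [this]

/-- Each entry of the `2 × 2` Schur complement of `N` is a bordered determinant divided by `det N`.
-/
theorem det_fromBlocks_mul_det {k : Type*} [Fintype k] [DecidableEq k] (N : Matrix k k ℝ)
    (hN : N.det ≠ 0) (B : Matrix k (Fin 2) ℝ) (C : Matrix (Fin 2) k ℝ)
    (E : Matrix (Fin 2) (Fin 2) ℝ) :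
    (Matrix.fromBlocks N B C E).det * N.det =
      (Matrix.fromBlocks N (B.submatrix id fun _ : Unit => 0)
        (C.submatrix (fun _ : Unit => 0) id) (E.submatrix (fun _ => 0) fun _ => 0)).det *
      (Matrix.fromBlocks N (B.submatrix id fun _ : Unit => 1)
        (C.submatrix (fun _ : Unit => 1) id) (E.submatrix (fun _ => 1) fun _ => 1)).det -
      (Matrix.fromBlocks N (B.submatrix id fun _ : Unit => 1)
        (C.submatrix (fun _ : Unit => 0) id) (E.submatrix (fun _ => 0) fun _ => 1)).det *
      (Matrix.fromBlocks N (B.submatrix id fun _ : Unit => 0)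
        (C.submatrix (fun _ : Unit => 1) id) (E.submatrix (fun _ => 1) fun _ => 0)).det := by
  have : Invertible N := Matrix.invertibleOfIsUnitDet N hN.isUnit
  simp only [Matrix.det_fromBlocks₁₁]
  rw [Matrix.det_fin_two]
  simp only [Matrix.det_unique, Matrix.sub_apply, Matrix.mul_apply, Matrix.submatrix_apply, id]
  ring

/-- The index equivalence putting the first and last index at the end. -/
noncomputable def middleEquiv (n : ℕ) : Fin n ⊕ Fin 2 ≃ Fin (n + 2) :=
  Equiv.ofBijective (Sum.elim (fun i => i.succ.castSucc) ![0, Fin.last _]) <| by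
    rw [Fintype.bijective_iff_injective_and_card]
    refine ⟨?_, by simp⟩
    rintro (i | i) (j | j) h
    · simpa using h
    · exfalso
      fin_cases j <;> simp [Fin.ext_iff] at h; omega
    · exfalso
      fin_cases i <;> simp [Fin.ext_iff] at h; omega
    · fin_cases i <;> fin_cases j <;> simp [Fin.ext_iff] at h ⊢

/-- The index equivalence putting the first index at the end. -/
noncomputable def tailEquiv (n : ℕ) : Fin n ⊕ Unit ≃ Fin (n + 1) :=
  Equiv.ofBijective (Sum.elim Fin.succ fun _ => 0) <| by
    rw [Fintype.bijective_iff_injective_and_card]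
    refine ⟨?_, by simp⟩
    rintro (i | i) (j | j) h <;> simp [Fin.ext_iff] at h ⊢
    exact h

/-- The index equivalence keeping the last index at the end. -/
noncomputable def initEquiv (n : ℕ) : Fin n ⊕ Unit ≃ Fin (n + 1) :=
  Equiv.ofBijective (Sum.elim Fin.castSucc fun _ => Fin.last n) <| by
    rw [Fintype.bijective_iff_injective_and_card]
    refine ⟨?_, by simp⟩
    rintro (i | i) (j | j) h <;> simp [Fin.ext_iff] at h ⊢ <;> omega

theorem hankelDet_eq_submatrix (c : ℤ → ℝ) (n : ℕ) (m : ℤ) {ι : Type*} [Fintype ι]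
    [DecidableEq ι] (e : ι ≃ Fin n) :
    hankelDet c n m = (Matrix.of fun i j => c (m + (e i : ℕ) + (e j : ℕ))).det := by
  rw [hankelDet, ← Matrix.det_submatrix_equiv_self e]
  rfl

theorem hankelDet_sq_eq_submatrix (c : ℤ → ℝ) (n : ℕ) (m : ℤ) {ι : Type*} [Fintype ι]
    [DecidableEq ι] (e f : ι ≃ Fin n) :
    hankelDet c n m ^ 2 = (Matrix.of fun i j => c (m + (e i : ℕ) + (f j : ℕ))).det ^ 2 := by
  rw [hankelDet, ← det_submatrix_equiv_sq _ e f]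
  rfl

/-- The condensation identity for Hankel determinants, when the inner one does not vanish. -/
theorem hankelDet_condensation (c : ℤ → ℝ) (n : ℕ) (m : ℤ) (h : hankelDet c n (m + 2) ≠ 0) :
    hankelDet c (n + 2) m * hankelDet c n (m + 2) =
      hankelDet c (n + 1) m * hankelDet c (n + 1) (m + 2) - hankelDet c (n + 1) (m + 1) ^ 2 := by
  set w : Fin 2 → ℤ := ![0, n + 1] with hw
  set B : Matrix (Fin n) (Fin 2) ℝ := Matrix.of fun i j => c (m + (i + 1) + w j) with hB
  set C : Matrix (Fin 2) (Fin n) ℝ := Matrix.of fun i j => c (m + w i + (j + 1)) with hC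
  set E : Matrix (Fin 2) (Fin 2) ℝ := Matrix.of fun i j => c (m + w i + w j) with hE
  have key := det_fromBlocks_mul_det (Matrix.of fun i j : Fin n => c (m + 2 + i + j)) h B C E
  -- Hankel symmetry makes the two mixed minors transposes of each other, so their product is a
  -- square; the sign from different row and column orders disappears in it.
  rw [← Matrix.det_transpose (Matrix.fromBlocks _ (B.submatrix id fun _ : Unit => 0)
    (C.submatrix (fun _ : Unit => 1) id) _)] at key
  rw [hankelDet_eq_submatrix c (n + 2) m (middleEquiv n),
    hankelDet_eq_submatrix c (n + 1) m (tailEquiv n),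
    hankelDet_eq_submatrix c (n + 1) (m + 2) (initEquiv n),
    hankelDet_sq_eq_submatrix c (n + 1) (m + 1) (tailEquiv n) (initEquiv n), sq]
  convert! key using 4 <;> refine Matrix.ext fun i j => ?_
  · rcases i with i | i <;> rcases j with j | j <;> (try fin_cases i) <;> (try fin_cases j) <;>
      simp [hB, hC, hE, hw, middleEquiv]  <;> congr 1 <;> ring
  · rcases i with i | i <;> rcases j with j | j <;>
      simp [hB, hC, hE, hw, tailEquiv]  <;> congr 1 <;> ring
  · rcases i with i | i <;> rcases j with j | j <;>
      simp [hB, hC, hE, hw, initEquiv]  <;> congr 1 <;> ring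
  · rcases i with i | i <;> rcases j with j | j <;>
      simp [hB, hC, hE, hw, tailEquiv, initEquiv]  <;> congr 1 <;> ring
  · rcases i with i | i <;> rcases j with j | j <;>
      simp [hB, hC, hE, hw, tailEquiv, initEquiv]  <;> congr 1 <;> ring

end HankelDet

/-! ### The symmetry `ζ ↦ 1/ζ`. -/

theorem aPar_inv {ζ : ℝ} (h0 : ζ ≠ 0) : aPar ζ⁻¹ = aPar ζ := by
  rw [aPar, aPar]; field_simp; ring

/-- Inversion fixes `aPar` and exchanges the roles of `momA` and `momB` up to scaling. The power of
`aPar` is geometric in `m`, so in a Toeplitz determinant it splits into row and column factors. -/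
theorem moment_inv {ζ : ℝ} (h0 : ζ ≠ 0) (h2 : ζ + 2 ≠ 0) (h3 : 2 * ζ + 1 ≠ 0) (m : ℤ) :
    moment ζ m = (ζ + 2) * aPar ζ ^ (-2 - 3 * m) * moment ζ⁻¹ (-1 - m) := by
  have ha : aPar ζ ≠ 0 := div_ne_zero (mul_ne_zero h3 h2) h0
  have e1 : βPar ζ = (ζ + 2) * (ζ⁻¹ + 3) := by rw [βPar]; field_simp; ring
  have e2 : (ζ + 2) * βPar ζ⁻¹ = (ζ + 3) * aPar ζ := by rw [βPar, aPar]; field_simp; ring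
  rcases m with n | n
  · have : (-1 - Int.ofNat n : ℤ) = Int.negSucc n := by rw [Int.negSucc_eq]; simp; ring
    rw [this]
    have e3 : (aPar ζ ^ (3 * n + 2))⁻¹ = aPar ζ ^ (-2 - 3 * (Int.ofNat n)) := by
      rw [← zpow_natCast, ← zpow_neg]; congr 1; push_cast; simp; ring
    simp only [moment, momA, momB, aPar_inv h0, e3, e1]
    linear_combination aPar ζ ^ (-2 - 3 * (Int.ofNat n)) * eCoeff' (aPar ζ) n * e2
  · have : (-1 - Int.negSucc n : ℤ) = Int.ofNat n := by rw [Int.negSucc_eq]; simp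
    rw [this]
    have e3 : aPar ζ ^ (-2 - 3 * (Int.negSucc n)) * (aPar ζ ^ (3 * n + 2))⁻¹ = (aPar ζ)⁻¹ := by
      rw [← zpow_natCast, ← zpow_neg, ← zpow_add₀ ha, ← zpow_neg_one]
      congr 1; rw [Int.negSucc_eq]; push_cast; ring
    have e4 : (aPar ζ)⁻¹ * aPar ζ = 1 := inv_mul_cancel₀ ha
    simp only [moment, momA, momB, aPar_inv h0, e1]
    linear_combination (-(ζ + 2) * (βPar ζ⁻¹ * eCoeff (aPar ζ) n +
      -(ζ⁻¹ + 3) * aPar ζ * eCoeff' (aPar ζ) n)) * e3 - (aPar ζ)⁻¹ * eCoeff (aPar ζ) n * e2 -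
      ((ζ + 3) * eCoeff (aPar ζ) n - (ζ + 2) * (ζ⁻¹ + 3) * eCoeff' (aPar ζ) n) * e4

theorem p_isRoot_iff_hankelDet {ζ : ℝ} (n : ℕ) (h0 : ζ ≠ 0) (h1 : ζ + 1 ≠ 0) (h2 : ζ + 2 ≠ 0)
    (h3 : 2 * ζ + 1 ≠ 0) : (p n).IsRoot ζ ↔ hankelDet (moment ζ) n (1 - n) = 0 := by
  rw [p_isRoot_iff n h0 h1 h2 h3, specValue_eq_zero_iff n h0 h1 h2 h3, det_toeplitz_eq_zero_iff]

theorem p_isRoot_inv_iff_hankelDet {ζ : ℝ} (n : ℕ) (h0 : ζ ≠ 0) (h1 : ζ + 1 ≠ 0) (h2 : ζ + 2 ≠ 0)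
    (h3 : 2 * ζ + 1 ≠ 0) : (p n).IsRoot ζ⁻¹ ↔ hankelDet (moment ζ) n (-n) = 0 := by
  have ha : aPar ζ ≠ 0 := div_ne_zero (mul_ne_zero h3 h2) h0
  have k1 : ζ⁻¹ + 1 ≠ 0 := by
    rw [show ζ⁻¹ + 1 = (ζ + 1) / ζ by field_simp; ring]; exact div_ne_zero h1 h0
  have k2 : ζ⁻¹ + 2 ≠ 0 := by
    rw [show ζ⁻¹ + 2 = (2 * ζ + 1) / ζ by field_simp; ring]; exact div_ne_zero h3 h0
  have k3 : 2 * ζ⁻¹ + 1 ≠ 0 := by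
    rw [show 2 * ζ⁻¹ + 1 = (ζ + 2) / ζ by field_simp; ring]; exact div_ne_zero h2 h0
  rw [p_isRoot_iff n (inv_ne_zero h0) k1 k2 k3,
    specValue_eq_zero_iff n (inv_ne_zero h0) k1 k2 k3, ← det_toeplitz_reflect_eq_zero_iff]
  have e : (Matrix.of fun i j : Fin n => moment ζ (-1 - ((i : ℤ) - j))) =
      Matrix.of fun i j : Fin n => ((ζ + 2) * aPar ζ * aPar ζ ^ (3 * (i : ℕ))) *
        (Matrix.of fun i j : Fin n => (aPar ζ ^ (3 * (j : ℕ)))⁻¹ *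
          (Matrix.of fun i j : Fin n => moment ζ⁻¹ ((i : ℤ) - j)) i j) i j := by
    ext i j
    simp only [Matrix.of_apply]
    rw [moment_inv h0 h2 h3, show (-1 - (-1 - ((i : ℤ) - j))) = (i : ℤ) - j by ring,
      show (-2 - 3 * (-1 - ((i : ℤ) - j))) = 1 + 3 * (i : ℤ) + -(3 * (j : ℤ)) by ring,
      zpow_add₀ ha, zpow_add₀ ha, zpow_one, zpow_neg]
    norm_cast
    ring
  rw [e, Matrix.det_mul_column, Matrix.det_mul_row, mul_eq_zero, mul_eq_zero,
    or_iff_right (Finset.prod_ne_zero_iff.2 fun i _ =>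
      mul_ne_zero (mul_ne_zero h2 ha) (pow_ne_zero _ ha)),
    or_iff_right (Finset.prod_ne_zero_iff.2 fun i _ => inv_ne_zero (pow_ne_zero _ ha))]

/-! ### An abstract Sturm argument for interlacing zeros. -/

section Sturm

open Set Filter Topology

theorem exists_zero_of_sign_change {f : ℝ → ℝ} {s x y : ℝ} (hxy : x < y)
    (hf : ContinuousOn f (Icc x y)) (hx : 0 < s * f x) (hy : 0 < -s * f y) :
    ∃ z, x < z ∧ z < y ∧ f z = 0 := by
  have hg : ContinuousOn (fun t => s * f t) (Icc x y) := continuousOn_const.mul hf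
  obtain ⟨z, hz, hz0⟩ := intermediate_value_Ioo' hxy.le hg
    (show (0 : ℝ) ∈ Ioo (s * f y) (s * f x) from ⟨by linarith, hx⟩)
  refine ⟨z, hz.1, hz.2, (mul_eq_zero.1 hz0).resolve_left ?_⟩
  rintro rfl
  simp at hx

theorem sign_eq_of_no_zero {f : ℝ → ℝ} {s x y : ℝ} {S : Set ℝ} (hS : S.OrdConnected)
    (hf : ContinuousOn f S) (h0 : ∀ t ∈ S, f t ≠ 0) (hx : x ∈ S) (hy : y ∈ S)
    (h : 0 < s * f y) : 0 < s * f x := by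
  by_contra! hx'
  have hs : s ≠ 0 := by rintro rfl; simp at h
  obtain ⟨z, hz, hz0⟩ := hS.isPreconnected.intermediate_value hx hy
    (continuousOn_const.mul hf : ContinuousOn (fun t => s * f t) S)
    (show (0 : ℝ) ∈ Icc (s * f x) (s * f y) from ⟨hx', h.le⟩)
  exact h0 z hz ((mul_eq_zero.1 hz0).resolve_left hs)

/-- A sequence of functions on `(-∞, c)` satisfying a condensation identity at zeroes. -/
structure SturmSequence (c : ℝ) (D M : ℕ → ℝ → ℝ) : Prop where
  continuousOn : ∀ k, ContinuousOn (D k) (Iio c)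
  condensation : ∀ k, ∀ x < c, D k x ≠ 0 → D (k + 1) x = 0 →
    D (k + 2) x * D k x = -M (k + 1) x ^ 2
  pos : ∀ k, ∀ᶠ x in 𝓝[<] c, 0 < D k x
  sign_atBot : ∀ m : ℕ, ∀ᶠ x in atBot, 0 < (-1) ^ (m + 1) * D (2 * m + 1) x
  count : ∀ k (s : Finset ℝ), (∀ x ∈ s, x < c ∧ D k x = 0) → s.card = (k + 1) / 2 →
    ∀ x < c, (D k x = 0 → x ∈ s) ∧ M k x ≠ 0

/-- `u` and `v` list, in decreasing order, interlacing zeroes of `D k` and `D (k + 1)`. -/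
structure InterlacingZeros (c : ℝ) (D : ℕ → ℝ → ℝ) (k : ℕ) (u v : ℕ → ℝ) : Prop where
  left : ∀ j < (k + 1) / 2, D k (u j) = 0
  right : ∀ j < (k + 2) / 2, v j < c ∧ D (k + 1) (v j) = 0
  lt : ∀ j < (k + 1) / 2, u j < v j
  lt_succ : ∀ j, j + 1 < (k + 2) / 2 → v (j + 1) < u j
  sign_left : ∀ j < (k + 1) / 2, 0 < (-1) ^ (j + 1) * D (k + 1) (u j)
  sign_right : ∀ j < (k + 2) / 2, 0 < (-1) ^ j * D k (v j)

variable {c : ℝ} {D M : ℕ → ℝ → ℝ} {k : ℕ} {u v : ℕ → ℝ}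

theorem strictAntiOn_of_succ_lt {N : ℕ} (h : ∀ j, j + 1 < N → v (j + 1) < v j) :
    ∀ i j, i < j → j < N → v j < v i := by
  intro i j hij hj
  induction j, hij using Nat.le_induction with
  | base => exact h _ hj
  | succ j hij ih => exact (h _ hj).trans (ih (by omega))

theorem InterlacingZeros.anti_right (h : InterlacingZeros c D k u v) :
    ∀ i j, i < j → j < (k + 2) / 2 → v j < v i :=
  strictAntiOn_of_succ_lt fun j hj => (h.lt_succ j hj).trans (h.lt j (by omega))

theorem InterlacingZeros.anti_left (h : InterlacingZeros c D k u v) :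
    ∀ i j, i < j → j < (k + 1) / 2 → u j < u i :=
  strictAntiOn_of_succ_lt fun j hj => (h.lt _ hj).trans (h.lt_succ j (by omega))

theorem SturmSequence.zeros_of_anti (hD : SturmSequence c D M) {k : ℕ} {v : ℕ → ℝ}
    (hv : ∀ j < (k + 1) / 2, v j < c ∧ D k (v j) = 0)
    (anti : ∀ i j, i < j → j < (k + 1) / 2 → v j < v i) :
    ∀ x < c, (D k x = 0 → ∃ j < (k + 1) / 2, v j = x) ∧ M k x ≠ 0 := by
  intro x hx
  have := hD.count k ((Finset.range ((k + 1) / 2)).image v) (by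
    intro y hy
    obtain ⟨j, hj, rfl⟩ := Finset.mem_image.1 hy
    exact hv j (Finset.mem_range.1 hj)) (by
    rw [Finset.card_image_of_injOn, Finset.card_range]
    intro i hi j hj hij
    simp only [Finset.coe_range, mem_Iio] at hi hj
    rcases lt_trichotomy i j with h | h | h
    · exact absurd hij (anti i j h hj).ne'
    · exact h
    · exact absurd hij (anti j i h hi).ne) x hx
  refine ⟨fun h => ?_, this.2⟩
  obtain ⟨j, hj, e⟩ := Finset.mem_image.1 (this.1 h)
  exact ⟨j, Finset.mem_range.1 hj, e⟩

/-- At a zero of `D (k + 1)` condensation forces `D (k + 2)` and `D k` to have opposite signs,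
strictly because `count` excludes zeros of `M (k + 1)`. -/
theorem InterlacingZeros.sign_next (hD : SturmSequence c D M) (h : InterlacingZeros c D k u v) :
    ∀ j < (k + 2) / 2, 0 < (-1) ^ (j + 1) * D (k + 2) (v j) := by
  intro j hj
  obtain ⟨hjc, hj0⟩ := h.right j hj
  have h1 := h.sign_right j hj
  have hne : D k (v j) ≠ 0 := by intro e; simp [e] at h1
  have h2 := hD.condensation k _ hjc hne hj0
  have h3 := (hD.zeros_of_anti h.right h.anti_right _ hjc).2
  have h4 : 0 < M (k + 1) (v j) ^ 2 := by positivity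
  have h5 : ((-1 : ℝ) ^ j) ^ 2 = 1 := by rw [← pow_mul, mul_comm, pow_mul]; simp
  have h6 : ((-1) ^ (j + 1) * D (k + 2) (v j)) * ((-1) ^ j * D k (v j)) = M (k + 1) (v j) ^ 2 := by
    rw [pow_succ]
    linear_combination (-((-1 : ℝ) ^ j) ^ 2) * h2 + M (k + 1) (v j) ^ 2 * h5
  exact pos_of_mul_pos_left (h6 ▸ h4) h1.le

/-- The signs of `D (k + 2)` alternate along the `v j`, giving a zero in each gap; positivity near
`c` gives one more on the right, and for odd `k` the sign at `-∞` gives one on the left. -/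
theorem InterlacingZeros.exists_zero (hD : SturmSequence c D M) (h : InterlacingZeros c D k u v)
    (j : ℕ) (hj : j < (k + 3) / 2) : ∃ x, x < c ∧ D (k + 2) x = 0 ∧
      (j < (k + 2) / 2 → v j < x) ∧ (∀ i, j = i + 1 → x < v i) ∧ 0 < (-1) ^ j * D (k + 1) x := by
  have hs := h.sign_next hD
  have hz := hD.zeros_of_anti h.right h.anti_right
  rcases j with _ | i
  · have hv := (h.right 0 (by omega)).1
    obtain ⟨y, hy0, hy1⟩ := ((hD.pos (k + 2)).and (Ioo_mem_nhdsLT hv)).exists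
    obtain ⟨x, hx1, hx2, hx0⟩ := exists_zero_of_sign_change (f := D (k + 2)) (s := -1) hy1.1
      ((hD.continuousOn _).mono fun t ht => ht.2.trans_lt hy1.2)
      (by simpa using hs 0 (by omega)) (by simpa using hy0)
    have hxc := hx2.trans hy1.2
    refine ⟨x, hxc, hx0, fun _ => hx1, fun i hi => by omega, ?_⟩
    obtain ⟨t, ht0, ht1⟩ := ((hD.pos (k + 1)).and (Ioo_mem_nhdsLT hxc)).exists
    rw [pow_zero]
    refine sign_eq_of_no_zero (S := Ioo (v 0) c) ordConnected_Ioo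
      ((hD.continuousOn _).mono fun t ht => ht.2) ?_ ⟨hx1, hxc⟩ ⟨hx1.trans ht1.1, ht1.2⟩
      (by simpa using ht0)
    intro t ht e
    obtain ⟨l, hl, rfl⟩ := (hz t ht.2).1 e
    rcases Nat.eq_zero_or_pos l with rfl | hl0
    · exact lt_irrefl _ ht.1
    · exact lt_asymm ht.1 (h.anti_right 0 l hl0 hl)
  · have hi : i < (k + 2) / 2 := by omega
    have hic := (h.right i hi).1
    -- The left end `L` is the next zero `v (i + 1)` if there is one. Otherwise `k + 2 = 2 * (i + 1)
    -- + 1` is odd and `L` is far to the left.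
    obtain ⟨L, hL1, hL2, hL3⟩ : ∃ L, L < v i ∧ (i + 1 < (k + 2) / 2 → v (i + 1) ≤ L) ∧
        0 < (-1) ^ (i + 2) * D (k + 2) L := by
      by_cases hi' : i + 1 < (k + 2) / 2
      · exact ⟨v (i + 1), h.anti_right _ _ i.lt_succ_self hi', fun _ => le_rfl, hs _ hi'⟩
      · obtain ⟨L, hL, hL'⟩ := ((hD.sign_atBot (i + 1)).and (eventually_lt_atBot (v i))).exists
        refine ⟨L, hL', fun h => absurd h hi', ?_⟩
        rwa [show 2 * (i + 1) + 1 = k + 2 by omega] at hL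
    obtain ⟨x, hx1, hx2, hx0⟩ := exists_zero_of_sign_change (f := D (k + 2)) hL1
      ((hD.continuousOn _).mono fun t ht => ht.2.trans_lt hic) hL3
      (by have := hs i hi; rwa [pow_succ _ (i + 1), mul_neg_one, neg_neg])
    refine ⟨x, hx2.trans hic, hx0, fun hi' => (hL2 hi').trans_lt hx1,
      fun l hl => by rwa [show l = i by omega], ?_⟩
    -- The new zero and `u i` lie in the same gap between zeros of `D (k + 1)`, so the sign is
    -- inherited from `sign_left`.
    refine sign_eq_of_no_zero (S := {t | t < v i ∧ (i + 1 < (k + 2) / 2 → v (i + 1) < t)})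
      ⟨fun a ha b hb t ht => ⟨ht.2.trans_lt hb.1, fun hi' => (ha.2 hi').trans_le ht.1⟩⟩
      ((hD.continuousOn _).mono fun t ht => ht.1.trans hic) ?_
      ⟨hx2, fun hi' => (hL2 hi').trans_lt hx1⟩ ⟨h.lt i (by omega), h.lt_succ i⟩
      (h.sign_left i (by omega))
    intro t ht e
    obtain ⟨l, hl, rfl⟩ := (hz t (ht.1.trans hic)).1 e
    rcases lt_trichotomy l (i + 1) with hl' | rfl | hl'
    · rcases Nat.lt_succ_iff_lt_or_eq.1 hl' with hl' | rfl
      · exact lt_asymm ht.1 (h.anti_right _ _ hl' hi)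
      · exact lt_irrefl _ ht.1
    · exact lt_irrefl _ (ht.2 hl)
    · exact lt_asymm (ht.2 (by omega)) (h.anti_right _ _ hl' hl)

theorem InterlacingZeros.exists_next (hD : SturmSequence c D M) (h : InterlacingZeros c D k u v) :
    ∃ w, InterlacingZeros c D (k + 1) v w := by
  choose! w hw using h.exists_zero hD
  exact ⟨w, fun j hj => (h.right j hj).2, fun j hj => ⟨(hw j hj).1, (hw j hj).2.1⟩,
    fun j hj => (hw j (by omega)).2.2.1 hj, fun j hj => (hw (j + 1) hj).2.2.2.1 j rfl,
    h.sign_next hD, fun j hj => (hw j hj).2.2.2.2⟩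

theorem SturmSequence.exists_interlacingZeros (hD : SturmSequence c D M) (h0 : ∀ x, D 0 x = 1)
    {b : ℝ} (hb : b < c) (h1 : D 1 b = 0) (k : ℕ) : ∃ u v, InterlacingZeros c D k u v := by
  induction k with
  | zero =>
    refine ⟨fun _ => 0, fun _ => b, by simp, fun _ _ => ⟨hb, h1⟩, by simp, by simp, by simp, ?_⟩
    intro j hj
    obtain rfl : j = 0 := by omega
    simp [h0]
  | succ k ih =>
    obtain ⟨u, v, h⟩ := ih
    exact ⟨v, h.exists_next hD⟩

end Sturm

/-! ### Continuity, and signs as `ζ` tends to `-2` from the left. -/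

section Analysis

open Set Filter Topology

theorem tendsto_det {ι α : Type*} [Fintype ι] [DecidableEq ι] {l : Filter α}
    {W : α → Matrix ι ι ℝ} {L : Matrix ι ι ℝ}
    (h : ∀ i j, Tendsto (fun x => W x i j) l (𝓝 (L i j))) :
    Tendsto (fun x => (W x).det) l (𝓝 L.det) :=
  (Continuous.matrix_det continuous_id).continuousAt.tendsto.comp
    (tendsto_pi_nhds.2 fun i => tendsto_pi_nhds.2 fun j => h i j)

theorem continuous_eCoeff (n : ℕ) : Continuous fun a : ℝ => eCoeff a n := by
  simp only [← eval_eCoeff]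
  exact Polynomial.continuous _

theorem continuous_eCoeff' (n : ℕ) : Continuous fun a : ℝ => eCoeff' a n := by
  simp only [← eval_eCoeff']
  exact Polynomial.continuous _

theorem continuousOn_aPar : ContinuousOn aPar {0}ᶜ := by
  unfold aPar
  exact ContinuousOn.div (by fun_prop) (by fun_prop) fun x hx => hx

theorem continuousOn_βPar : ContinuousOn βPar {0}ᶜ := by
  unfold βPar
  exact ContinuousOn.div (by fun_prop) (by fun_prop) fun x hx => hx

theorem continuousOn_momA (n : ℕ) : ContinuousOn (fun ζ => momA ζ n) {0}ᶜ := by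
  unfold momA
  exact (continuousOn_βPar.mul ((continuous_eCoeff n).comp_continuousOn continuousOn_aPar)).add
    (((by fun_prop : ContinuousOn (fun ζ : ℝ => -(ζ + 3)) {0}ᶜ).mul continuousOn_aPar).mul
      ((continuous_eCoeff' n).comp_continuousOn continuousOn_aPar))

theorem continuousOn_momB (n : ℕ) : ContinuousOn (fun ζ => momB ζ n) {0}ᶜ := by
  unfold momB
  exact ((by fun_prop : ContinuousOn (fun ζ : ℝ => -(ζ + 3)) {0}ᶜ).mul
    ((continuous_eCoeff n).comp_continuousOn continuousOn_aPar)).add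
    (continuousOn_βPar.mul ((continuous_eCoeff' n).comp_continuousOn continuousOn_aPar))

theorem aPar_neg {ζ : ℝ} (h : ζ < -2) : aPar ζ < 0 :=
  div_neg_of_pos_of_neg (mul_pos_of_neg_of_neg (by linarith) (by linarith)) (by linarith)

theorem Iio_subset_compl_zero : Iio (-2 : ℝ) ⊆ {0}ᶜ := by
  rintro x hx rfl
  exact absurd hx (by norm_num)

theorem continuousOn_moment (m : ℤ) : ContinuousOn (fun ζ => moment ζ m) (Iio (-2)) := by
  rcases m with n | n
  · exact ((continuousOn_aPar.mono Iio_subset_compl_zero).pow _ |>.inv₀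
      fun x hx => pow_ne_zero _ (aPar_neg hx).ne).mul
      ((continuousOn_momA n).mono Iio_subset_compl_zero)
  · exact ((continuousOn_momB n).mono Iio_subset_compl_zero).neg

theorem continuousOn_hankelDet (n : ℕ) (m : ℤ) :
    ContinuousOn (fun ζ => hankelDet (moment ζ) n m) (Iio (-2)) := fun x hx =>
  tendsto_det fun _ _ => continuousOn_moment _ x hx

/-- The index equivalence separating negative from nonnegative exponents. -/
def splitEquiv (p q : ℕ) : Fin p ⊕ Fin q ≃ Fin (p + q) :=
  (Equiv.sumCongr Fin.revPerm (Equiv.refl _)).trans finSumFinEquiv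

theorem cast_splitEquiv_inl {p q : ℕ} (i : Fin p) :
    ((splitEquiv p q (Sum.inl i) : ℕ) : ℤ) = p - 1 - i := by
  simp only [splitEquiv, Equiv.trans_apply, Equiv.sumCongr_apply, Sum.map_inl,
    finSumFinEquiv_apply_left, Fin.val_castAdd, Fin.revPerm_apply, cast_rev]

theorem cast_splitEquiv_inr {p q : ℕ} (i : Fin q) :
    ((splitEquiv p q (Sum.inr i) : ℕ) : ℤ) = p + i := by
  simp [splitEquiv]

theorem tendsto_nhdsLT_of_continuousOn {f : ℝ → ℝ} (hf : ContinuousOn f {0}ᶜ) :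
    Tendsto f (𝓝[<] (-2)) (𝓝 (f (-2))) :=
  (hf.continuousAt (isOpen_compl_singleton.mem_nhds (by norm_num))).tendsto.mono_left
    nhdsWithin_le_nhds

theorem aPar_neg_two : aPar (-2) = 0 := by norm_num [aPar]

theorem βPar_neg_two : βPar (-2) = 0 := by norm_num [βPar]

theorem eventually_aPar_ne_zero : ∀ᶠ ζ in 𝓝[<] (-2 : ℝ), aPar ζ ≠ 0 := by
  filter_upwards [self_mem_nhdsWithin] with ζ hζ using (aPar_neg hζ).ne

theorem tendsto_moment_neg (n : ℕ) : Tendsto (fun ζ => moment ζ (-1 - n)) (𝓝[<] (-2))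
    (𝓝 (raney₂ n)) := by
  have h := (tendsto_nhdsLT_of_continuousOn (continuousOn_momB n)).neg
  have e : -momB (-2) n = raney₂ n := by
    rw [momB, aPar_neg_two, βPar_neg_two, eCoeff_at_zero]; ring
  rw [e] at h
  rw [show (-1 - n : ℤ) = Int.negSucc n by rw [Int.negSucc_eq]; ring]
  exact h

/-- Nonnegative moments may blow up since `aPar` tends to `0`, but the scaling leaves the factor
`momA`, which vanishes at `-2`. Negative moments stay bounded. -/
theorem tendsto_mul_moment (i j : ℕ) :
    Tendsto (fun ζ => aPar ζ ^ (3 * j + 2) * moment ζ (j - i)) (𝓝[<] (-2)) (𝓝 0) := by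
  have ha := tendsto_nhdsLT_of_continuousOn continuousOn_aPar
  rw [aPar_neg_two] at ha
  rcases le_or_gt i j with h | h
  · obtain ⟨n, rfl⟩ := Nat.exists_eq_add_of_le h
    have hA := tendsto_nhdsLT_of_continuousOn (continuousOn_momA n)
    rw [show momA (-2) n = 0 by rw [momA, aPar_neg_two, βPar_neg_two]; ring] at hA
    have := (ha.pow (3 * i)).mul hA
    rw [mul_zero] at this
    refine this.congr' ?_
    filter_upwards [eventually_aPar_ne_zero] with ζ hζ
    rw [show (((i + n : ℕ) : ℤ) - i) = Int.ofNat n by push_cast; simp, moment]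
    rw [show 3 * (i + n) + 2 = 3 * i + (3 * n + 2) by ring, pow_add]
    field_simp
  · obtain ⟨n, rfl⟩ := Nat.exists_eq_add_of_lt h
    have := (ha.pow (3 * j + 2)).mul (tendsto_moment_neg n)
    rw [zero_pow (by omega), zero_mul] at this
    rwa [show ((j : ℤ) - (j + n + 1 : ℕ)) = -1 - n by push_cast; ring]

/-- The ratio `βPar / aPar` tends to `5/3` and `-(ζ+3)` to `-1`; then `5/3 e - e' = 2/3 e + (e -
e')` expresses the limit in Raney numbers. -/
theorem tendsto_mul_mul_moment (i j : ℕ) :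
    Tendsto (fun ζ => aPar ζ ^ (3 * i + 2) * aPar ζ ^ (3 * j + 2) * moment ζ (1 + i + j))
      (𝓝[<] (-2)) (𝓝 (2 / 3 * raney₂ (i + j + 1) + raney₁ (i + j + 1))) := by
  have h1 : Tendsto (fun ζ : ℝ => (3 * ζ + 1) / (2 * ζ + 1)) (𝓝[<] (-2)) (𝓝 (5 / 3)) := by
    have : ContinuousAt (fun ζ : ℝ => (3 * ζ + 1) / (2 * ζ + 1)) (-2) :=
      ContinuousAt.div (by fun_prop) (by fun_prop) (by norm_num)
    have := this.tendsto.mono_left (nhdsWithin_le_nhds (s := Iio (-2)))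
    norm_num at this ⊢
    exact this
  have h2 : Tendsto (fun ζ : ℝ => -(ζ + 3)) (𝓝[<] (-2)) (𝓝 (-1)) := by
    have := tendsto_nhdsLT_of_continuousOn
      (by fun_prop : ContinuousOn (fun ζ : ℝ => -(ζ + 3)) {0}ᶜ)
    norm_num at this ⊢
    exact this
  have h3 := tendsto_nhdsLT_of_continuousOn
    ((continuous_eCoeff (i + j + 1)).comp_continuousOn continuousOn_aPar)
  have h4 := tendsto_nhdsLT_of_continuousOn
    ((continuous_eCoeff' (i + j + 1)).comp_continuousOn continuousOn_aPar)
  simp only [Function.comp_apply, aPar_neg_two] at h3 h4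
  have h := (h1.mul h3).add (h2.mul h4)
  have e : 5 / 3 * eCoeff 0 (i + j + 1) + -1 * eCoeff' 0 (i + j + 1) =
      2 / 3 * raney₂ (i + j + 1) + raney₁ (i + j + 1) := by
    rw [← eCoeff_sub_at_zero, ← eCoeff_at_zero, Pi.sub_apply]; ring
  rw [e] at h
  refine h.congr' ?_
  filter_upwards [self_mem_nhdsWithin] with ζ (hζ : ζ < -2)
  have ha := (aPar_neg hζ).ne
  have hb : βPar ζ = aPar ζ * ((3 * ζ + 1) / (2 * ζ + 1)) := by
    have h0 : ζ ≠ 0 := by linarith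
    have h1 : 2 * ζ + 1 ≠ 0 := by linarith
    rw [βPar, aPar, div_mul_div_comm, div_eq_div_iff h0 (mul_ne_zero h0 h1)]; ring
  rw [show (1 + (i : ℤ) + j) = Int.ofNat (i + j + 1) by simp; ring, moment, momA, hb,
    show aPar ζ ^ (3 * (i + j + 1) + 2) =
      aPar ζ ^ (3 * i + 2) * aPar ζ ^ (3 * j + 2) * aPar ζ by ring,
    Function.comp_apply, Function.comp_apply]
  generalize (3 * ζ + 1) / (2 * ζ + 1) = r
  have hx : aPar ζ ^ (3 * i + 2) ≠ 0 := pow_ne_zero _ ha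
  have hy : aPar ζ ^ (3 * j + 2) ≠ 0 := pow_ne_zero _ ha
  generalize aPar ζ ^ (3 * i + 2) = x at hx ⊢
  generalize aPar ζ ^ (3 * j + 2) = y at hy ⊢
  field_simp

/-- Splitting the indices into `p` that carry negative moments and `q` that carry positive ones, and
scaling the latter by powers of `aPar`, gives a block diagonal limit with positive definite blocks.
The scaling enters the determinant as a square. -/
theorem eventually_hankelDet_pos (p q : ℕ) :
    ∀ᶠ ζ in 𝓝[<] (-2 : ℝ), 0 < hankelDet (moment ζ) (p + q) (1 - 2 * p) := by
  set s : ℝ → Fin p ⊕ Fin q → ℝ := fun ζ =>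
    Sum.elim (fun _ => 1) fun j => aPar ζ ^ (3 * (j : ℕ) + 2) with hs
  set W : ℝ → Matrix (Fin p ⊕ Fin q) (Fin p ⊕ Fin q) ℝ := fun ζ => Matrix.of fun x y =>
    s ζ x * (Matrix.of fun x y => s ζ y * (Matrix.of fun x y =>
      moment ζ (1 - 2 * p + (splitEquiv p q x : ℕ) + (splitEquiv p q y : ℕ))) x y) x y with hW
  set L : Matrix (Fin p ⊕ Fin q) (Fin p ⊕ Fin q) ℝ := Matrix.fromBlocks
    (Matrix.of fun i j => raney₂ (i + j)) 0 0
    (Matrix.of fun i j => 2 / 3 * raney₂ (i + j + 1) + raney₁ (i + j + 1)) with hL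
  have hdet : ∀ ζ, (W ζ).det = (∏ x, s ζ x) ^ 2 * hankelDet (moment ζ) (p + q) (1 - 2 * p) := by
    intro ζ
    rw [hankelDet_eq_submatrix _ _ _ (splitEquiv p q), hW, Matrix.det_mul_column,
      Matrix.det_mul_row]
    ring
  have hLpos : 0 < L.det := by
    rw [hL, Matrix.det_fromBlocks_zero₂₁]
    refine mul_pos (hankel_raney₂_posDef p).det_pos ?_
    exact (((hankel_raney₂_succ_posDef q).smul (by norm_num : (0 : ℝ) < 2 / 3)).add
      (hankel_raney₁_succ_posDef q)).det_pos
  have hlim : Tendsto (fun ζ => (W ζ).det) (𝓝[<] (-2)) (𝓝 L.det) := by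
    refine tendsto_det ?_
    rintro (i | i) (j | j)
    · simp only [hW, hs, hL, Matrix.of_apply, Sum.elim_inl, one_mul, cast_splitEquiv_inl,
        Matrix.fromBlocks_apply₁₁]
      convert! tendsto_moment_neg (i + j) using 3
      push_cast; ring
    · simp only [hW, hs, hL, Matrix.of_apply, Sum.elim_inl, Sum.elim_inr, one_mul,
        cast_splitEquiv_inl, cast_splitEquiv_inr, Matrix.fromBlocks_apply₁₂, Matrix.zero_apply]
      convert! tendsto_mul_moment i j using 4
      ring
    · simp only [hW, hs, hL, Matrix.of_apply, Sum.elim_inl, Sum.elim_inr, one_mul,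
        cast_splitEquiv_inl, cast_splitEquiv_inr, Matrix.fromBlocks_apply₂₁, Matrix.zero_apply]
      convert! tendsto_mul_moment j i using 4
      ring
    · simp only [hW, hs, hL, Matrix.of_apply, Sum.elim_inr, ← mul_assoc,
        cast_splitEquiv_inr, Matrix.fromBlocks_apply₂₂]
      convert! tendsto_mul_mul_moment i j using 4
      ring
  filter_upwards [hlim.eventually_const_lt hLpos] with ζ hζ
  rw [hdet] at hζ
  exact pos_of_mul_pos_right hζ (sq_nonneg _)

end Analysis

/-! ### Signs as `ζ` tends to `-∞`. -/

section AtBot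

open Set Filter Topology

/-- The exchange matrix. -/
def exchange (n : ℕ) : Matrix (Fin n) (Fin n) ℝ :=
  Matrix.of fun i j => if (i : ℕ) + j + 1 = n then 1 else 0

theorem det_exchange_succ (n : ℕ) : (exchange (n + 1)).det = (-1) ^ n * (exchange n).det := by
  rw [Matrix.det_succ_row_zero, Finset.sum_eq_single (Fin.last n)]
  · have : (exchange (n + 1)).submatrix Fin.succ (Fin.last n).succAbove = exchange n := by
      ext i j
      simp only [exchange, Matrix.submatrix_apply, Matrix.of_apply, Fin.succAbove_last,
        Fin.val_succ, Fin.val_castSucc]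
      congr 1
      simp only [eq_iff_iff]; omega
    rw [this]
    simp [exchange]
  · intro j _ hj
    have : (j : ℕ) ≠ n := fun h => hj (Fin.ext h)
    simp [exchange, this]
  · simp

theorem det_exchange_odd (m : ℕ) : (exchange (2 * m + 1)).det = (-1) ^ m := by
  induction m with
  | zero => simp [exchange]
  | succ m ih =>
    rw [show 2 * (m + 1) + 1 = 2 * m + 1 + 1 + 1 by ring, det_exchange_succ, det_exchange_succ, ih,
      ← pow_add, ← pow_add, show 2 * m + 1 + 1 + (2 * m + 1 + m) = 2 * (2 * m + 1) + (m + 1) by ring,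
      pow_add, pow_mul]
    simp

theorem tendsto_aPar_atBot : Tendsto aPar atBot atBot := by
  have h1 : Tendsto (fun ζ : ℝ => 2 * ζ + 5) atBot atBot :=
    tendsto_atBot_add_const_right _ _ (tendsto_id.const_mul_atBot two_pos)
  refine tendsto_atBot_mono' _ ?_ h1
  filter_upwards [eventually_lt_atBot (-2 : ℝ)] with ζ hζ
  have : aPar ζ = 2 * ζ + 5 + 2 / ζ := by
    have : ζ ≠ 0 := by linarith
    rw [aPar]; field_simp; ring
  rw [this]
  have : 2 / ζ ≤ 0 := div_nonpos_of_nonneg_of_nonpos (by norm_num) (by linarith)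
  linarith

/-- The square root of `-aPar ζ`. -/
noncomputable def bPar (ζ : ℝ) : ℝ := √(-aPar ζ)

theorem tendsto_bPar : Tendsto bPar atBot atTop :=
  Real.tendsto_sqrt_atTop.comp (tendsto_neg_atBot_atTop.comp tendsto_aPar_atBot)

theorem neg_bPar_sq {ζ : ℝ} (h : ζ < -2) : -bPar ζ ^ 2 = aPar ζ := by
  rw [bPar, Real.sq_sqrt (by have := aPar_neg h; linarith)]; ring

theorem bPar_pos {ζ : ℝ} (h : ζ < -2) : 0 < bPar ζ :=
  Real.sqrt_pos.2 (by have := aPar_neg h; linarith)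

theorem tendsto_eval_div_pow (P : Polynomial ℝ) {d : ℕ} (h : 2 * P.natDegree < d) :
    Tendsto (fun ζ => P.eval (aPar ζ) / bPar ζ ^ d) atBot (𝓝 0) := by
  have hd : (P.comp (-Polynomial.X ^ 2)).degree < (Polynomial.X ^ d : Polynomial ℝ).degree := by
    rw [Polynomial.degree_X_pow]
    refine Polynomial.degree_le_natDegree.trans_lt ?_
    rw [Polynomial.natDegree_comp, Polynomial.natDegree_neg, Polynomial.natDegree_X_pow]
    exact_mod_cast (by omega : P.natDegree * 2 < d)
  have := (Polynomial.div_tendsto_atTop_zero_of_degree_lt _ _ hd).comp tendsto_bPar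
  refine this.congr' ?_
  filter_upwards [eventually_lt_atBot (-2 : ℝ)] with ζ hζ
  simp [Polynomial.eval_comp, neg_bPar_sq hζ]

theorem tendsto_eCoeff_div_pow {n d : ℕ} (h : 2 * (n - 1) < d) :
    Tendsto (fun ζ => eCoeff (aPar ζ) n / bPar ζ ^ d) atBot (𝓝 0) := by
  have := tendsto_eval_div_pow (eCoeff Polynomial.X n) (d := d)
    (by have := natDegree_eCoeff_le n; omega)
  simpa only [eval_eCoeff] using this

theorem tendsto_eCoeff'_div_pow {n d : ℕ} (h : 2 * (n - 1) < d) :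
    Tendsto (fun ζ => eCoeff' (aPar ζ) n / bPar ζ ^ d) atBot (𝓝 0) := by
  have := tendsto_eval_div_pow (eCoeff' Polynomial.X n) (d := d)
    (by have := natDegree_eCoeff'_le n; omega)
  simpa only [eval_eCoeff'] using this

theorem tendsto_aPar_mul_eCoeff'_div_pow {n d : ℕ} (h : 2 * n < d) :
    Tendsto (fun ζ => aPar ζ * eCoeff' (aPar ζ) n / bPar ζ ^ d) atBot (𝓝 0) := by
  rcases n with _ | n
  · simp [eCoeff'_zero]
  have := tendsto_eval_div_pow (Polynomial.X * eCoeff' Polynomial.X (n + 1)) (d := d) (by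
    have h1 := natDegree_eCoeff'_le (n + 1)
    have h2 := Polynomial.natDegree_mul_le (p := (Polynomial.X : Polynomial ℝ))
      (q := eCoeff' Polynomial.X (n + 1))
    rw [Polynomial.natDegree_X] at h2
    omega)
  simpa only [Polynomial.eval_mul, Polynomial.eval_X, eval_eCoeff'] using this

theorem tendsto_βPar_div : Tendsto (fun ζ => βPar ζ / (ζ + 3)) atBot (𝓝 3) := by
  have h1 : Tendsto (fun ζ : ℝ => ζ⁻¹) atBot (𝓝 0) := tendsto_inv_atBot_zero
  have h2 : Tendsto (fun ζ : ℝ => (1 + 2 * ζ⁻¹) * (3 + ζ⁻¹) / (1 + 3 * ζ⁻¹)) atBot (𝓝 3) := by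
    have := (((h1.const_mul 2).const_add 1).mul (h1.const_add 3)).div
      ((h1.const_mul 3).const_add 1) (by norm_num)
    rw [mul_zero, mul_zero, add_zero, add_zero, one_mul, div_one] at this
    exact this
  refine h2.congr' ?_
  filter_upwards [eventually_lt_atBot (-3 : ℝ)] with ζ hζ
  have : ζ ≠ 0 := by linarith
  have : ζ + 3 ≠ 0 := by linarith
  have : 1 + 3 * ζ⁻¹ ≠ 0 := by
    rw [show 1 + 3 * ζ⁻¹ = (ζ + 3) / ζ by field_simp]; positivity
  rw [βPar]
  rw [div_eq_div_iff (by assumption) (by assumption)]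
  field_simp

/-- The moments, rescaled so that they stay bounded at `-∞`. -/
noncomputable def scaledMoment (ζ : ℝ) (r : ℤ) : ℝ :=
  (bPar ζ ^ 3) ^ r * moment ζ (r - 1) / (ζ + 3)

/-- The central moment is `moment ζ (-1) = ζ + 3`. For the others the degree bound on the
coefficients, doubled in passing from `aPar` to `bPar`, is beaten by the power of `bPar`. -/
theorem tendsto_scaledMoment (r : ℤ) :
    Tendsto (fun ζ => scaledMoment ζ r) atBot (𝓝 (if r = 0 then 1 else 0)) := by
  rcases lt_or_ge 0 r with hr | hr
  · obtain ⟨n, rfl⟩ : ∃ n : ℕ, r = n + 1 := ⟨(r - 1).toNat, by omega⟩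
    rw [if_neg hr.ne']
    have h := ((tendsto_βPar_div.mul (tendsto_eCoeff_div_pow (n := n) (d := 3 * n + 1)
      (by omega))).sub (tendsto_aPar_mul_eCoeff'_div_pow (n := n) (d := 3 * n + 1)
      (by omega))).const_mul ((-1) ^ (3 * n + 2))
    simp only [mul_zero, sub_zero] at h
    refine h.congr' ?_
    filter_upwards [eventually_lt_atBot (-3 : ℝ)] with ζ hζ
    have hb := (bPar_pos (show ζ < -2 by linarith)).ne'
    have h3 : ζ + 3 ≠ 0 := by linarith
    have hs : (((-1) ^ (3 * n + 2) : ℝ))⁻¹ = (-1) ^ (3 * n + 2) := by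
      rw [← inv_pow, inv_neg, inv_one]
    have ha : aPar ζ ^ (3 * n + 2) = (-1) ^ (3 * n + 2) * (bPar ζ ^ (3 * n + 1) *
        bPar ζ ^ (3 * n + 3)) := by
      rw [← neg_bPar_sq (show ζ < -2 by linarith), neg_pow]; ring
    have hz : (bPar ζ ^ 3) ^ ((n : ℤ) + 1) = bPar ζ ^ (3 * n + 3) := by
      rw [← Nat.cast_succ, zpow_natCast, ← pow_mul]; rfl
    rw [scaledMoment, show (n + 1 - 1 : ℤ) = Int.ofNat n by simp, moment, momA, ha, hz, mul_inv, hs]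
    have hx : bPar ζ ^ (3 * n + 1) ≠ 0 := pow_ne_zero _ hb
    have hy : bPar ζ ^ (3 * n + 3) ≠ 0 := pow_ne_zero _ hb
    generalize bPar ζ ^ (3 * n + 1) = x at hx ⊢
    generalize bPar ζ ^ (3 * n + 3) = y at hy ⊢
    field_simp
    ring
  · obtain ⟨n, rfl⟩ : ∃ n : ℕ, r = -n := ⟨(-r).toNat, by omega⟩
    have key : ∀ᶠ ζ in atBot, eCoeff (aPar ζ) n / bPar ζ ^ (3 * n) -
        βPar ζ / (ζ + 3) * (eCoeff' (aPar ζ) n / bPar ζ ^ (3 * n)) = scaledMoment ζ (-n) := by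
      filter_upwards [eventually_lt_atBot (-3 : ℝ)] with ζ hζ
      have hb := (bPar_pos (show ζ < -2 by linarith)).ne'
      have h3 : ζ + 3 ≠ 0 := by linarith
      have hx : bPar ζ ^ (3 * n) ≠ 0 := pow_ne_zero _ hb
      rw [scaledMoment, show (-n - 1 : ℤ) = Int.negSucc n by rw [Int.negSucc_eq]; ring, moment,
        momB, zpow_neg, zpow_natCast, ← pow_mul]
      generalize bPar ζ ^ (3 * n) = x at hx ⊢
      field_simp
      ring
    rcases n with _ | n
    · refine Tendsto.congr' key ?_
      simp [eCoeff_zero, eCoeff'_zero]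
    · rw [if_neg (by omega)]
      have := (tendsto_eCoeff_div_pow (n := n + 1) (d := 3 * (n + 1)) (by omega)).sub
        (tendsto_βPar_div.mul (tendsto_eCoeff'_div_pow (n := n + 1) (d := 3 * (n + 1)) (by omega)))
      simp only [mul_zero, sub_zero] at this
      exact this.congr' key

/-- The rescaled matrix tends to the exchange matrix, whose determinant is `(-1)^m`; the odd power
of the negative factor `ζ + 3` contributes one further sign. -/
theorem eventually_sign_hankelDet (m : ℕ) : ∀ᶠ ζ in atBot,
    0 < (-1) ^ (m + 1) * hankelDet (moment ζ) (2 * m + 1) (1 - 2 * (m + 1)) := by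
  set W : ℝ → Matrix (Fin (2 * m + 1)) (Fin (2 * m + 1)) ℝ := fun ζ => Matrix.of fun i j =>
    scaledMoment ζ (i + j - 2 * m) with hW
  have hlim : Tendsto (fun ζ => (W ζ).det) atBot (𝓝 (exchange (2 * m + 1)).det) := by
    refine tendsto_det fun i j => ?_
    have := tendsto_scaledMoment ((i : ℤ) + j - 2 * m)
    simp only [hW, Matrix.of_apply, exchange]
    convert! this using 2
    congr 1
    simp only [eq_iff_iff]; omega
  rw [det_exchange_odd] at hlim
  have hpos : ∀ᶠ ζ in atBot, 0 < (-1) ^ m * (W ζ).det := by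
    have := hlim.const_mul ((-1) ^ m)
    rw [← pow_add, ← two_mul, pow_mul, neg_one_sq, one_pow] at this
    exact this.eventually_const_lt one_pos
  filter_upwards [hpos, eventually_lt_atBot (-3 : ℝ)] with ζ h1 hζ
  have hb := bPar_pos (show ζ < -2 by linarith)
  have h3 : ζ + 3 < 0 := by linarith
  set t := ((bPar ζ ^ 3) ^ (2 * m))⁻¹ * (ζ + 3)⁻¹ with ht
  have hdet : (W ζ).det = (∏ i : Fin (2 * m + 1), (bPar ζ ^ 3) ^ (i : ℕ)) *
      ((∏ j : Fin (2 * m + 1), (bPar ζ ^ 3) ^ (j : ℕ)) *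
        (t ^ (2 * m + 1) * hankelDet (moment ζ) (2 * m + 1) (1 - 2 * (m + 1)))) := by
    have := Matrix.det_smul (Matrix.of fun i j : Fin (2 * m + 1) =>
      moment ζ (1 - 2 * (m + 1) + i + j)) t
    rw [Fintype.card_fin] at this
    rw [hankelDet, ← this, ← Matrix.det_mul_row, ← Matrix.det_mul_column]
    congr 1
    ext i j
    simp only [hW, Matrix.of_apply, Matrix.smul_apply, smul_eq_mul, scaledMoment]
    rw [show (i : ℤ) + j - 2 * m - 1 = 1 - 2 * (m + 1) + i + j by ring,
      show (i : ℤ) + j - 2 * m = ((i : ℕ) : ℤ) + ((j : ℕ) : ℤ) + -((2 * m : ℕ) : ℤ) by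
        push_cast; ring,
      zpow_add₀ (by positivity), zpow_add₀ (by positivity), zpow_neg, zpow_natCast, zpow_natCast,
      zpow_natCast, ht]
    field_simp
  have hx : 0 < ∏ i : Fin (2 * m + 1), (bPar ζ ^ 3) ^ (i : ℕ) :=
    Finset.prod_pos fun _ _ => by positivity
  have hz : t ^ (2 * m + 1) < 0 := (odd_two_mul_add_one m).pow_neg
    (mul_neg_of_pos_of_neg (by positivity) (inv_lt_zero.2 h3))
  rw [hdet, mul_left_comm, mul_left_comm _ (∏ i : Fin (2 * m + 1), (bPar ζ ^ 3) ^ (i : ℕ)),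
    mul_left_comm _ (t ^ _), mul_pos_iff_of_pos_left hx, mul_pos_iff_of_pos_left hx] at h1
  rw [pow_succ, mul_neg_one, neg_mul, neg_pos]
  exact neg_of_mul_pos_right h1 hz.le

end AtBot

/-! ### Application of the Sturm argument to the zeros of `p`. -/

section Zeros

open Set Filter Topology

/-- The identity for even `k` and inversion for odd `k`. -/
noncomputable def twist (k : ℕ) (x : ℝ) : ℝ := if Even k then x else x⁻¹

theorem twist_injective (k : ℕ) : Function.Injective (twist k) := by
  intro x y h
  unfold twist at h
  split_ifs at h
  · exact h
  · exact inv_injective h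

/-- The Hankel determinant vanishing at the zeroes of `pₖ`, twisted by `twist k`. -/
noncomputable def mainDet (k : ℕ) (ζ : ℝ) : ℝ :=
  hankelDet (moment ζ) k (1 - 2 * ((k + 1) / 2 : ℕ))

/-- The Hankel determinant vanishing at the zeroes of `pₖ`, twisted by `twist (k + 1)`. -/
noncomputable def sideDet (k : ℕ) (ζ : ℝ) : ℝ :=
  hankelDet (moment ζ) k (-2 * (k / 2 : ℕ))

variable {k : ℕ} {ζ : ℝ}

theorem mainDet_eq_zero_iff (hζ : ζ < -2) : mainDet k ζ = 0 ↔ (p k).IsRoot (twist k ζ) := by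
  have h0 : ζ ≠ 0 := by linarith
  have h1 : ζ + 1 ≠ 0 := by linarith
  have h2 : ζ + 2 ≠ 0 := by linarith
  have h3 : 2 * ζ + 1 ≠ 0 := by linarith
  unfold twist mainDet
  split_ifs with hk
  · rw [p_isRoot_iff_hankelDet k h0 h1 h2 h3]
    obtain ⟨m, rfl⟩ := hk
    rw [show (1 - 2 * ((m + m + 1) / 2 : ℕ) : ℤ) = 1 - (m + m : ℕ) by omega]
  · rw [p_isRoot_inv_iff_hankelDet k h0 h1 h2 h3]
    obtain ⟨m, rfl⟩ := Nat.not_even_iff_odd.1 hk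
    rw [show (1 - 2 * ((2 * m + 1 + 1) / 2 : ℕ) : ℤ) = -(2 * m + 1 : ℕ) by omega]

theorem sideDet_eq_zero_iff (hζ : ζ < -2) : sideDet k ζ = 0 ↔ (p k).IsRoot (twist (k + 1) ζ) := by
  have h0 : ζ ≠ 0 := by linarith
  have h1 : ζ + 1 ≠ 0 := by linarith
  have h2 : ζ + 2 ≠ 0 := by linarith
  have h3 : 2 * ζ + 1 ≠ 0 := by linarith
  unfold twist sideDet
  split_ifs with hk
  · rw [p_isRoot_iff_hankelDet k h0 h1 h2 h3]
    obtain ⟨m, rfl⟩ := Nat.not_even_iff_odd.1 fun h => Nat.even_add_one.1 hk h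
    rw [show (-2 * ((2 * m + 1) / 2 : ℕ) : ℤ) = 1 - (2 * m + 1 : ℕ) by omega]
  · rw [p_isRoot_inv_iff_hankelDet k h0 h1 h2 h3]
    obtain ⟨m, rfl⟩ : Even k := by rwa [Nat.even_add_one, not_not] at hk
    rw [show (-2 * ((m + m) / 2 : ℕ) : ℤ) = -(m + m : ℕ) by omega]

theorem p_ne_zero (h : RealZeroCountConjecture) (k : ℕ) : p k ≠ 0 := by
  intro h0
  -- For `k = 0` the count is zero and says nothing, but the empty determinant is `1`.
  rcases Nat.eq_zero_or_pos k with rfl | hk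
  · have := (mainDet_eq_zero_iff (k := 0) (ζ := -3) (by norm_num)).2 (by simp [h0])
    simp [mainDet, hankelDet] at this
  · have := h k
    rw [h0, Polynomial.roots_zero, Multiset.card_zero] at this
    omega

/-- Distinct zeros in the number allowed by the hypothesis exhaust the multiset of roots, so every
root is also simple. -/
theorem roots_eq_image (h : RealZeroCountConjecture) {s : Finset ℝ}
    (hs : ∀ x ∈ s, x < -2 ∧ mainDet k x = 0) (hcard : s.card = (k + 1) / 2) :
    (p k).roots = (s.image (twist k)).val := by
  symm
  refine Multiset.eq_of_le_of_card_le ?_ ?_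
  · rw [Multiset.le_iff_subset (s.image _).nodup]
    intro y hy
    obtain ⟨x, hx, rfl⟩ := Finset.mem_image.1 hy
    exact (Polynomial.mem_roots (p_ne_zero h k)).2 ((mainDet_eq_zero_iff (hs x hx).1).1 (hs x hx).2)
  · rw [h k, Finset.card_val, Finset.card_image_of_injective _ (twist_injective k), hcard]

theorem twist_mem_of_even (hk : Even k) (hζ : ζ < -2) : twist k ζ < -2 := by
  rwa [twist, if_pos hk]

theorem twist_mem_of_odd (hk : Odd k) (hζ : ζ < -2) : -1 / 2 < twist k ζ ∧ twist k ζ < 0 := by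
  rw [twist, if_neg (Nat.not_even_iff_odd.2 hk)]
  refine ⟨?_, inv_lt_zero.2 (by linarith)⟩
  rw [show (-1 / 2 : ℝ) = (-2)⁻¹ by norm_num]
  exact (inv_lt_inv_of_neg (by norm_num) (by linarith)).2 hζ

/-- One of the two values is below `-2` and the other in `(-1/2, 0)`. This keeps zeros of `mainDet`
and `sideDet` from giving the same root. -/
theorem twist_succ_ne {x y : ℝ} (hx : x < -2) (hy : y < -2) : twist k x ≠ twist (k + 1) y := by
  rcases Nat.even_or_odd k with hk | hk
  · have h1 := twist_mem_of_even hk hx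
    have h2 := (twist_mem_of_odd hk.add_one hy).1
    intro h; linarith
  · have h1 := (twist_mem_of_odd hk hx).1
    have h2 := twist_mem_of_even hk.add_one hy
    intro h; linarith

theorem sturmSequence (h : RealZeroCountConjecture) : SturmSequence (-2) mainDet sideDet where
  continuousOn k := continuousOn_hankelDet _ _
  condensation k x hx h0 h1 := by
    have e := hankelDet_condensation (moment x) k (1 - 2 * ((k + 3) / 2 : ℕ))
    rw [show (1 - 2 * ((k + 3) / 2 : ℕ) + 2 : ℤ) = 1 - 2 * ((k + 1) / 2 : ℕ) by omega,
      show (1 - 2 * ((k + 3) / 2 : ℕ) + 1 : ℤ) = -2 * ((k + 1) / 2 : ℕ) by omega] at e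
    have e := e h0
    change mainDet (k + 2) x * mainDet k x = _ - sideDet (k + 1) x ^ 2 at e
    -- One of the two factors is `mainDet (k + 1) x`: the first for even `k`, the second for odd
    -- `k`.
    have : hankelDet (moment x) (k + 1) (1 - 2 * ((k + 3) / 2 : ℕ)) *
        hankelDet (moment x) (k + 1) (1 - 2 * ((k + 1) / 2 : ℕ)) = 0 := by
      rcases Nat.even_or_odd' k with ⟨m, rfl | rfl⟩
      · rw [mainDet, show (2 * m + 1 + 1) / 2 = (2 * m + 1) / 2 + 1 by omega] at h1
        rw [show (2 * m + 3) / 2 = (2 * m + 1) / 2 + 1 by omega, h1, zero_mul]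
      · rw [mainDet, show (2 * m + 1 + 1 + 1) / 2 = (2 * m + 1 + 1) / 2 by omega] at h1
        rw [h1, mul_zero]
    rw [e, this, zero_sub]
  pos k := by
    have := eventually_hankelDet_pos ((k + 1) / 2) (k / 2)
    rwa [show (k + 1) / 2 + k / 2 = k by omega] at this
  sign_atBot m := by
    have := eventually_sign_hankelDet m
    filter_upwards [this] with x hx
    rw [mainDet, show (2 * m + 1 + 1) / 2 = m + 1 by omega]
    exact_mod_cast hx
  -- This is where the assumed number of real zeros enters: a zero of `sideDet` would be a root of
  -- `p k` outside the complete list.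
  count k s hs hcard x hx := by
    have hr := roots_eq_image h hs hcard
    have key : ∀ y, (p k).IsRoot y → ∃ z ∈ s, twist k z = y := by
      intro y hy
      rw [← Polynomial.mem_roots (p_ne_zero h k), hr, Finset.mem_val] at hy
      exact Finset.mem_image.1 hy
    refine ⟨fun h0 => ?_, fun h0 => ?_⟩
    · obtain ⟨z, hz, e⟩ := key _ ((mainDet_eq_zero_iff hx).1 h0)
      rwa [← twist_injective k e]
    · obtain ⟨z, hz, e⟩ := key _ ((sideDet_eq_zero_iff hx).1 h0)
      exact twist_succ_ne (hs z hz).1 hx e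

theorem exists_interlacingZeros (h : RealZeroCountConjecture) (k : ℕ) :
    ∃ u v, InterlacingZeros (-2) mainDet k u v := by
  refine (sturmSequence h).exists_interlacingZeros (by simp [mainDet, hankelDet])
    -- The induction starts from `mainDet 1 ζ = moment ζ (-1) = ζ + 3`.
    (b := -3) (by norm_num) ?_ k
  simp [mainDet, hankelDet]
  change -momB (-3) 0 = 0
  simp [momB, eCoeff_zero, eCoeff'_zero]

theorem roots_eq_image_range (h : RealZeroCountConjecture) {u : ℕ → ℝ}
    (hu : ∀ j < (k + 1) / 2, u j < -2 ∧ mainDet k (u j) = 0)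
    (anti : ∀ i j, i < j → j < (k + 1) / 2 → u j < u i) :
    (p k).roots = (((Finset.range ((k + 1) / 2)).image u).image (twist k)).val := by
  refine roots_eq_image h ?_ ?_
  · intro y hy
    obtain ⟨j, hj, rfl⟩ := Finset.mem_image.1 hy
    exact hu j (Finset.mem_range.1 hj)
  · rw [Finset.card_image_of_injOn, Finset.card_range]
    intro i hi j hj hij
    simp only [Finset.coe_range, mem_Iio] at hi hj
    rcases lt_trichotomy i j with h | h | h
    · exact absurd hij (anti i j h hj).ne'
    · exact h
    · exact absurd hij (anti j i h hi).ne

theorem isRoot_iff_exists (h : RealZeroCountConjecture) {u : ℕ → ℝ}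
    (hu : ∀ j < (k + 1) / 2, u j < -2 ∧ mainDet k (u j) = 0)
    (anti : ∀ i j, i < j → j < (k + 1) / 2 → u j < u i) (y : ℝ) :
    (p k).IsRoot y ↔ ∃ j < (k + 1) / 2, twist k (u j) = y := by
  rw [← Polynomial.mem_roots (p_ne_zero h k), roots_eq_image_range h hu anti]
  simp

theorem reverse_isRoot_iff {P : Polynomial ℝ} (hP : P ≠ 0) (x : ℝ) :
    P.reverse.IsRoot x ↔ x ≠ 0 ∧ P.IsRoot x⁻¹ := by
  rcases eq_or_ne x 0 with rfl | hx
  · simp [Polynomial.IsRoot, ← Polynomial.coeff_zero_eq_eval_zero, hP]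
  · have : Invertible x⁻¹ := invertibleOfNonzero (inv_ne_zero hx)
    have := Polynomial.eval₂_reverse_eq_zero_iff (RingHom.id ℝ) x⁻¹ P
    rw [invOf_eq_inv, inv_inv] at this
    exact ⟨fun h => ⟨hx, this.1 h⟩, fun h => this.2 h.2⟩

theorem InterlacingZeros.left_lt {u v : ℕ → ℝ} (h : InterlacingZeros (-2) mainDet k u v) :
    ∀ j < (k + 1) / 2, u j < -2 ∧ mainDet k (u j) = 0 := fun j hj =>
  ⟨(h.lt j hj).trans (h.right j (by omega)).1, h.left j hj⟩

theorem rootMultiplicity_and_location (h : RealZeroCountConjecture) (hζ : (p k).IsRoot ζ) :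
    (p k).rootMultiplicity ζ = 1 ∧ (Odd k → -1 / 2 < ζ ∧ ζ < 0) ∧ (Even k → ζ < -2) := by
  obtain ⟨u, v, hI⟩ := exists_interlacingZeros h k
  refine ⟨?_, ?_⟩
  · rw [← Polynomial.count_roots]
    have hm := (Polynomial.mem_roots (p_ne_zero h k)).2 hζ
    rw [roots_eq_image_range h hI.left_lt hI.anti_left] at hm ⊢
    exact Multiset.count_eq_one_of_mem (Finset.nodup _) hm
  · obtain ⟨j, hj, rfl⟩ := (isRoot_iff_exists h hI.left_lt hI.anti_left ζ).1 hζ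
    exact ⟨fun hk => twist_mem_of_odd hk (hI.left_lt j hj).1,
      fun hk => twist_mem_of_even hk (hI.left_lt j hj).1⟩

theorem range_eq_of_rev {N : ℕ} {u : ℕ → ℝ} {P : ℝ → Prop}
    (h : ∀ y, P y ↔ ∃ j < N, u j = y) :
    Set.range (fun i : Fin N => u (N - 1 - i)) = {ζ | P ζ} := by
  ext y
  rw [mem_range, mem_ofPred_eq, h]
  constructor
  · rintro ⟨i, hi⟩
    exact ⟨N - 1 - i, by omega, hi⟩
  · rintro ⟨j, hj, hj'⟩
    refine ⟨⟨N - 1 - j, by omega⟩, ?_⟩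
    dsimp only
    rwa [show N - 1 - (N - 1 - j) = j by omega]

theorem strictMono_rev {N : ℕ} {u : ℕ → ℝ} (anti : ∀ i j, i < j → j < N → u j < u i) :
    StrictMono (fun i : Fin N => u (N - 1 - i)) := by
  intro i j hij
  have : (i : ℕ) < j := hij
  exact anti _ _ (by omega) (by omega)

end Zeros

end ThreeColour

/-! ### Assembly of the three claims. -/

theorem proposition3p12 (h : ThreeColour.RealZeroCountConjecture) :
    (∀ (n : ℕ) (ζ : ℝ), (ThreeColour.p n).IsRoot ζ →
      (ThreeColour.p n).rootMultiplicity ζ = 1 ∧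
      (Odd n → -1 / 2 < ζ ∧ ζ < 0) ∧
      (Even n → ζ < -2)) ∧
    (∀ n : ℕ, ∃ (a : Fin n → ℝ) (b c : Fin (n + 1) → ℝ),
      StrictMono a ∧ StrictMono b ∧ StrictMono c ∧
      Set.range a = {ζ : ℝ | (ThreeColour.p (2 * n)).IsRoot ζ} ∧
      Set.range b = {ζ : ℝ | (ThreeColour.p (2 * n + 1)).reverse.IsRoot ζ} ∧
      Set.range c = {ζ : ℝ | (ThreeColour.p (2 * n + 2)).IsRoot ζ} ∧
      (∀ i : Fin n, b i.castSucc < a i ∧ a i < b i.succ) ∧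
      (∀ i : Fin (n + 1), b i < c i) ∧
      (∀ i : Fin n, c i.castSucc < b i.succ)) ∧
    ThreeColour.NonvanishingConjecture := by
  refine ⟨fun n ζ hζ => ThreeColour.rootMultiplicity_and_location h hζ, fun n => ?_, ?_⟩
  · obtain ⟨u, v, huv⟩ := ThreeColour.exists_interlacingZeros h (2 * n)
    obtain ⟨w, hvw⟩ := huv.exists_next (ThreeColour.sturmSequence h)
    -- This extra step serves only to have `w` as a left family, so that it lists all zeros of `p (2
    -- * n + 2)`.
    obtain ⟨w', hw⟩ := hvw.exists_next (ThreeColour.sturmSequence h)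
    have e0 : (2 * n + 1) / 2 = n := by omega
    have e1 : (2 * n + 1 + 1) / 2 = n + 1 := by omega
    have e2 : (2 * n + 2 + 1) / 2 = n + 1 := by omega
    have ha := ThreeColour.isRoot_iff_exists h huv.left_lt huv.anti_left
    have hb := ThreeColour.isRoot_iff_exists h hvw.left_lt hvw.anti_left
    have hc := ThreeColour.isRoot_iff_exists h hw.left_lt hw.anti_left
    have hu := huv.anti_left
    have hv := hvw.anti_left
    have hw' := hw.anti_left
    rw [e0] at ha hu
    rw [e1] at hb hv
    rw [e2] at hc hw'
    -- The families decrease, so the increasing enumerations read them backwards.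
    refine ⟨fun i => u (n - 1 - i), fun i => v (n + 1 - 1 - i), fun i => w (n + 1 - 1 - i),
      ThreeColour.strictMono_rev hu, ThreeColour.strictMono_rev hv, ThreeColour.strictMono_rev hw',
      ThreeColour.range_eq_of_rev ?_, ThreeColour.range_eq_of_rev ?_,
      ThreeColour.range_eq_of_rev ?_, fun i => ⟨?_, ?_⟩, fun i => ?_, fun i => ?_⟩
    · simpa [ThreeColour.twist] using ha
    · intro y
      rw [ThreeColour.reverse_isRoot_iff (ThreeColour.p_ne_zero h _), hb]
      simp only [ThreeColour.twist, Nat.not_even_bit1, if_false, inv_inj]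
      constructor
      · exact And.right
      · rintro ⟨j, hj, rfl⟩
        exact ⟨by have := (hvw.left_lt j (by omega)).1; intro h0; linarith, j, hj, rfl⟩
    · simpa [ThreeColour.twist, Nat.even_add] using hc
    all_goals have hi := i.2
    · have := huv.lt_succ (n - 1 - i) (by omega)
      rw [show n - 1 - (i : ℕ) + 1 = n + 1 - 1 - i by omega] at this
      exact this
    · have := huv.lt (n - 1 - i) (by omega)
      dsimp only
      rw [Fin.val_succ, show n + 1 - 1 - ((i : ℕ) + 1) = n - 1 - i by omega]
      exact this
    · exact hvw.lt (n + 1 - 1 - i) (by omega)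
    · have := hvw.lt_succ (n - 1 - i) (by omega)
      rw [show n - 1 - (i : ℕ) + 1 = n + 1 - 1 - i by omega] at this
      dsimp only
      rw [Fin.val_succ, show n + 1 - 1 - ((i : ℕ) + 1) = n - 1 - i by omega]
      exact this
  · intro n ζ h1 h2 hζ
    obtain ⟨-, h3, h4⟩ := ThreeColour.rootMultiplicity_and_location h hζ
    rcases Nat.even_or_odd n with hn | hn
    · exact lt_asymm h1 (h4 hn)
    · exact lt_asymm h2 (h3 hn).1
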